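/- **Setting.** Let $V$ be the node set of the infinite rooted binary tree. A *heap* is a labelling $\mathrm{val}\colon V\to\mathbb{R}$ with pairwise distinct values such that every node has a smaller label than each of its two children. For $n\ge 1$, the $n$-th smallest label is the label $x$ such that exactly $n$ nodes have a label at most $x$. In the *explorable heap selection problem*, an agent starts at the root, is given $n$, and has to output the $n$-th smallest label. In one step it can move to the left child, the right child or the parent of its current node, and it sees only the label of the node at which it currently resides. The labels are fixed in advance and do not depend on the random choices of the agent (oblivious adversary). **Model.** A randomized algorithm is a fixed finite program, independent of $n$ and of the heap, with finitely many, possibly recursive, procedures. Each procedure activation has finitely many local variables; each variable holds either a natural number or a key, that is, a label of the heap or $\infty$. Keys can only be copied and compared. Integers can be added, subtracted (truncated at $0$) and compared, and a uniformly random element of $\{0,\dots,m\}$ can be drawn. Every instruction, in particular every move along an edge, takes one unit of time; the distance traveled is the number of moves. The space in use is the number of variables of all active procedure activations plus the number of their pending commands, where every integer stored may have only $O(\log n)$ bits. **Theorem.** There is a randomized algorithm that solves the explorable heap selection problem: for every heap and every $n\ge 1$, with probability $1$ it halts and outputs the $n$-th smallest label. Moreover, there is a constant $C$ such that for every $n\ge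 2$ and every heap 1. its expected running time, and hence also the expected distance traveled by the agent, is at most $C\,n\,(\log_2 n)^3$; and 2. in every configuration that is reached with positive probability, it uses at most $C\log_2 n$ memory cells, and every integer in memory has at most $C\log_2 n$ bits. -/

import Mathlib

open scoped ENNReal Topology

/-! ## Explorable heaps -/

namespace ExplorableHeap

/-- Nodes of the infinite rooted binary tree: the root is `[]`, and the two children of `v` are
`false :: v` (left) and `true :: v` (right). -/
abbrev Node : Type := List Bool

/-- A labelling of the infinite binary tree by pairwise distinct reals in which every node has a
smaller label than its two children. -/
structure IsHeap (val : Node → ℝ) : Prop where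
  injective : Function.Injective val
  lt_child : ∀ (v : Node) (b : Bool), val v < val (b :: v)

/-- `x` is the `n`-th smallest label (`n ≥ 1`): it is a label, and exactly `n` nodes have a
label that is at most `x`. -/
def IsNthSmallest (val : Node → ℝ) (n : ℕ) (x : ℝ) : Prop :=
  x ∈ Set.range val ∧ {v : Node | val v ≤ x}.encard = n

/-! ## Programs

A program has finitely many procedures, which may be recursive. Each activation of a procedure
has its own finite set of local variables: word variables (indexed by `W`), which hold natural
numbers, and key variables (indexed by `K`), which hold a label of the heap or the symbol `⊤`
for `∞`. Labels can only be copied and compared. -/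

/-- The directions in which the agent can travel along an edge. -/
inductive Dir : Type
  | up
  | left
  | right

/-- The node reached by a move; at the root, the move `up` has no effect. -/
def Dir.apply : Dir → Node → Node
  | .up, v => v.tail
  | .left, v => false :: v
  | .right, v => true :: v

/-- Integer expressions; `sub` is truncated subtraction. -/
inductive WordExpr (W : Type) : Type
  | lit (m : ℕ)
  | var (i : W)
  | add (a b : WordExpr W)
  | sub (a b : WordExpr W)

def WordExpr.eval {W : Type} (words : W → ℕ) : WordExpr W → ℕ
  | .lit m => m
  | .var i => words i
  | .add a b => a.eval words + b.eval words
  | .sub a b => a.eval words - b.eval words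

/-- Key expressions: `∞`, the content of a key variable, or the label of the node at which the
agent currently resides. -/
inductive KeyExpr (K : Type) : Type
  | infinity
  | var (i : K)
  | here

def KeyExpr.eval {K : Type} (keys : K → WithTop ℝ) (current : ℝ) : KeyExpr K → WithTop ℝ
  | .infinity => ⊤
  | .var i => keys i
  | .here => (current : WithTop ℝ)

/-- Tests: comparisons between integers and between keys, and Boolean combinations of them. -/
inductive Test (W K : Type) : Type
  | wordLt (a b : WordExpr W)
  | keyLt (a b : KeyExpr K)
  | not (a : Test W K)
  | and (a b : Test W K)

def Test.Holds {W K : Type} (words : W → ℕ) (keys : K → WithTop ℝ) (current : ℝ) :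
    Test W K → Prop
  | .wordLt a b => a.eval words < b.eval words
  | .keyLt a b => a.eval keys current < b.eval keys current
  | .not a => ¬ a.Holds words keys current
  | .and a b => a.Holds words keys current ∧ b.Holds words keys current

/-- Commands. `rand i a` stores in the word variable `i` a uniformly random element of
`{0, 1, …, a}`. `call p aw ak rw rk` starts procedure `p` with its local variables initialized by
the expressions `aw` and `ak`, evaluated for the caller; when `p` returns, each variable `i` of the
caller with `rw i = some j` (or `rk i = some j`) takes the value of the variable `j` of `p`, and
the other variables of the caller keep their values. -/
inductive Cmd (W K P : Type) : Type
  | skip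
  | seq (c d : Cmd W K P)
  | ite (b : Test W K) (c d : Cmd W K P)
  | while (b : Test W K) (c : Cmd W K P)
  | setWord (i : W) (a : WordExpr W)
  | setKey (i : K) (a : KeyExpr K)
  | move (d : Dir)
  | rand (i : W) (a : WordExpr W)
  | call (p : P) (aw : W → WordExpr W) (ak : K → KeyExpr K)
      (rw : W → Option W) (rk : K → Option K)

/-- A randomized algorithm is a finite program: a finite set of local variables per activation,
finitely many procedures, a distinguished main procedure, the variable holding its input `n`, and
the variable holding its output. It does not depend on `n` or on the labels. -/
structure Algorithm : Type 1 where
  W : Type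
  K : Type
  P : Type
  [fintypeW : Fintype W]
  [fintypeK : Fintype K]
  [finiteP : Finite P]
  [decidableEqW : DecidableEq W]
  [decidableEqK : DecidableEq K]
  input : W
  output : K
  main : P
  body : P → Cmd W K P

attribute [instance] Algorithm.fintypeW Algorithm.fintypeK Algorithm.finiteP
  Algorithm.decidableEqW Algorithm.decidableEqK

/-! ## Executions -/

/-- The record of one procedure activation: the local variables, and the commands of this
activation that are still to be executed, in order. -/
@[ext]
structure Frame (W K P : Type) : Type where
  words : W → ℕ
  keys : K → WithTop ℝ
  todo : List (Cmd W K P)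

/-- A configuration: the node at which the agent resides and the stack of active procedure
activations, innermost first. -/
@[ext]
structure Config (W K P : Type) : Type where
  pos : Node
  stack : List (Frame W K P)

namespace Algorithm

variable (A : Algorithm)

/-- The initial configuration: the agent is at the root and the main procedure is about to start,
with input `n`, all other word variables `0`, and all key variables `∞`. -/
def init (n : ℕ) : Config A.W A.K A.P where
  pos := []
  stack := [{ words := Function.update (fun _ => 0) A.input n
              keys := fun _ => ⊤
              todo := [A.body A.main] }]

/-- Execution of the command `cmd` by the activation with variables `words` and `keys` and
remaining commands `todo`, below which the stack is `rest`. While a called procedure is active,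
the `call` command stays at the head of the caller's list; it is removed on return. -/
noncomputable def exec (val : Node → ℝ) (pos : Node) (words : A.W → ℕ) (keys : A.K → WithTop ℝ)
    (todo : List (Cmd A.W A.K A.P)) (rest : List (Frame A.W A.K A.P)) :
    Cmd A.W A.K A.P → PMF (Config A.W A.K A.P)
  | .skip => PMF.pure ⟨pos, ⟨words, keys, todo⟩ :: rest⟩
  | .seq c d => PMF.pure ⟨pos, ⟨words, keys, c :: d :: todo⟩ :: rest⟩
  | .ite b c d => by
      classical
      exact PMF.pure
        (if b.Holds words keys (val pos) then ⟨pos, ⟨words, keys, c :: todo⟩ :: rest⟩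
          else ⟨pos, ⟨words, keys, d :: todo⟩ :: rest⟩)
  | .while b c => by
      classical
      exact PMF.pure
        (if b.Holds words keys (val pos) then
          ⟨pos, ⟨words, keys, c :: .while b c :: todo⟩ :: rest⟩
          else ⟨pos, ⟨words, keys, todo⟩ :: rest⟩)
  | .setWord i a =>
      PMF.pure ⟨pos, ⟨Function.update words i (a.eval words), keys, todo⟩ :: rest⟩
  | .setKey i a =>
      PMF.pure ⟨pos, ⟨words, Function.update keys i (a.eval keys (val pos)), todo⟩ :: rest⟩
  | .move d => PMF.pure ⟨d.apply pos, ⟨words, keys, todo⟩ :: rest⟩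
  | .rand i a =>
      (PMF.uniformOfFintype (Fin (a.eval words + 1))).map fun x =>
        ⟨pos, ⟨Function.update words i x, keys, todo⟩ :: rest⟩
  | .call p aw ak rw rk =>
      PMF.pure ⟨pos,
        ⟨fun i => (aw i).eval words, fun i => (ak i).eval keys (val pos), [A.body p]⟩ ::
        ⟨words, keys, .call p aw ak rw rk :: todo⟩ :: rest⟩

/-- One step of the computation. If the innermost activation has no commands left, it returns to
its caller; if it has no caller, the computation has halted and the configuration stays put. -/
noncomputable def step (val : Node → ℝ) (c : Config A.W A.K A.P) : PMF (Config A.W A.K A.P) :=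
  match c.stack with
  | ⟨words, keys, cmd :: todo⟩ :: rest => A.exec val c.pos words keys todo rest cmd
  | ⟨words, keys, []⟩ :: ⟨words', keys', .call _ _ _ rw rk :: todo⟩ :: rest =>
      PMF.pure ⟨c.pos,
        ⟨fun i => (rw i).elim (words' i) words, fun i => (rk i).elim (keys' i) keys, todo⟩ ::
        rest⟩
  | _ => PMF.pure c

/-- The distribution of the configuration after `t` steps, on the heap with labels `val` (which are
fixed before the execution) and with input `n`. -/
noncomputable def run (val : Node → ℝ) (n : ℕ) : ℕ → PMF (Config A.W A.K A.P)
  | 0 => PMF.pure (A.init n)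
  | t + 1 => (run val n t).bind (A.step val)

/-- The computation has halted: only the main procedure is active and it is finished. -/
def Halted (c : Config A.W A.K A.P) : Prop :=
  ∃ f : Frame A.W A.K A.P, c.stack = [f] ∧ f.todo = []

/-- The computation has halted and its output is `x`. -/
def HaltedWith (c : Config A.W A.K A.P) (x : ℝ) : Prop :=
  ∃ f : Frame A.W A.K A.P, c.stack = [f] ∧ f.todo = [] ∧ f.keys A.output = (x : WithTop ℝ)

/-- The next step of the computation is a move of the agent along an edge. -/
def IsMoving (c : Config A.W A.K A.P) : Prop :=
  ∃ (f : Frame A.W A.K A.P) (d : Dir) (todo : List (Cmd A.W A.K A.P))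
    (rest : List (Frame A.W A.K A.P)), c.stack = f :: rest ∧ f.todo = .move d :: todo

/-- The expected running time `E[τ] = ∑ₜ Pr[τ > t]`, where `τ` is the number of steps
before halting (it is infinite if the computation fails to halt with positive probability). -/
noncomputable def expectedTime (val : Node → ℝ) (n : ℕ) : ℝ≥0∞ :=
  ∑' t : ℕ, (A.run val n t).toOuterMeasure {c | ¬ A.Halted c}

/-- The expected distance travelled by the agent: the expected number of moves, which is the sum
over `t` of the probability that step `t` is a move. -/
noncomputable def expectedTravel (val : Node → ℝ) (n : ℕ) : ℝ≥0∞ :=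
  ∑' t : ℕ, (A.run val n t).toOuterMeasure {c | A.IsMoving c}

/-- The number of memory cells in use: all local variables of all active procedure activations,
and one cell for each of their pending commands. -/
def cells (c : Config A.W A.K A.P) : ℕ :=
  (c.stack.map fun f => Fintype.card A.W + Fintype.card A.K + f.todo.length).sum

/-- All integers in memory have at most `b` bits. -/
def WordsFit (c : Config A.W A.K A.P) (b : ℝ) : Prop :=
  ∀ f ∈ c.stack, ∀ i : A.W, ((f.words i).size : ℝ) ≤ b

/-- The algorithm solves the selection problem: for every heap and every `n ≥ 1`, with
probability `1` it halts and outputs the `n`-th smallest label. -/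
def Solves : Prop :=
  ∀ val : Node → ℝ, IsHeap val → ∀ n : ℕ, 1 ≤ n →
    Filter.Tendsto
      (fun t : ℕ => (A.run val n t).toOuterMeasure
        {c | ∃ x : ℝ, IsNthSmallest val n x ∧ A.HaltedWith c x})
      Filter.atTop (𝓝 1)

/-- On every heap, on input `n`, in every configuration that has positive probability of being
reached, at most `s` memory cells are in use and all integers in memory have at most `b` bits. -/
def UsesSpace (n : ℕ) (s b : ℝ) : Prop :=
  ∀ val : Node → ℝ, IsHeap val → ∀ t : ℕ, ∀ c ∈ (A.run val n t).support,
    (A.cells c : ℝ) ≤ s ∧ A.WordsFit c b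

end Algorithm

end ExplorableHeap

namespace ExplorableHeap

/-! ## Expected cost of a computation -/

/-! One quantity carries correctness, time and space together. A running configuration costs 1, a
configuration halted with the right output costs 0, and a configuration that breaks the memory
bounds or halts with a wrong output costs ∞ (`Limits.price`). If the expected total price
`Limits.total` is finite, it bounds the expected time and hence the travel, it forces halting with
the right output with probability 1, and every configuration of positive probability respects the
memory bounds. The total is estimated by an expected-cost transformer `Limits.wp`, which is monotone
and compositional over commands; loops are treated by induction on a quantity that decreases in
every execution.

The procedure `ext` works at a node `v`, knows that exactly `k` labels of the subtree are at most
`L₀`, and looks for the label `X` of rank `n`. Removing the known nodes leaves a forest with at most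
`n` roots. Bounds `L ≤ X < U` are maintained. A round draws a uniformly random root whose subtree
has a label in `(L, U)` and tests the smallest such label. If it exceeds `X`, it becomes `U`.
Otherwise the subtree of this root is explored until `L` is its largest label that is at most `X`:
if `c` of its labels are known, a recursive call finds its label of rank `c + s` with `s` about `c /
2`; this is repeated until `X` is reached or a call fails, that is, returns a label above `X`, and
after a failure the gap is closed by a random binary search. Whether a label exceeds `X` is decided
by counting the labels up to it, capped at `n + 1`, on a depth-first walk of length `O(n)`. Nodes
are addressed by their labels, so no path is ever stored.

Write `λ` for a bound on `1 + log n`. Call a root live if its subtree has a label in `(L, X]`.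
Exploring a live root leaves live only the roots with a larger last label up to `X`, so under a
uniform choice the harmonic number of the number of live roots drops by one on average; the roots
that can still lower `U` behave in the same way (`sum_harmonic_union_le`). This gives `O(λ)`
expected rounds, each with overhead `O(n λ)` besides the recursive calls.

The delicate point is the recursion. The successful calls for one root fetch labels that stay known,
but the failing call is wasted, and charging half of the subtree for it would multiply the bound by
a constant at every level. Instead, with `g` labels up to `X` and `c` labels up to `L` in the
subtree of a live root, the potential `ψ` is the sum of `g - c / 2` over the live roots. It starts
at no more than `n - k`, and the expected recursive work of a round plus the new `ψ` is at most the
old `ψ` (`sum_charge_le`, `Level.sum_psi_le`, with `Level.le_failBound` limiting the waste). So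
nothing is lost from level to level: if `m` missing labels cost `w (n + 6 m μ)`, then up to twice as
many cost the same with `μ + 1` in place of `μ`, where `w = O(λ ^ 2)` (`Limits.cost_extBody_rounds`,
`Limits.extSpec`). The number of missing labels at least halves per level, the depth is at most
`log₂ n + 1` below the outermost call, and the product of `n`, `λ ^ 2` and the depth is the time
bound. Each level uses a bounded number of memory cells. -/

theorem tsum_pure_mul {α : Type*} (a : α) (f : α → ℝ≥0∞) :
    ∑' b, (PMF.pure a) b * f b = f a := by
  rw [tsum_eq_single a]
  · simp
  · intro b hb
    simp [PMF.pure_apply, hb]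

theorem tsum_bind_mul {α β : Type*} (p : PMF α) (q : α → PMF β) (f : β → ℝ≥0∞) :
    ∑' b, (p.bind q) b * f b = ∑' a, p a * ∑' b, q a b * f b := by
  simp only [PMF.bind_apply, ← ENNReal.tsum_mul_right, ← ENNReal.tsum_mul_left]
  rw [ENNReal.tsum_comm]
  simp only [mul_assoc]

theorem tsum_map_mul {α β : Type*} (p : PMF α) (q : α → β) (f : β → ℝ≥0∞) :
    ∑' b, (p.map q) b * f b = ∑' a, p a * f (q a) := by
  rw [PMF.map, tsum_bind_mul]
  simp only [Function.comp, tsum_pure_mul]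

/-- The part of a configuration that a command reads and writes: the position of the agent and the
local variables of the innermost activation. -/
structure Local (W K : Type) : Type where
  pos : Node
  words : W → ℕ
  keys : K → WithTop ℝ

/-- The largest number of commands by which a command is replaced during its execution. -/
def Cmd.height {W K P : Type} : Cmd W K P → ℕ
  | .seq c d => max (c.height + 1) d.height
  | .ite _ c d => max c.height d.height
  | .while _ c => c.height + 1
  | _ => 1

theorem Cmd.one_le_height {W K P : Type} (c : Cmd W K P) : 1 ≤ c.height := by
  induction c <;> simp_all [Cmd.height]

/-- A heap together with bounds on the memory and a set of accepted outputs. -/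
structure Limits : Type where
  val : Node → ℝ
  space : ℕ
  bound : ℕ
  accept : WithTop ℝ → Prop

namespace Limits

variable (E : Limits) {A : Algorithm}

/-- The configuration respects the memory bounds. -/
def Fits (c : Config A.W A.K A.P) : Prop :=
  A.cells c ≤ E.space ∧ ∀ f ∈ c.stack, ∀ i, f.words i ≤ E.bound

open Classical in
/-- The cost of a configuration: `1` while the computation is running, `0` once it has halted
with an accepted output, and `∞` if the memory bounds are violated or the output is wrong. -/
noncomputable def price (c : Config A.W A.K A.P) : ℝ≥0∞ :=
  if E.Fits c then
    if A.Halted c then if ∃ f ∈ c.stack, E.accept (f.keys A.output) then 0 else ⊤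
    else 1
  else ⊤

/-- The distribution after `t` steps from a given configuration. -/
noncomputable def iter : ℕ → Config A.W A.K A.P → PMF (Config A.W A.K A.P)
  | 0, c => PMF.pure c
  | t + 1, c => (A.step E.val c).bind (iter t)

/-- The expected total price of a computation. -/
noncomputable def total (c : Config A.W A.K A.P) : ℝ≥0∞ :=
  ∑' t, ∑' c', E.iter t c c' * E.price c'

/-- Splitting off time 0 yields the one-step equation of the Markov chain. As `total` is an actual
sum over time and not a chosen fixed point of this equation, non-termination with positive
probability makes it infinite. -/
theorem total_eq (c : Config A.W A.K A.P) :
    E.total c = E.price c + ∑' c', A.step E.val c c' * E.total c' := by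
  rw [total, tsum_eq_zero_add' ENNReal.summable]
  congr 1
  · simp [iter]
  · simp only [iter, tsum_bind_mul]
    rw [ENNReal.tsum_comm]
    simp only [ENNReal.tsum_mul_left, total]

theorem run_eq_iter (n t : ℕ) : A.run E.val n t = E.iter t (A.init n) := by
  have key : ∀ (t : ℕ) (c : Config A.W A.K A.P),
      (E.iter t c).bind (A.step E.val) = E.iter (t + 1) c := by
    intro t
    induction t with
    | zero =>
      intro c
      simp only [iter, PMF.pure_bind]
      exact (PMF.bind_pure _).symm
    | succ t ih =>
      intro c
      rw [iter, PMF.bind_bind]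
      simp only [ih]
      rfl
  induction t with
  | zero => rfl
  | succ t ih => rw [Algorithm.run, ih, key]

theorem total_of_running {c : Config A.W A.K A.P} (hc : E.Fits c) (hh : ¬ A.Halted c) :
    E.total c = 1 + ∑' c', A.step E.val c c' * E.total c' := by
  rw [total_eq, price, if_pos hc, if_neg hh]

/-- A halted configuration steps to itself forever, so the sum is finite only because the price of
an accepted one is 0. -/
theorem total_of_halted {pos : Node} {words : A.W → ℕ} {keys : A.K → WithTop ℝ}
    (hc : E.Fits (A := A) ⟨pos, [⟨words, keys, []⟩]⟩) (ha : E.accept (keys A.output)) :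
    E.total (A := A) ⟨pos, [⟨words, keys, []⟩]⟩ = 0 := by
  have hp : E.price (A := A) ⟨pos, [⟨words, keys, []⟩]⟩ = 0 := by
    rw [price, if_pos hc, if_pos ⟨_, rfl, rfl⟩, if_pos ⟨_, List.mem_singleton_self _, ha⟩]
  have hi : ∀ t, E.iter (A := A) t ⟨pos, [⟨words, keys, []⟩]⟩
      = PMF.pure ⟨pos, [⟨words, keys, []⟩]⟩ := by
    intro t
    induction t with
    | zero => rfl
    | succ t ih =>
      rw [iter]
      simp only [Algorithm.step, PMF.pure_bind, ih]
  simp only [total, hi, tsum_pure_mul, hp, tsum_zero]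

/-- The configuration in which the innermost activation has local state `σ` and pending commands
`todo`, on top of `rest`. -/
def cfg (σ : Local A.W A.K) (todo : List (Cmd A.W A.K A.P)) (rest : List (Frame A.W A.K A.P)) :
    Config A.W A.K A.P :=
  ⟨σ.pos, ⟨σ.words, σ.keys, todo⟩ :: rest⟩

/-- The number of variables of an activation. -/
def _root_.ExplorableHeap.Algorithm.vars (A : Algorithm) : ℕ :=
  Fintype.card A.W + Fintype.card A.K

/-- There are at least `d` free memory cells. -/
def Room (d : ℕ) (todo : List (Cmd A.W A.K A.P)) (rest : List (Frame A.W A.K A.P)) : Prop :=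
  A.cells ⟨[], rest⟩ + A.vars + todo.length + d ≤ E.space ∧
    ∀ f ∈ rest, ∀ i, f.words i ≤ E.bound

/-- All words of the local state are within the bound. -/
def Small {W K : Type} (σ : Local W K) : Prop := ∀ i, σ.words i ≤ E.bound

theorem fits_cfg {d : ℕ} {todo : List (Cmd A.W A.K A.P)} {rest : List (Frame A.W A.K A.P)}
    {σ : Local A.W A.K} (h : E.Room d todo rest) (hσ : E.Small σ)
    (l : List (Cmd A.W A.K A.P)) (hl : l.length ≤ d) : E.Fits (cfg σ (l ++ todo) rest) := by
  obtain ⟨h1, h2⟩ := h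
  constructor
  · simp only [Algorithm.cells, Algorithm.vars, cfg, List.map_cons, List.sum_cons,
      List.length_append] at h1 ⊢
    omega
  · intro f hf
    rcases List.mem_cons.1 hf with rfl | hf
    · exact hσ
    · exact h2 f hf

theorem Room.cons {d : ℕ} {todo : List (Cmd A.W A.K A.P)} {rest : List (Frame A.W A.K A.P)}
    (h : E.Room (d + 1) todo rest) (c : Cmd A.W A.K A.P) : E.Room d (c :: todo) rest :=
  ⟨by have := h.1; simp only [List.length_cons]; omega, h.2⟩

theorem not_halted_cons {σ : Local A.W A.K} {c : Cmd A.W A.K A.P}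
    {todo : List (Cmd A.W A.K A.P)} {rest : List (Frame A.W A.K A.P)} :
    ¬ A.Halted (cfg σ (c :: todo) rest) := by
  rintro ⟨f, hf, hf'⟩
  simp only [cfg, List.cons.injEq] at hf
  rw [← hf.1] at hf'
  simp at hf'

/-- The worst expected price of executing `c` from the local state `σ` with `d` free memory cells,
if the expected price of continuing from a local state `τ` is at most `f τ`. -/
noncomputable def wp (d : ℕ) (c : Cmd A.W A.K A.P) (f : Local A.W A.K → ℝ≥0∞)
    (σ : Local A.W A.K) : ℝ≥0∞ :=
  ⨆ (todo : List (Cmd A.W A.K A.P)) (rest : List (Frame A.W A.K A.P)) (_ : E.Room d todo rest)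
    (_ : ∀ τ, E.Small τ → E.total (cfg τ todo rest) ≤ f τ), E.total (cfg σ (c :: todo) rest)

theorem wp_le {d : ℕ} {c : Cmd A.W A.K A.P} {f : Local A.W A.K → ℝ≥0∞} {σ : Local A.W A.K}
    {b : ℝ≥0∞}
    (h : ∀ todo rest, E.Room d todo rest →
      (∀ τ, E.Small τ → E.total (cfg τ todo rest) ≤ f τ) →
      E.total (cfg σ (c :: todo) rest) ≤ b) : E.wp d c f σ ≤ b :=
  iSup_le fun todo => iSup_le fun rest => iSup_le fun h1 => iSup_le fun h2 => h todo rest h1 h2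

theorem le_wp {d : ℕ} {c : Cmd A.W A.K A.P} {f : Local A.W A.K → ℝ≥0∞} {σ : Local A.W A.K}
    {todo : List (Cmd A.W A.K A.P)} {rest : List (Frame A.W A.K A.P)} (h1 : E.Room d todo rest)
    (h2 : ∀ τ, E.Small τ → E.total (cfg τ todo rest) ≤ f τ) :
    E.total (cfg σ (c :: todo) rest) ≤ E.wp d c f σ :=
  le_iSup_of_le todo <| le_iSup_of_le rest <| le_iSup_of_le h1 <| le_iSup_of_le h2 le_rfl

theorem wp_mono {d : ℕ} {c : Cmd A.W A.K A.P} {f g : Local A.W A.K → ℝ≥0∞} {σ : Local A.W A.K}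
    (h : ∀ τ, E.Small τ → f τ ≤ g τ) : E.wp d c f σ ≤ E.wp d c g σ :=
  E.wp_le fun _ _ h1 h2 => E.le_wp h1 fun τ hτ => (h2 τ hτ).trans (h τ hτ)

theorem total_cons {σ : Local A.W A.K} {d : ℕ} {c : Cmd A.W A.K A.P}
    {todo : List (Cmd A.W A.K A.P)} {rest : List (Frame A.W A.K A.P)}
    (h : E.Room d todo rest) (hd : 1 ≤ d) (hσ : E.Small σ) :
    E.total (cfg σ (c :: todo) rest) =
      1 + ∑' c', A.exec E.val σ.pos σ.words σ.keys todo rest c c' * E.total c' := by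
  rw [E.total_of_running (c := cfg σ (c :: todo) rest) (E.fits_cfg h hσ [c] (by simpa using hd))
    not_halted_cons]
  rfl

theorem wp_skip {d : ℕ} (hd : 1 ≤ d) {f : Local A.W A.K → ℝ≥0∞} {σ : Local A.W A.K}
    (hσ : E.Small σ) : E.wp d (.skip : Cmd A.W A.K A.P) f σ ≤ 1 + f σ := by
  refine E.wp_le fun todo rest h1 h2 => ?_
  rw [E.total_cons h1 hd hσ, Algorithm.exec, tsum_pure_mul]
  gcongr
  exact h2 σ hσ

/-- The pending second command occupies a cell while the first one runs, which therefore has one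
free cell fewer. -/
theorem wp_seq {d : ℕ} {c c' : Cmd A.W A.K A.P} {f : Local A.W A.K → ℝ≥0∞}
    {σ : Local A.W A.K} (hσ : E.Small σ) :
    E.wp (d + 1) (.seq c c') f σ ≤ 1 + E.wp d c (E.wp (d + 1) c' f) σ := by
  refine E.wp_le fun todo rest h1 h2 => ?_
  rw [E.total_cons h1 (by omega) hσ, Algorithm.exec, tsum_pure_mul]
  gcongr
  exact E.le_wp (Room.cons E h1 _) fun τ _ => E.le_wp h1 h2

open Classical in
theorem wp_ite {d : ℕ} (hd : 1 ≤ d) {b : Test A.W A.K} {c c' : Cmd A.W A.K A.P}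
    {f : Local A.W A.K → ℝ≥0∞} {σ : Local A.W A.K} (hσ : E.Small σ) :
    E.wp d (.ite b c c') f σ ≤
      1 + if b.Holds σ.words σ.keys (E.val σ.pos) then E.wp d c f σ else E.wp d c' f σ := by
  refine E.wp_le fun todo rest h1 h2 => ?_
  rw [E.total_cons h1 hd hσ, Algorithm.exec, tsum_pure_mul]
  gcongr
  split_ifs
  · exact E.le_wp h1 h2
  · exact E.le_wp h1 h2

open Classical in
theorem wp_while {d : ℕ} {b : Test A.W A.K} {c : Cmd A.W A.K A.P}
    {f : Local A.W A.K → ℝ≥0∞} {σ : Local A.W A.K} (hσ : E.Small σ) :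
    E.wp (d + 1) (.while b c) f σ ≤
      1 + if b.Holds σ.words σ.keys (E.val σ.pos) then E.wp d c (E.wp (d + 1) (.while b c) f) σ
        else f σ := by
  refine E.wp_le fun todo rest h1 h2 => ?_
  rw [E.total_cons h1 (by omega) hσ, Algorithm.exec, tsum_pure_mul]
  gcongr
  split_ifs
  · exact E.le_wp (Room.cons E h1 _) fun τ _ => E.le_wp h1 h2
  · exact h2 σ hσ

theorem wp_setWord {d : ℕ} (hd : 1 ≤ d) {i : A.W} {a : WordExpr A.W}
    {f : Local A.W A.K → ℝ≥0∞} {σ : Local A.W A.K} (hσ : E.Small σ)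
    (ha : a.eval σ.words ≤ E.bound) :
    E.wp d (.setWord i a : Cmd A.W A.K A.P) f σ ≤
      1 + f ⟨σ.pos, Function.update σ.words i (a.eval σ.words), σ.keys⟩ := by
  refine E.wp_le fun todo rest h1 h2 => ?_
  rw [E.total_cons h1 hd hσ, Algorithm.exec, tsum_pure_mul]
  gcongr
  refine h2 ⟨_, _, _⟩ fun j => ?_
  by_cases hj : j = i
  · subst hj
    simpa using ha
  · simpa [hj] using hσ j

theorem wp_setKey {d : ℕ} (hd : 1 ≤ d) {i : A.K} {a : KeyExpr A.K}
    {f : Local A.W A.K → ℝ≥0∞} {σ : Local A.W A.K} (hσ : E.Small σ) :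
    E.wp d (.setKey i a : Cmd A.W A.K A.P) f σ ≤
      1 + f ⟨σ.pos, σ.words, Function.update σ.keys i (a.eval σ.keys (E.val σ.pos))⟩ := by
  refine E.wp_le fun todo rest h1 h2 => ?_
  rw [E.total_cons h1 hd hσ, Algorithm.exec, tsum_pure_mul]
  gcongr
  exact h2 ⟨_, _, _⟩ hσ

theorem wp_move {d : ℕ} (hd : 1 ≤ d) {m : Dir} {f : Local A.W A.K → ℝ≥0∞}
    {σ : Local A.W A.K} (hσ : E.Small σ) :
    E.wp d (.move m : Cmd A.W A.K A.P) f σ ≤ 1 + f ⟨m.apply σ.pos, σ.words, σ.keys⟩ := by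
  refine E.wp_le fun todo rest h1 h2 => ?_
  rw [E.total_cons h1 hd hσ, Algorithm.exec, tsum_pure_mul]
  gcongr
  exact h2 ⟨_, _, _⟩ hσ

theorem wp_rand {d : ℕ} (hd : 1 ≤ d) {i : A.W} {a : WordExpr A.W}
    {f : Local A.W A.K → ℝ≥0∞} {σ : Local A.W A.K} (hσ : E.Small σ)
    (ha : a.eval σ.words ≤ E.bound) :
    E.wp d (.rand i a : Cmd A.W A.K A.P) f σ ≤
      1 + (∑ x ∈ Finset.range (a.eval σ.words + 1),
        f ⟨σ.pos, Function.update σ.words i x, σ.keys⟩) / (a.eval σ.words + 1 : ℕ) := by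
  refine E.wp_le fun todo rest h1 h2 => ?_
  rw [E.total_cons h1 hd hσ, Algorithm.exec, tsum_map_mul]
  change 1 + ∑' b, (PMF.bind (PMF.uniformOfFintype (Fin (a.eval σ.words + 1)))
    fun x => PMF.pure (x : ℕ)) b * E.total (cfg ⟨σ.pos, Function.update σ.words i b, σ.keys⟩
      todo rest) ≤ _
  rw [tsum_bind_mul, tsum_fintype]
  simp only [tsum_pure_mul, PMF.uniformOfFintype_apply, Fintype.card_fin]
  rw [← Finset.mul_sum, mul_comm, ← div_eq_mul_inv,
    Finset.sum_range (n := a.eval σ.words + 1)]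
  gcongr with x
  refine h2 ⟨_, _, _⟩ fun j => ?_
  by_cases hj : j = i
  · subst hj
    have := x.2
    simp only [Function.update_self]
    omega
  · simpa [hj] using hσ j

/-- The called activation takes `A.vars` cells, and one more cell is lost to the `call` that stays
pending in the caller. The two added units of time are the call and the return. -/
theorem wp_call {d : ℕ} {p : A.P} {aw : A.W → WordExpr A.W} {ak : A.K → KeyExpr A.K}
    {rw : A.W → Option A.W} {rk : A.K → Option A.K}
    {f : Local A.W A.K → ℝ≥0∞} {σ : Local A.W A.K} (hσ : E.Small σ) :
    E.wp (d + (A.vars + 1)) (.call p aw ak rw rk : Cmd A.W A.K A.P) f σ ≤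
      1 + E.wp d (A.body p) (fun τ => 1 + f ⟨τ.pos, fun i => (rw i).elim (σ.words i) τ.words,
          fun i => (rk i).elim (σ.keys i) τ.keys⟩)
        ⟨σ.pos, fun i => (aw i).eval σ.words, fun i => (ak i).eval σ.keys (E.val σ.pos)⟩ := by
  refine E.wp_le fun todo rest h1 h2 => ?_
  rw [E.total_cons h1 (by omega) hσ, Algorithm.exec, tsum_pure_mul]
  gcongr
  have hroom : E.Room (A := A) d []
      (⟨σ.words, σ.keys, .call p aw ak rw rk :: todo⟩ :: rest) := by
    refine ⟨?_, ?_⟩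
    · have := h1.1
      simp only [Algorithm.cells, Algorithm.vars, List.map_cons, List.sum_cons,
        List.length_cons, List.length_nil] at this ⊢
      omega
    · intro g hg
      rcases List.mem_cons.1 hg with rfl | hg
      · exact hσ
      · exact h1.2 g hg
  refine E.le_wp (σ := ⟨_, _, _⟩) hroom fun τ hτ => ?_
  have hnh : ¬ A.Halted (cfg τ [] (⟨σ.words, σ.keys, .call p aw ak rw rk :: todo⟩ :: rest)) := by
    rintro ⟨g, hg, -⟩
    simp [cfg] at hg
  rw [E.total_of_running (c := cfg τ [] _) (E.fits_cfg hroom hτ [] (by simp)) hnh]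
  simp only [cfg, Algorithm.step]
  rw [tsum_pure_mul]
  gcongr
  refine h2 ⟨_, _, _⟩ fun i => ?_
  simp only
  cases rw i with
  | none => exact hσ i
  | some j => exact hτ j

open Classical in
/-- A computed upper bound for `wp`; loops and calls are left to be treated separately. -/
noncomputable def ert : ℕ → Cmd A.W A.K A.P → (Local A.W A.K → ℝ≥0∞) → Local A.W A.K → ℝ≥0∞
  | _, .skip, f, σ => 1 + f σ
  | d, .seq c c', f, σ => 1 + ert (d - 1) c (ert d c' f) σ
  | d, .ite b c c', f, σ =>
      1 + if b.Holds σ.words σ.keys (E.val σ.pos) then ert d c f σ else ert d c' f σ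
  | d, .while b c, f, σ => E.wp d (.while b c) f σ
  | _, .setWord i a, f, σ =>
      1 + if a.eval σ.words ≤ E.bound then
        f ⟨σ.pos, Function.update σ.words i (a.eval σ.words), σ.keys⟩ else ⊤
  | _, .setKey i a, f, σ =>
      1 + f ⟨σ.pos, σ.words, Function.update σ.keys i (a.eval σ.keys (E.val σ.pos))⟩
  | _, .move m, f, σ => 1 + f ⟨m.apply σ.pos, σ.words, σ.keys⟩
  | _, .rand i a, f, σ =>
      1 + if a.eval σ.words ≤ E.bound then
        (∑ x ∈ Finset.range (a.eval σ.words + 1),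
          f ⟨σ.pos, Function.update σ.words i x, σ.keys⟩) / (a.eval σ.words + 1 : ℕ) else ⊤
  | d, .call p aw ak rw rk, f, σ => E.wp d (.call p aw ak rw rk) f σ

/-- For code without loops and calls, `c.height ≤ d` is the whole memory check. The bound on stored
integers is enforced by the value `⊤` in the rules for `setWord` and `rand`. -/
theorem wp_le_ert {d : ℕ} {c : Cmd A.W A.K A.P} {f : Local A.W A.K → ℝ≥0∞} {σ : Local A.W A.K}
    (hσ : E.Small σ) (hd : c.height ≤ d) : E.wp d c f σ ≤ E.ert d c f σ := by
  induction c generalizing d f σ with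
  | skip => exact E.wp_skip hd hσ
  | seq c c' ih ih' =>
    simp only [Cmd.height, sup_le_iff] at hd
    obtain ⟨d, rfl⟩ : ∃ e, d = e + 1 := ⟨d - 1, by omega⟩
    refine (E.wp_seq hσ).trans ?_
    rw [ert]
    gcongr
    exact (E.wp_mono fun τ hτ => ih' hτ hd.2).trans (ih hσ (by omega))
  | ite b c c' ih ih' =>
    simp only [Cmd.height, sup_le_iff] at hd
    refine (E.wp_ite (c.one_le_height.trans hd.1) hσ).trans ?_
    rw [ert]
    gcongr
    split_ifs
    · exact ih hσ hd.1
    · exact ih' hσ hd.2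
  | setWord i a =>
    rw [ert]
    split_ifs with h
    · exact E.wp_setWord hd hσ h
    · simp
  | setKey i a => exact E.wp_setKey hd hσ
  | move m => exact E.wp_move hd hσ
  | rand i a =>
    rw [ert]
    split_ifs with h
    · exact E.wp_rand hd hσ h
    · simp
  | _ => exact le_rfl

end Limits

/-! ## The program -/

/-- The word variables of an activation. -/
inductive WVar : Type
  | w0 | w1 | w2 | w3 | w4 | w5
  deriving DecidableEq

/-- The key variables of an activation. -/
inductive KVar : Type
  | k0 | k1 | k2 | k3 | k4 | k5 | k6 | k7
  deriving DecidableEq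

/-- The procedures of the program. -/
inductive Proc : Type
  | main | ext | pick | query | find | scan
  deriving DecidableEq

open WVar KVar

instance : Fintype WVar := ⟨{w0, w1, w2, w3, w4, w5}, fun x => by cases x <;> decide⟩

instance : Fintype KVar := ⟨{k0, k1, k2, k3, k4, k5, k6, k7}, fun x => by cases x <;> decide⟩

instance : Fintype Proc :=
  ⟨{.main, .ext, .pick, .query, .find, .scan}, fun x => by cases x <;> decide⟩

/-- The words with given contents. -/
def mkW (a b c d e f : ℕ) : WVar → ℕ
  | w0 => a
  | w1 => b
  | w2 => c
  | w3 => d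
  | w4 => e
  | w5 => f

/-- The keys with given contents. -/
def mkK (a b c d e f g h : WithTop ℝ) : KVar → WithTop ℝ
  | k0 => a
  | k1 => b
  | k2 => c
  | k3 => d
  | k4 => e
  | k5 => f
  | k6 => g
  | k7 => h

/-- The table of word expressions with given entries. -/
def mkWE (a b c d e f : WordExpr WVar) : WVar → WordExpr WVar
  | w0 => a
  | w1 => b
  | w2 => c
  | w3 => d
  | w4 => e
  | w5 => f

/-- The table of key expressions with given entries. -/
def mkKE (a b c d e f g h : KeyExpr KVar) : KVar → KeyExpr KVar
  | k0 => a
  | k1 => b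
  | k2 => c
  | k3 => d
  | k4 => e
  | k5 => f
  | k6 => g
  | k7 => h

/-- The commands of the program. -/
abbrev Com : Type := Cmd WVar KVar Proc

/-- Words that are not passed to a procedure. -/
abbrev zeroE : WordExpr WVar := .lit 0

abbrev infE : KeyExpr KVar := .infinity

/-- Return nothing. -/
def noW : WVar → Option WVar := fun _ => none

def noK : KVar → Option KVar := fun _ => none

/-- Return the variable `j` of the called procedure in the variable `i`. -/
def retW (i j : WVar) : WVar → Option WVar := fun x => if x = i then some j else none

def retK (i j : KVar) : KVar → Option KVar := fun x => if x = i then some j else none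

def retK2 (i j i' j' : KVar) : KVar → Option KVar := fun x =>
  if x = i then some j else if x = i' then some j' else none

/-- Disjunction of tests. -/
def Test.or {W K : Type} (a b : Test W K) : Test W K := .not (.and (.not a) (.not b))

/-- Return to the node with label `k0`. -/
def home : Com := .while (.keyLt (.var k0) .here) (.move .up)

/-- Continue a walk below the current node if its label is at most `k1`. -/
def descend : Com := .ite (.keyLt (.var k1) .here) (.setWord w1 (.lit 1)) (.move .left)

/-- Leave the subtree of the current node in a walk on the subtree with root label `k0`. -/
def climb : Com :=
  .ite (.keyLt (.var k0) .here)
    -- The agent does not know whether it is at a left or a right child. It keeps the label in `k6`,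
    -- looks at the left child of the parent and compares: equal labels mean that it came from the
    -- left.
    (.seq (.setKey k6 .here) (.seq (.move .up) (.seq (.move .left)
      (.ite (.or (.keyLt (.var k6) .here) (.keyLt .here (.var k6))) (.move .up)
        (.seq (.move .up) (.seq (.move .right) (.setWord w1 (.lit 0))))))))
    (.setWord w1 (.lit 2))

/-- The visit of a node in a walk that counts the nodes at which `T` holds after `pre`. -/
def visit (pre : Com) (T : Test WVar KVar) : Com :=
  .seq pre (.ite T (.seq (.setWord w0 (.add (.var w0) (.lit 1)))
    (.ite (.wordLt (.var w0) (.var w2)) descend (.setWord w1 (.lit 2)))) descend)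

/-- The depth-first walk on the nodes with label at most `k1` and their children, until `w2` nodes
are counted. -/
def walk (pre : Com) (T : Test WVar KVar) : Com :=
  .while (.wordLt (.var w1) (.lit 2))
    (.ite (.wordLt (.var w1) (.lit 1)) (visit pre T) climb)

/-- Keep in `k5` the smallest label seen above `k1`. -/
def trackMin : Com :=
  .ite (.and (.keyLt (.var k1) .here) (.keyLt .here (.var k5))) (.setKey k5 .here) .skip

/-- The current label is `k1`. -/
def findTest : Test WVar KVar :=
  .and (.not (.keyLt (.var k1) .here)) (.not (.keyLt .here (.var k1)))

/-- The current label is at most `k1`, less than `k3`, and greater than `k2` unless `k2 = ∞`. -/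
def scanTest : Test WVar KVar :=
  .and (.not (.keyLt (.var k1) .here))
    (.and (.or (.not (.keyLt (.var k2) .infinity)) (.keyLt (.var k2) .here))
      (.or (.not (.keyLt (.var k3) .infinity)) (.keyLt .here (.var k3))))

/-- Go to the node with label `k1`. -/
def findBody : Com := .seq (.setKey k0 .here) (walk trackMin findTest)

/-- Count the labels at most `k1` in the open interval from `k2` to `k3`, up to `w2`. The last
counted label is stored in `k7`, the smallest label above `k1` that was seen in `k5`. -/
def scanBody : Com :=
  .seq (.setKey k0 .here) (.seq (walk trackMin scanTest) (.seq (.setKey k7 .here) home))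

/-- Call `find` for the label `e`. -/
def callFind (e : KeyExpr KVar) : Com :=
  .call .find (mkWE zeroE zeroE (.lit 1) zeroE zeroE zeroE)
    (mkKE infE e infE infE infE infE infE infE) noW noK

/-- Perform `scan` on the subtree of the node with label `k7` for the bound `k4`. -/
def queryBody : Com :=
  .seq (.setKey k0 .here) (.seq (callFind (.var k7))
    (.seq (.call .scan (mkWE zeroE zeroE (.var w2) zeroE zeroE zeroE)
      (mkKE infE (.var k4) (.var k2) (.var k3) infE infE infE infE) (retW w0 w0)
        (retK2 k5 k5 k6 k7)) home))

/-- Call `query` for the subtree of the node with label `e`, the bound `b`, the interval from `lo`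
to `hi` and the limit `t`. -/
def callQuery (e b lo hi : KeyExpr KVar) (t : WordExpr WVar) (rw : WVar → Option WVar)
    (rk : KVar → Option KVar) : Com :=
  .call .query (mkWE zeroE zeroE t zeroE zeroE zeroE) (mkKE infE infE lo hi b infE infE e) rw rk

/-- Store in `k5` the smallest label above `k2` in the subtree of the current node if this node is a
child, with label above `k1`, of a node with label at most `k1`. -/
def pickPre : Com :=
  .ite (.keyLt (.var k1) .here)
    (callQuery .here (.var k2) infE infE (.add (.var w3) (.lit 1)) noW (retK k5 k5))
    (.setKey k5 .infinity)

/-- Find the `w2`-th root above `k1` whose subtree has a label between `k2` and `k3`. -/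
def pickBody : Com :=
  .seq (.setKey k0 .here) (.seq (walk pickPre (.keyLt (.var k5) (.var k3)))
    (.seq (.setKey k7 .here) home))

/-! In the procedure `ext`, the words are: `w0`, the rank `n` of the required label; `w1`, the
number of known labels; `w2`, the number of known labels in the explored subtree; `w3`, the
increment; `w4`, a flag or index; `w5`, the last count. The keys are: `k0`, the label of the root;
`k1`, the initial threshold; `k2` and `k3`, the lower and upper bound; `k4`, the label of the
explored root; `k5`, the candidate. -/

/-- Count the labels at most `b` in the subtree of the node with label `e`. -/
def callCount (e b : KeyExpr KVar) (i : WVar) : Com :=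
  callQuery e b infE infE (.add (.var w0) (.lit 1)) (retW i w0) noK

/-- Find the candidates in the explored subtree. -/
def callItems (t : WordExpr WVar) (rw : WVar → Option WVar) (rk : KVar → Option KVar) : Com :=
  callQuery (.var k4) (.var k3) (.var k2) (.var k3) t rw rk

/-- `w3` receives the rank `n`, from which `pickPre` forms the cap `n + 1` of its queries. -/
def callPick (t : WordExpr WVar) (rw : WVar → Option WVar) (rk : KVar → Option KVar) : Com :=
  .call .pick (mkWE zeroE zeroE t (.var w0) zeroE zeroE)
    (mkKE infE (.var k1) (.var k2) (.var k3) infE infE infE infE) rw rk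

/-- Determine the increment of the rank. -/
def chooseStep : Com :=
  .seq (.setWord w3 (.lit 1))
    -- The test `2 s + 1 < c` says `2 (s + 1) ≤ c`. The loop thus replaces a division by 2: it ends
    -- at `s = max 1 ⌊c / 2⌋`, or earlier if `s` reaches the number of missing labels.
    (.while (.and (.wordLt (.add (.add (.var w3) (.var w3)) (.lit 1)) (.var w2))
        (.wordLt (.add (.var w3) (.var w1)) (.var w0)))
      (.setWord w3 (.add (.var w3) (.lit 1))))

/-- Accept the candidate as the new lower bound. -/
def accept : Com := .seq (.setKey k2 (.var k5)) (.setWord w1 (.var w5))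

def tooLarge : Test WVar KVar := .wordLt (.var w0) (.var w5)

/-- Enlarge the number of labels that are known in the explored subtree. -/
def grow : Com :=
  .seq chooseStep (.seq (callFind (.var k4))
    (.seq (.call .ext (mkWE (.add (.var w2) (.var w3)) (.var w2) zeroE zeroE zeroE zeroE)
        (mkKE infE (.var k2) infE infE infE infE infE infE) noW (retK k5 k2))
      (.seq home (.seq (callCount (.var k0) (.var k5) w5)
        (.ite tooLarge
          (.seq (.setWord w4 (.lit 1))
            (.ite (.keyLt (.var k5) (.var k3)) (.setKey k3 (.var k5)) .skip))
          (.seq accept (.setWord w2 (.add (.var w2) (.var w3)))))))))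

def growLoop : Com :=
  .while (.and (.wordLt (.var w1) (.var w0)) (.wordLt (.var w4) (.lit 1))) grow

/-- Test a random candidate in the explored subtree. -/
def refine : Com :=
  .seq (callItems (.add (.var w0) (.lit 1)) (retW w4 w0) noK)
    (.ite (.wordLt (.lit 0) (.var w4))
      (.seq (.rand w3 (.sub (.var w4) (.lit 1)))
        (.seq (callItems (.add (.var w3) (.lit 1)) noW (retK k5 k6))
          (.seq (callCount (.var k0) (.var k5) w5)
            (.ite tooLarge (.setKey k3 (.var k5)) accept))))
      .skip)

/-- The flag `w4 = 1` left by a failed `grow` starts this loop; from then on `w4` is the number of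
candidates found by `refine`, so that the loop ends when there are none. If `growLoop` ended because
the rank was reached, the flag is 0 and the loop is skipped. -/
def refineLoop : Com := .while (.wordLt (.lit 0) (.var w4)) refine

/-- Explore the chosen subtree. -/
def explore : Com :=
  .seq accept (.seq (callCount (.var k4) (.var k2) w2) (.seq (.setWord w4 (.lit 0))
    (.seq growLoop refineLoop)))

/-- Choose a random root and find the largest label in its subtree that is not too large. -/
def round : Com :=
  .seq (callPick (.add (.var w0) (.lit 1)) (retW w4 w0) noK)
    (.seq (.rand w3 (.sub (.var w4) (.lit 1)))
      (.seq (callPick (.add (.var w3) (.lit 1)) noW (retK2 k4 k7 k5 k5))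
        (.seq (callCount (.var k0) (.var k5) w5)
          (.ite tooLarge (.setKey k3 (.var k5)) explore))))

def roundLoop : Com := .while (.wordLt (.var w1) (.var w0)) round

/-- Find the `w0`-th smallest label in the subtree of the current node, if exactly `w1` labels in it
are at most `k1`. The result is stored in `k2`. -/
def extBody : Com :=
  .seq (.setKey k0 .here) (.seq (.setKey k2 (.var k1)) (.seq (.setKey k3 .infinity)
    (.ite (.wordLt (.add (.var w1) (.lit 1)) (.var w0)) roundLoop
      -- If one label is missing, it is the smallest label above the threshold, which a scan finds
      -- as a by-product. This is where the recursion ends.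
      (.ite (.wordLt (.var w1) (.var w0))
        (callQuery (.var k0) (.var k1) infE infE (.add (.var w0) (.lit 1)) noW (retK k2 k5))
        .skip))))

/-- The root has the smallest label, so exactly one label is at most it; this is the initial
knowledge handed to `ext`. -/
def mainBody : Com :=
  .call .ext (mkWE (.var w0) (.lit 1) zeroE zeroE zeroE zeroE)
    (mkKE infE .here infE infE infE infE infE infE) noW (retK k2 k2)

/-- The randomized selection algorithm. -/
abbrev heapSelect : Algorithm where
  W := WVar
  K := KVar
  P := Proc
  input := w0
  output := k2
  main := .main
  body
    | .main => mainBody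
    | .ext => extBody
    | .pick => pickBody
    | .query => queryBody
    | .find => findBody
    | .scan => scanBody

/-! ## Symbolic execution -/

section update

variable (a b c d e f x : ℕ)

@[simp] theorem update_w0 : Function.update (mkW a b c d e f) w0 x = mkW x b c d e f := by
  funext i; cases i <;> rfl
@[simp] theorem update_w1 : Function.update (mkW a b c d e f) w1 x = mkW a x c d e f := by
  funext i; cases i <;> rfl
@[simp] theorem update_w2 : Function.update (mkW a b c d e f) w2 x = mkW a b x d e f := by
  funext i; cases i <;> rfl
@[simp] theorem update_w3 : Function.update (mkW a b c d e f) w3 x = mkW a b c x e f := by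
  funext i; cases i <;> rfl
@[simp] theorem update_w4 : Function.update (mkW a b c d e f) w4 x = mkW a b c d x f := by
  funext i; cases i <;> rfl

variable {a b c d e f}

@[simp] theorem mkW_w0 : mkW a b c d e f w0 = a := rfl
@[simp] theorem mkW_w1 : mkW a b c d e f w1 = b := rfl
@[simp] theorem mkW_w2 : mkW a b c d e f w2 = c := rfl
@[simp] theorem mkW_w3 : mkW a b c d e f w3 = d := rfl
@[simp] theorem mkW_w4 : mkW a b c d e f w4 = e := rfl
@[simp] theorem mkW_w5 : mkW a b c d e f w5 = f := rfl

end update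

section update

variable (a b c d e f g h x : WithTop ℝ)

@[simp] theorem update_k0 : Function.update (mkK a b c d e f g h) k0 x = mkK x b c d e f g h := by
  funext i; cases i <;> rfl
@[simp] theorem update_k2 : Function.update (mkK a b c d e f g h) k2 x = mkK a b x d e f g h := by
  funext i; cases i <;> rfl
@[simp] theorem update_k3 : Function.update (mkK a b c d e f g h) k3 x = mkK a b c x e f g h := by
  funext i; cases i <;> rfl
@[simp] theorem update_k5 : Function.update (mkK a b c d e f g h) k5 x = mkK a b c d e x g h := by
  funext i; cases i <;> rfl
@[simp] theorem update_k6 : Function.update (mkK a b c d e f g h) k6 x = mkK a b c d e f x h := by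
  funext i; cases i <;> rfl
@[simp] theorem update_k7 : Function.update (mkK a b c d e f g h) k7 x = mkK a b c d e f g x := by
  funext i; cases i <;> rfl

variable {a b c d e f g h}

@[simp] theorem mkK_k0 : mkK a b c d e f g h k0 = a := rfl
@[simp] theorem mkK_k1 : mkK a b c d e f g h k1 = b := rfl
@[simp] theorem mkK_k2 : mkK a b c d e f g h k2 = c := rfl
@[simp] theorem mkK_k3 : mkK a b c d e f g h k3 = d := rfl
@[simp] theorem mkK_k4 : mkK a b c d e f g h k4 = e := rfl
@[simp] theorem mkK_k5 : mkK a b c d e f g h k5 = f := rfl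
@[simp] theorem mkK_k6 : mkK a b c d e f g h k6 = g := rfl
@[simp] theorem mkK_k7 : mkK a b c d e f g h k7 = h := rfl

end update

theorem eval_mkWE (words : WVar → ℕ) (a b c d e f : WordExpr WVar) :
    (fun i => (mkWE a b c d e f i).eval words) =
      mkW (a.eval words) (b.eval words) (c.eval words) (d.eval words) (e.eval words)
        (f.eval words) := by
  funext i; cases i <;> rfl

theorem eval_mkKE (keys : KVar → WithTop ℝ) (x : ℝ) (a b c d e f g h : KeyExpr KVar) :
    (fun i => (mkKE a b c d e f g h i).eval keys x) =
      mkK (a.eval keys x) (b.eval keys x) (c.eval keys x) (d.eval keys x) (e.eval keys x)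
        (f.eval keys x) (g.eval keys x) (h.eval keys x) := by
  funext i; cases i <;> rfl

@[simp] theorem Test.or_holds {W K : Type} {a b : Test W K} {words : W → ℕ}
    {keys : K → WithTop ℝ} {x : ℝ} :
    (Test.or a b).Holds words keys x ↔ a.Holds words keys x ∨ b.Holds words keys x := by
  simp only [Test.or, Test.Holds]
  tauto

namespace Limits

variable (E : Limits)

/-- The local state with given position, words and keys. -/
abbrev st (u : Node) (ws : WVar → ℕ) (ks : KVar → WithTop ℝ) : Local WVar KVar := ⟨u, ws, ks⟩

/-- `wp` for the commands of the selection algorithm. -/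
noncomputable def cost (d : ℕ) (c : Com) (f : Local WVar KVar → ℝ≥0∞) (σ : Local WVar KVar) :
    ℝ≥0∞ :=
  E.wp (A := heapSelect) d c f σ

open Classical in
/-- `ert` for the commands of the selection algorithm. -/
noncomputable def symb : ℕ → Com → (Local WVar KVar → ℝ≥0∞) → Local WVar KVar → ℝ≥0∞
  | _, .skip, f, σ => 1 + f σ
  | d, .seq c c', f, σ => 1 + symb (d - 1) c (symb d c' f) σ
  | d, .ite b c c', f, σ =>
      1 + if b.Holds σ.words σ.keys (E.val σ.pos) then symb d c f σ else symb d c' f σ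
  | d, .while b c, f, σ => E.cost d (.while b c) f σ
  | _, .setWord i a, f, σ =>
      1 + if a.eval σ.words ≤ E.bound then
        f ⟨σ.pos, Function.update σ.words i (a.eval σ.words), σ.keys⟩ else ⊤
  | _, .setKey i a, f, σ =>
      1 + f ⟨σ.pos, σ.words, Function.update σ.keys i (a.eval σ.keys (E.val σ.pos))⟩
  | _, .move m, f, σ => 1 + f ⟨m.apply σ.pos, σ.words, σ.keys⟩
  | _, .rand i a, f, σ =>
      1 + if a.eval σ.words ≤ E.bound then
        (∑ x ∈ Finset.range (a.eval σ.words + 1),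
          f ⟨σ.pos, Function.update σ.words i x, σ.keys⟩) / (a.eval σ.words + 1 : ℕ) else ⊤
  | d, .call p aw ak rw rk, f, σ => E.cost d (.call p aw ak rw rk) f σ

theorem ert_eq_symb : ∀ (c : Com) (d : ℕ) (f : Local WVar KVar → ℝ≥0∞) (σ : Local WVar KVar),
    E.ert (A := heapSelect) d c f σ = E.symb d c f σ
  | .skip, _, _, _ => rfl
  | .seq c c', d, f, σ => by
    rw [ert, symb, ert_eq_symb c]
    congr 3
    funext τ
    exact ert_eq_symb c' d f τ
  | .ite b c c', d, f, σ => by rw [ert, symb, ert_eq_symb c, ert_eq_symb c']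
  | .while b c, _, _, _ => rfl
  | .setWord i a, _, _, _ => rfl
  | .setKey i a, _, _, _ => rfl
  | .move m, _, _, _ => rfl
  | .rand i a, _, _, _ => rfl
  | .call p aw ak rw rk, _, _, _ => rfl

theorem cost_le_symb {d : ℕ} {c : Com} {f : Local WVar KVar → ℝ≥0∞} {σ : Local WVar KVar}
    (hσ : E.Small σ) (hd : c.height ≤ d) : E.cost d c f σ ≤ E.symb d c f σ :=
  (E.wp_le_ert hσ hd).trans_eq (E.ert_eq_symb c d f σ)

open Classical in
theorem cost_while {d : ℕ} {b : Test WVar KVar} {c : Com}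
    {f : Local WVar KVar → ℝ≥0∞} {σ : Local WVar KVar} (hσ : E.Small σ) (hd : c.height + 1 ≤ d) :
    E.cost d (.while b c) f σ ≤
      1 + if b.Holds σ.words σ.keys (E.val σ.pos) then
          E.symb (d - 1) c (E.cost d (.while b c) f) σ
        else f σ := by
  obtain ⟨d, rfl⟩ : ∃ e, d = e + 1 := ⟨d - 1, by omega⟩
  refine (E.wp_while (A := heapSelect) hσ).trans ?_
  gcongr
  split_ifs
  · exact E.cost_le_symb hσ (by omega)
  · exact le_rfl

/-- The number 15 is six words, eight keys and the pending `call`. -/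
theorem cost_call {d : ℕ} {p : Proc} {aw : WVar → WordExpr WVar} {ak : KVar → KeyExpr KVar}
    {rw : WVar → Option WVar} {rk : KVar → Option KVar}
    {f : Local WVar KVar → ℝ≥0∞} {σ : Local WVar KVar} (hσ : E.Small σ)
    (hd : 15 ≤ d) :
    E.cost d (.call p aw ak rw rk) f σ ≤
      1 + E.cost (d - 15) (heapSelect.body p) (fun τ => 1 + f ⟨τ.pos,
          fun i => (rw i).elim (σ.words i) τ.words, fun i => (rk i).elim (σ.keys i) τ.keys⟩)
        ⟨σ.pos, fun i => (aw i).eval σ.words, fun i => (ak i).eval σ.keys (E.val σ.pos)⟩ := by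
  obtain ⟨d, rfl⟩ : ∃ e, d = e + 15 := ⟨d - 15, by omega⟩
  exact E.wp_call (A := heapSelect) hσ

theorem small_mkW {u : Node} {a b c d e f : ℕ} {ks : KVar → WithTop ℝ} :
    E.Small (st u (mkW a b c d e f) ks) ↔
      a ≤ E.bound ∧ b ≤ E.bound ∧ c ≤ E.bound ∧ d ≤ E.bound ∧ e ≤ E.bound ∧ f ≤ E.bound := by
  constructor
  · intro h
    exact ⟨h w0, h w1, h w2, h w3, h w4, h w5⟩
  · rintro ⟨h0, h1, h2, h3, h4, h5⟩ i
    cases i <;> assumption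

end Limits

/-! ## Subtrees of a heap -/

/-- A node lists the turns on its path with the last one first, so the subtree of `v` consists of
the nodes with suffix `v`. -/
theorem suffix_cases {v w : Node} :
    v <:+ w ↔ w = v ∨ (false :: v) <:+ w ∨ (true :: v) <:+ w := by
  constructor
  · rintro ⟨t, rfl⟩
    rcases List.eq_nil_or_concat t with rfl | ⟨t, b, rfl⟩
    · simp
    · right
      cases b
      · left; exact ⟨t, by simp⟩
      · right; exact ⟨t, by simp⟩
  · rintro (rfl | h | h)
    · exact List.suffix_rfl
    · exact (List.suffix_cons _ _).trans h
    · exact (List.suffix_cons _ _).trans h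

theorem not_both_suffix {v w : Node} (h : (false :: v) <:+ w) (h' : (true :: v) <:+ w) : False := by
  have := (List.suffix_of_suffix_length_le h h' (by simp)).eq_of_length (by simp)
  simp at this

/-- The nodes in the subtree of `v` with label at most `x`. -/
def low (val : Node → ℝ) (v : Node) (x : ℝ) : Set Node := {w | v <:+ w ∧ val w ≤ x}

/-- The node `w` is in the subtree of `v` and its ancestors there have labels at most `x`. -/
def Reach (val : Node → ℝ) (v : Node) (x : ℝ) (w : Node) : Prop :=
  v <:+ w ∧ ∀ w', v <:+ w' → w' <:+ w → w' ≠ w → val w' ≤ x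

/-- The roots of the forest of the nodes of the subtree of `v` with label greater than `x`. -/
def front (val : Node → ℝ) (v : Node) (x : ℝ) : Set Node := {w | Reach val v x w ∧ x < val w}

/-- The list `l` is the preorder of the nodes in the subtree of `v` that are reached. -/
inductive Preorder (val : Node → ℝ) (x : ℝ) : Node → List Node → Prop
  | leaf {v : Node} : x < val v → Preorder val x v [v]
  | node {v : Node} {l l' : List Node} : val v ≤ x → Preorder val x (false :: v) l →
      Preorder val x (true :: v) l' → Preorder val x v (v :: (l ++ l'))

namespace IsHeap

variable {val : Node → ℝ} (hv : IsHeap val)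
include hv

theorem le_of_suffix {v w : Node} (h : v <:+ w) : val v ≤ val w := by
  obtain ⟨t, rfl⟩ := h
  induction t with
  | nil => exact le_rfl
  | cons b t ih => exact ih.trans (hv.lt_child _ b).le

theorem lt_of_suffix {v w : Node} (h : v <:+ w) (hne : w ≠ v) : val v < val w :=
  lt_of_le_of_ne (hv.le_of_suffix h) fun he => hne (hv.injective he).symm

theorem low_eq_empty {v : Node} {x : ℝ} (h : x < val v) : low val v x = ∅ := by
  ext w
  simp only [low, Set.mem_ofPred_eq, Set.mem_empty_iff_false, iff_false, not_and, not_le]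
  exact fun hw => h.trans_le (hv.le_of_suffix hw)

omit hv in
theorem low_eq_insert {v : Node} {x : ℝ} (h : val v ≤ x) :
    low val v x = insert v (low val (false :: v) x ∪ low val (true :: v) x) := by
  ext w
  simp only [low, Set.mem_ofPred_eq, Set.mem_insert_iff, Set.mem_union]
  rw [suffix_cases]
  constructor
  · tauto
  · rintro (rfl | h | h) <;> tauto

omit hv in
theorem low_child_subset {v : Node} {x : ℝ} (b : Bool) : low val (b :: v) x ⊆ low val v x :=
  fun _ hw => ⟨(List.suffix_cons _ _).trans hw.1, hw.2⟩

omit hv in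
theorem low_subset_of_suffix {v w : Node} {x : ℝ} (h : v <:+ w) : low val w x ⊆ low val v x :=
  fun _ hu => ⟨h.trans hu.1, hu.2⟩

omit hv in
theorem low_mono {v : Node} {x y : ℝ} (h : x ≤ y) : low val v x ⊆ low val v y :=
  fun _ hu => ⟨hu.1, hu.2.trans h⟩

omit hv in
theorem encard_low {v : Node} {x : ℝ} (h : val v ≤ x) :
    (low val v x).encard =
      1 + ((low val (false :: v) x).encard + (low val (true :: v) x).encard) := by
  rw [low_eq_insert h, Set.encard_insert_of_notMem, Set.encard_union_eq, add_comm]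
  · rw [Set.disjoint_left]
    exact fun w h1 h2 => not_both_suffix h1.1 h2.1
  · rintro (h | h)
    · simpa using h.1.length_le
    · simpa using h.1.length_le

omit hv in
theorem ncard_low {v : Node} {x : ℝ} (h : val v ≤ x) (hf : (low val v x).Finite) :
    (low val v x).ncard =
      1 + ((low val (false :: v) x).ncard + (low val (true :: v) x).ncard) := by
  have h1 := hf.subset (low_child_subset false)
  have h2 := hf.subset (low_child_subset true)
  have := encard_low h
  rw [← hf.cast_ncard_eq, ← h1.cast_ncard_eq, ← h2.cast_ncard_eq] at this
  exact_mod_cast this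

omit hv in
-- The tree is infinite, but the part with labels at most `x` is assumed finite, and its size drops
-- strictly on passing to a child. This replaces well-founded induction on the tree.
@[elab_as_elim]
theorem low_induction {x : ℝ} {P : Node → Prop} (leaf : ∀ v, x < val v → P v)
    (node : ∀ v, (low val v x).Finite → val v ≤ x → P (false :: v) → P (true :: v) → P v)
    {v : Node}
    (hf : (low val v x).Finite) : P v := by
  obtain ⟨n, hn⟩ : ∃ n, (low val v x).ncard ≤ n := ⟨_, le_rfl⟩
  induction n generalizing v with
  | zero =>
    refine leaf v (not_le.1 fun h => ?_)
    have := ncard_low h hf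
    omega
  | succ n ih =>
    rcases lt_or_ge x (val v) with h | h
    · exact leaf v h
    · have := ncard_low h hf
      exact node v hf h (ih (hf.subset (low_child_subset _)) (by omega))
        (ih (hf.subset (low_child_subset _)) (by omega))

omit hv in
theorem exists_preorder {v : Node} {x : ℝ} (hf : (low val v x).Finite) :
    ∃ l, Preorder val x v l := by
  refine low_induction (fun v h => ⟨_, .leaf h⟩) ?_ hf
  rintro v - h ⟨l, hl⟩ ⟨l', hl'⟩
  exact ⟨_, .node h hl hl'⟩

omit hv in
theorem reach_leaf {v w : Node} {x : ℝ} (h : x < val v) : Reach val v x w ↔ w = v := by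
  constructor
  · rintro ⟨h1, h2⟩
    by_contra hne
    exact absurd (h2 v List.suffix_rfl h1 (Ne.symm hne)) (not_le.2 h)
  · rintro rfl
    refine ⟨List.suffix_rfl, fun w' h1 h2 h3 => ?_⟩
    exact absurd (h1.sublist.antisymm h2.sublist).symm h3

omit hv in
theorem reach_node {v w : Node} {x : ℝ} (h : val v ≤ x) :
    Reach val v x w ↔ w = v ∨ Reach val (false :: v) x w ∨ Reach val (true :: v) x w := by
  constructor
  · rintro ⟨h1, h2⟩
    rcases suffix_cases.1 h1 with h3 | h3 | h3
    · exact .inl h3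
    · exact .inr (.inl ⟨h3, fun w' h4 => h2 w' ((List.suffix_cons _ _).trans h4)⟩)
    · exact .inr (.inr ⟨h3, fun w' h4 => h2 w' ((List.suffix_cons _ _).trans h4)⟩)
  · have key : ∀ b : Bool, Reach val (b :: v) x w → Reach val v x w := by
      rintro b ⟨h1, h2⟩
      refine ⟨(List.suffix_cons _ _).trans h1, fun w' h3 h4 h5 => ?_⟩
      rcases le_or_gt (v.length + 1) w'.length with hl | hl
      · exact h2 w' (List.suffix_of_suffix_length_le h1 h4 (by simpa using hl)) h4 h5
      · rw [h3.eq_of_length (le_antisymm h3.length_le (by omega))] at h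
        exact h
    rintro (rfl | h | h)
    · refine ⟨List.suffix_rfl, fun w' h1 h2 h3 => ?_⟩
      exact absurd (h1.sublist.antisymm h2.sublist).symm h3
    · exact key _ h
    · exact key _ h

omit hv in
theorem mem_preorder {v : Node} {x : ℝ} {l : List Node} (hl : Preorder val x v l) {w : Node} :
    w ∈ l ↔ Reach val v x w := by
  induction hl with
  | leaf h => rw [reach_leaf h, List.mem_singleton]
  | node h _ _ ih ih' => rw [reach_node h, List.mem_cons, List.mem_append, ih, ih']

omit hv in
theorem nodup_preorder {v : Node} {x : ℝ} {l : List Node} (hl : Preorder val x v l) :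
    l.Nodup := by
  induction hl with
  | leaf h => simp
  | node h hl hl' ih ih' =>
    rw [List.nodup_cons, List.nodup_append']
    refine ⟨?_, ih, ih', ?_⟩
    · rw [List.mem_append, mem_preorder hl, mem_preorder hl']
      rintro (h | h)
      · simpa using h.1.length_le
      · simpa using h.1.length_le
    · rw [List.disjoint_left]
      intro w h1 h2
      rw [mem_preorder hl] at h1
      rw [mem_preorder hl'] at h2
      exact not_both_suffix h1.1 h2.1

omit hv in
-- The reached nodes form a full binary tree whose inner nodes are those of `low`, and such a tree
-- has one leaf more than inner nodes.
theorem length_preorder {v : Node} {x : ℝ} {l : List Node} (hl : Preorder val x v l)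
    (hf : (low val v x).Finite) : l.length ≤ 2 * (low val v x).ncard + 1 := by
  induction hl with
  | leaf h => simp
  | node h hl hl' ih ih' =>
    have := ih (hf.subset (low_child_subset _))
    have := ih' (hf.subset (low_child_subset _))
    rw [ncard_low h hf]
    simp only [List.length_cons, List.length_append]
    omega

omit hv in
theorem depth_of_reach {v w : Node} {x : ℝ} (hf : (low val v x).Finite)
    (hw : Reach val v x w) : w.length ≤ v.length + (low val v x).ncard := by
  suffices h : ∀ w, Reach val v x w → w.length ≤ v.length + (low val v x).ncard from h w hw
  refine low_induction ?_ ?_ hf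
  · intro v h w hw
    rw [reach_leaf h] at hw
    simp [hw]
  · intro v hf h ih ih' w hw
    have := ncard_low h hf
    rcases (reach_node h).1 hw with rfl | hw | hw
    · omega
    · have := ih w hw
      simp only [List.length_cons] at this
      omega
    · have := ih' w hw
      simp only [List.length_cons] at this
      omega

theorem reach_of_mem_low {v w : Node} {x : ℝ} (hw : w ∈ low val v x) : Reach val v x w :=
  ⟨hw.1, fun _ _ h2 _ => (hv.le_of_suffix h2).trans hw.2⟩

omit hv in
theorem exists_front {v w : Node} {x : ℝ} (hf : (low val v x).Finite) (hw : v <:+ w)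
    (hx : x < val w) : ∃ r ∈ front val v x, r <:+ w := by
  have key : v <:+ w → ∃ r ∈ front val v x, r <:+ w := by
    refine low_induction ?_ ?_ hf
    · exact fun v h hw => ⟨v, ⟨(reach_leaf h).2 rfl, h⟩, hw⟩
    · intro v _ h ih ih' hw
      rcases suffix_cases.1 hw with rfl | h1 | h1
      · exact absurd h (not_le.2 hx)
      · obtain ⟨r, hr, hr'⟩ := ih h1
        exact ⟨r, ⟨(reach_node h).2 (.inr (.inl hr.1)), hr.2⟩, hr'⟩
      · obtain ⟨r, hr, hr'⟩ := ih' h1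
        exact ⟨r, ⟨(reach_node h).2 (.inr (.inr hr.1)), hr.2⟩, hr'⟩
  exact key hw

omit hv in
-- Two ancestors of the same node are comparable. If they differ, the upper one is a proper ancestor
-- of a reached node and hence has a label at most `x`.
theorem front_eq_of_suffix {v w r r' : Node} {x : ℝ} (hr : r ∈ front val v x)
    (hr' : r' ∈ front val v x) (h : r <:+ w) (h' : r' <:+ w) : r = r' := by
  by_contra hne
  rcases le_total r.length r'.length with hl | hl
  · exact absurd (hr'.1.2 r hr.1.1 (List.suffix_of_suffix_length_le h h' hl) hne)
      (not_le.2 hr.2)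
  · exact absurd (hr.1.2 r' hr'.1.1 (List.suffix_of_suffix_length_le h' h hl) (Ne.symm hne))
      (not_le.2 hr'.2)

omit hv in
theorem finite_front {v : Node} {x : ℝ} (hf : (low val v x).Finite) :
    (front val v x).Finite := by
  obtain ⟨l, hl⟩ := exists_preorder hf
  exact (l.finite_toSet).subset fun w hw => (mem_preorder hl).2 hw.1

theorem ncard_front_le {v : Node} {x : ℝ} (hf : (low val v x).Finite) :
    (front val v x).ncard ≤ (low val v x).ncard + 1 := by
  obtain ⟨l, hl⟩ := exists_preorder hf
  have h1 : (front val v x) ∪ (low val v x) ⊆ {w | w ∈ l} := by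
    rintro w (hw | hw)
    · exact (mem_preorder hl).2 hw.1
    · exact (mem_preorder hl).2 (hv.reach_of_mem_low hw)
  have h2 := Set.ncard_le_ncard h1 l.finite_toSet
  rw [Set.ncard_union_eq _ (finite_front hf) hf] at h2
  · have h3 := length_preorder hl hf
    have h4 : ({w | w ∈ l} : Set Node).ncard = l.toFinset.card := by
      rw [← Set.ncard_coe_finset]
      simp
    have := l.toFinset_card_le
    omega
  · rw [Set.disjoint_left]
    exact fun w h1 h2 => absurd h2.2 (not_le.2 h1.2)

omit hv in
theorem low_eq_union {v : Node} {x y : ℝ} (hf : (low val v x).Finite) (hxy : x ≤ y) :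
    low val v y = low val v x ∪ ⋃ r ∈ front val v x, low val r y := by
  ext w
  simp only [Set.mem_union, Set.mem_iUnion]
  constructor
  · intro hw
    rcases le_or_gt (val w) x with h | h
    · exact .inl ⟨hw.1, h⟩
    · obtain ⟨r, hr, hr'⟩ := exists_front hf hw.1 h
      exact .inr ⟨r, hr, hr', hw.2⟩
  · rintro (hw | ⟨r, hr, hw⟩)
    · exact ⟨hw.1, hw.2.trans hxy⟩
    · exact ⟨hr.1.1.trans hw.1, hw.2⟩

/-- Each label in `(x, y]` lies below exactly one root of the forest. This identity makes the work
at distinct roots add up to at most `n`. -/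
theorem ncard_low_eq_sum {v : Node} {x y : ℝ} (hf : (low val v x).Finite)
    (hfy : (low val v y).Finite) (hxy : x ≤ y) :
    (low val v y).ncard =
      (low val v x).ncard + ∑ r ∈ (finite_front hf).toFinset, (low val r y).ncard := by
  have hsub : ∀ r ∈ front val v x, low val r y ⊆ low val v y := fun r hr w hw =>
    ⟨hr.1.1.trans hw.1, hw.2⟩
  have h1 : (⋃ r ∈ front val v x, low val r y).Finite :=
    hfy.subset (Set.iUnion₂_subset hsub)
  rw [low_eq_union hf hxy, Set.ncard_union_eq _ hf h1]
  · classical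
    congr 1
    have h2 : (⋃ r ∈ front val v x, low val r y) =
        ⋃ r ∈ (finite_front hf).toFinset, low val r y := by simp
    rw [h2, Set.ncard_eq_toFinset_card _ (h2 ▸ h1)]
    have h3 : (h2 ▸ h1 : (⋃ r ∈ (finite_front hf).toFinset, low val r y).Finite).toFinset =
        (finite_front hf).toFinset.biUnion fun r =>
          if h : (low val r y).Finite then h.toFinset else ∅ := by
      ext w
      simp only [Set.Finite.mem_toFinset, Set.mem_iUnion, Finset.mem_biUnion, exists_prop]
      refine exists_congr fun r => and_congr_right fun hr => ?_
      rw [dif_pos (hfy.subset (hsub r hr)), Set.Finite.mem_toFinset]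
    rw [h3, Finset.card_biUnion]
    · refine Finset.sum_congr rfl fun r hr => ?_
      rw [Set.Finite.mem_toFinset] at hr
      rw [dif_pos (hfy.subset (hsub r hr)),
        Set.ncard_eq_toFinset_card _ (hfy.subset (hsub r hr))]
    · intro r hr r' hr' hne
      rw [Finset.mem_coe, Set.Finite.mem_toFinset] at hr hr'
      rw [Function.onFun, Finset.disjoint_left]
      intro w hw hw'
      rw [dif_pos (hfy.subset (hsub _ hr)), Set.Finite.mem_toFinset] at hw
      rw [dif_pos (hfy.subset (hsub _ hr')), Set.Finite.mem_toFinset] at hw'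
      exact hne (front_eq_of_suffix hr hr' hw.1 hw'.1)
  · rw [Set.disjoint_left]
    intro w hw hw'
    simp only [Set.mem_iUnion] at hw'
    obtain ⟨r, hr, hw'⟩ := hw'
    exact absurd hw.2 (not_le.2 (hr.2.trans_le (hv.le_of_suffix hw'.1)))

/-! ### Successors and ranks -/

/-- A minimum over infinitely many labels exists because it is the smaller of the minima for the two
children, down to nodes with label above `x`, which are minimal in their own subtrees. -/
theorem exists_next {v : Node} {x : ℝ} (hf : (low val v x).Finite) :
    ∃ w, v <:+ w ∧ x < val w ∧ ∀ w', v <:+ w' → x < val w' → val w ≤ val w' := by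
  refine low_induction ?_ ?_ hf
  · exact fun v h => ⟨v, List.suffix_rfl, h, fun w' hw' _ => hv.le_of_suffix hw'⟩
  · rintro v - h ⟨w, h1, h2, h3⟩ ⟨w', h1', h2', h3'⟩
    have hs : ∀ (b : Bool) (u : Node), (b :: v) <:+ u → v <:+ u := fun b u hu =>
      (List.suffix_cons _ _).trans hu
    rcases le_total (val w) (val w') with hle | hle
    · refine ⟨w, hs _ _ h1, h2, fun u hu hxu => ?_⟩
      rcases suffix_cases.1 hu with rfl | hu | hu
      · exact absurd h (not_le.2 hxu)
      · exact h3 u hu hxu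
      · exact hle.trans (h3' u hu hxu)
    · refine ⟨w', hs _ _ h1', h2', fun u hu hxu => ?_⟩
      rcases suffix_cases.1 hu with rfl | hu | hu
      · exact absurd h (not_le.2 hxu)
      · exact hle.trans (h3 u hu hxu)
      · exact h3' u hu hxu

end IsHeap

/-- The number `y` is the smallest label greater than `x` in the subtree of `v`. -/
def IsNext (val : Node → ℝ) (v : Node) (x y : ℝ) : Prop :=
  x < y ∧ (∃ w, v <:+ w ∧ val w = y) ∧ ∀ w, v <:+ w → x < val w → y ≤ val w

/-- The number `x` is a label in the subtree of `v`, and `n` labels there are at most `x`. -/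
def IsRank (val : Node → ℝ) (v : Node) (n : ℕ) (x : ℝ) : Prop :=
  (∃ w, v <:+ w ∧ val w = x) ∧ (low val v x).Finite ∧ (low val v x).ncard = n

theorem IsNext.unique {val : Node → ℝ} {v : Node} {x y y' : ℝ} (h : IsNext val v x y)
    (h' : IsNext val v x y') : y = y' := by
  obtain ⟨h1, ⟨w, hw, rfl⟩, h2⟩ := h
  obtain ⟨h1', ⟨w', hw', rfl⟩, h2'⟩ := h'
  exact le_antisymm (h2 _ hw' h1') (h2' _ hw h1)

namespace IsHeap

variable {val : Node → ℝ} (hv : IsHeap val)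
include hv

theorem exists_isNext {v : Node} {x : ℝ} (hf : (low val v x).Finite) :
    ∃ y, IsNext val v x y := by
  obtain ⟨w, h1, h2, h3⟩ := hv.exists_next hf
  exact ⟨val w, h2, ⟨w, h1, rfl⟩, h3⟩

theorem isRank_next {v : Node} {x y : ℝ} (hf : (low val v x).Finite) (h : IsNext val v x y) :
    IsRank val v ((low val v x).ncard + 1) y := by
  obtain ⟨h1, ⟨w, hw, rfl⟩, h2⟩ := h
  have he : low val v (val w) = insert w (low val v x) := by
    ext u
    simp only [low, Set.mem_ofPred_eq, Set.mem_insert_iff]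
    constructor
    · rintro ⟨hu, hu'⟩
      rcases le_or_gt (val u) x with h | h
      · exact .inr ⟨hu, h⟩
      · exact .inl (hv.injective (le_antisymm hu' (h2 u hu h)))
    · rintro (rfl | ⟨hu, hu'⟩)
      · exact ⟨hw, le_rfl⟩
      · exact ⟨hu, hu'.trans h1.le⟩
  refine ⟨⟨w, hw, rfl⟩, ?_, ?_⟩
  · rw [he]
    exact hf.insert w
  · rw [he, Set.ncard_insert_of_notMem _ hf]
    exact fun h => absurd h.2 (not_le.2 h1)

theorem exists_isRank {v : Node} {x : ℝ} (hf : (low val v x).Finite) {n : ℕ}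
    (hn : (low val v x).ncard < n) : ∃ y, x < y ∧ IsRank val v n y := by
  obtain ⟨s, rfl⟩ : ∃ s, n = (low val v x).ncard + 1 + s :=
    ⟨n - ((low val v x).ncard + 1), by omega⟩
  clear hn
  induction s with
  | zero =>
    obtain ⟨y, hy⟩ := hv.exists_isNext hf
    exact ⟨y, hy.1, hv.isRank_next hf hy⟩
  | succ s ih =>
    obtain ⟨y, h1, h2⟩ := ih
    obtain ⟨z, hz⟩ := hv.exists_isNext h2.2.1
    have := hv.isRank_next h2.2.1 hz
    rw [h2.2.2] at this
    exact ⟨z, h1.trans hz.1, this⟩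

omit hv in
theorem ncard_lt_of_lt {v w : Node} {x : ℝ} (hf : (low val v (val w)).Finite) (hw : v <:+ w)
    (h : x < val w) : (low val v x).ncard < (low val v (val w)).ncard := by
  refine Set.ncard_lt_ncard ⟨low_mono h.le, fun hs => ?_⟩ hf
  exact absurd (hs ⟨hw, le_rfl⟩).2 (not_le.2 h)

omit hv in
/-- A label has rank at most `n` if and only if it is at most the label of rank `n`. -/
theorem encard_le_iff {v : Node} {n : ℕ} {x y : ℝ} (hx : IsRank val v n x)
    (hy : ∃ w, v <:+ w ∧ val w = y) : (low val v y).encard ≤ n ↔ y ≤ x := by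
  obtain ⟨w, hw, rfl⟩ := hy
  constructor
  · intro h
    by_contra hlt
    have hf : (low val v (val w)).Finite := Set.finite_of_encard_le_coe h
    have h1 := ncard_lt_of_lt hf hw (not_le.1 hlt)
    rw [← hf.cast_ncard_eq, hx.2.2.symm] at h
    have : (low val v (val w)).ncard ≤ (low val v x).ncard := by exact_mod_cast h
    omega
  · intro h
    rw [← hx.2.2, hx.2.1.cast_ncard_eq]
    exact Set.encard_le_encard (low_mono h)

omit hv in
theorem _root_.ExplorableHeap.IsRank.unique {v : Node} {n : ℕ} {x y : ℝ} (hx : IsRank val v n x)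
    (hy : IsRank val v n y) : x = y := by
  refine le_antisymm ?_ ?_
  · rw [← encard_le_iff hy hx.1, ← hx.2.1.cast_ncard_eq, hx.2.2]
  · rw [← encard_le_iff hx hy.1, ← hy.2.1.cast_ncard_eq, hy.2.2]

end IsHeap

/-! ### Return values of calls and sums of costs -/

theorem retW_elim (i j : WVar) (ws ws' : WVar → ℕ) :
    (fun x => (retW i j x).elim (ws x) ws') = Function.update ws i (ws' j) := by
  funext x
  by_cases h : x = i <;> simp [retW, h]

theorem retK_elim (i j : KVar) (ks ks' : KVar → WithTop ℝ) :
    (fun x => (retK i j x).elim (ks x) ks') = Function.update ks i (ks' j) := by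
  funext x
  by_cases h : x = i <;> simp [retK, h]

theorem retK2_elim (i j i' j' : KVar) (ks ks' : KVar → WithTop ℝ) :
    (fun x => (retK2 i j i' j' x).elim (ks x) ks') =
      Function.update (Function.update ks i' (ks' j')) i (ks' j) := by
  funext x
  by_cases h : x = i
  · simp [retK2, h]
  · by_cases h' : x = i'
    · subst h'
      simp [retK2, h]
    · simp [retK2, h, h']

theorem noW_elim (ws ws' : WVar → ℕ) : (fun x => (noW x).elim (ws x) ws') = ws := rfl

theorem noK_elim (ks ks' : KVar → WithTop ℝ) : (fun x => (noK x).elim (ks x) ks') = ks := rfl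

theorem natCast_add_le {a b : ℕ} (h : a ≤ b) {x y : ℝ≥0∞} (hxy : x ≤ y) :
    (a : ℝ≥0∞) + x ≤ b + y := by
  gcongr

theorem le_natCast_add {a b : ℕ} {x y : ℝ≥0∞} (h : x = a + y) (hab : a ≤ b) : x ≤ b + y :=
  h.trans_le (natCast_add_le hab le_rfl)

namespace Limits

variable {E : Limits}

/-! ## Walks -/

theorem cost_home (hv : IsHeap E.val) {d : ℕ} (hd : 2 ≤ d) {f : Local WVar KVar → ℝ≥0∞} {v u : Node}
    {ws : WVar → ℕ} {ks : KVar → WithTop ℝ} (hs : E.Small (st u ws ks)) (hk : ks k0 = E.val v)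
    (hu : v <:+ u) {a : ℕ} (ha : u.length ≤ v.length + a) :
    E.cost d home f (st u ws ks) ≤ (2 * a + 1 : ℕ) + f (st v ws ks) := by
  obtain ⟨t, rfl⟩ := hu
  induction t generalizing a with
  | nil =>
    refine (E.cost_while hs (by simpa [Cmd.height] using hd)).trans ?_
    simp only [List.nil_append, Test.Holds, KeyExpr.eval, hk, lt_irrefl, if_false]
    exact_mod_cast natCast_add_le (a := 1) (by omega) le_rfl
  | cons x t ih =>
    refine (E.cost_while hs (by simpa [Cmd.height] using hd)).trans ?_
    have hlt : E.val v < E.val (x :: (t ++ v)) :=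
      (hv.le_of_suffix (List.suffix_append t v)).trans_lt (hv.lt_child _ _)
    simp only [List.cons_append, Test.Holds, KeyExpr.eval, hk, WithTop.coe_lt_coe, hlt, if_true,
      symb, Dir.apply, List.tail_cons]
    simp only [List.cons_append, List.length_cons] at ha
    have hl := List.length_append (as := t) (bs := v)
    have := ih (a := a - 1) hs (by omega)
    calc _ ≤ 1 + (1 + ((2 * (a - 1) + 1 : ℕ) + f (st v ws ks))) := by gcongr; exact this
      _ = ((2 * (a - 1) + 3 : ℕ) : ℝ≥0∞) + f (st v ws ks) := by push_cast; ring
      _ ≤ _ := natCast_add_le (by omega) le_rfl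

section Walk

variable (hv : IsHeap E.val) {d : ℕ} (hd : 30 ≤ d) {pre : Com}
  {T : Test WVar KVar} {f : Local WVar KVar → ℝ≥0∞} {v : Node} {b : ℝ} {tgt a₃ a₄ a₅ : ℕ}
  {q2 q3 q4 q7 : WithTop ℝ}

/-- The local state during a walk. -/
abbrev walkSt (E : Limits) (v : Node) (b : ℝ) (tgt a₃ a₄ a₅ : ℕ) (q2 q3 q4 q7 : WithTop ℝ)
    (u : Node) (cnt mode : ℕ) (β τ : WithTop ℝ) : Local WVar KVar :=
  st u (mkW cnt mode tgt a₃ a₄ a₅) (mkK (E.val v) b q2 q3 q4 β τ q7)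

local notation "wst" => walkSt E v b tgt a₃ a₄ a₅ q2 q3 q4 q7

include hd

omit hd in
-- The word `w1` is the mode of the walk: 0 on arrival at a new node, 1 when the subtree of the
-- current node is finished, 2 when the walk is over.
theorem walk_unfold (hd : 30 ≤ d) (hp : pre.height ≤ 10) {σ : Local WVar KVar} (hs : E.Small σ) :
    E.cost d (walk pre T) f σ ≤ 1 + if σ.words w1 < 2 then
      1 + if σ.words w1 < 1 then E.symb (d - 1) (visit pre T) (E.cost d (walk pre T) f) σ
        else E.symb (d - 1) climb (E.cost d (walk pre T) f) σ
      else f σ := by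
  have h : (Cmd.ite (.wordLt (.var w1) (.lit 1)) (visit pre T) climb).height + 1 ≤ d := by
    simp [Cmd.height, visit, climb, descend]
    omega
  refine (E.cost_while (b := .wordLt (.var w1) (.lit 2)) hs h).trans (le_of_eq ?_)
  simp only [symb, Test.Holds, WordExpr.eval, walk]
  congr

include hv

theorem climb_left (hp : pre.height ≤ 10) {u : Node} (hu : v <:+ u) {cnt : ℕ} {β τ : WithTop ℝ}
    (hs : E.Small (wst (false :: u) cnt 1 β τ)) :
    E.cost d (walk pre T) f (wst (false :: u) cnt 1 β τ) ≤
      15 + E.cost d (walk pre T) f (wst (true :: u) cnt 0 β (E.val (false :: u))) := by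
  have hlt : E.val v < E.val (false :: u) := (hv.le_of_suffix hu).trans_lt (hv.lt_child _ _)
  refine (walk_unfold hd hp hs).trans ?_
  simp only [Test.Holds, WordExpr.eval, KeyExpr.eval, mkW_w1, mkK_k0, Nat.one_lt_ofNat, if_true,
    symb, lt_irrefl, if_false, climb, WithTop.coe_lt_coe, hlt, Dir.apply, List.tail_cons,
    Test.or_holds, update_k6, mkK_k6, or_self, update_w1, Nat.zero_le]
  refine le_natCast_add (a := 15) (b := 15) ?_ (by omega)
  push_cast
  ring

theorem climb_right (hp : pre.height ≤ 10) {u : Node} (hu : v <:+ u) {cnt : ℕ} {β τ : WithTop ℝ}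
    (hs : E.Small (wst (true :: u) cnt 1 β τ)) :
    E.cost d (walk pre T) f (wst (true :: u) cnt 1 β τ) ≤
      15 + E.cost d (walk pre T) f (wst u cnt 1 β (E.val (true :: u))) := by
  have hlt : E.val v < E.val (true :: u) := (hv.le_of_suffix hu).trans_lt (hv.lt_child _ _)
  have hne : E.val (true :: u) < E.val (false :: u) ∨ E.val (false :: u) < E.val (true :: u) := by
    refine lt_or_gt_of_ne fun h => ?_
    simpa using hv.injective h
  refine (walk_unfold hd hp hs).trans ?_
  simp only [Test.Holds, WordExpr.eval, KeyExpr.eval, mkW_w1, mkK_k0, Nat.one_lt_ofNat, if_true,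
    symb, lt_irrefl, if_false, climb, WithTop.coe_lt_coe, hlt, Dir.apply, List.tail_cons,
    Test.or_holds, update_k6, mkK_k6, hne]
  refine le_natCast_add (a := 11) (b := 15) ?_ (by omega)
  push_cast
  ring

omit hv in
theorem climb_root (hp : pre.height ≤ 10) (hb : 2 ≤ E.bound) {cnt : ℕ} {β τ : WithTop ℝ}
    (hs : E.Small (wst v cnt 1 β τ)) :
    E.cost d (walk pre T) f (wst v cnt 1 β τ) ≤ 15 + f (wst v cnt 2 β τ) := by
  refine (walk_unfold hd hp hs).trans ?_
  simp only [Test.Holds, WordExpr.eval, KeyExpr.eval, mkW_w1, mkK_k0, Nat.one_lt_ofNat, if_true,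
    symb, lt_irrefl, if_false, climb, update_w1, hb]
  have hs' : E.Small (wst v cnt 2 β τ) := by
    rw [small_mkW] at hs ⊢
    exact ⟨hs.1, hb, hs.2.2⟩
  calc _ ≤ 1 + (1 + (1 + (1 + (1 + f (wst v cnt 2 β τ))))) := by
        gcongr
        refine (walk_unfold hd hp hs').trans ?_
        simp
    _ = (5 : ℕ) + f (wst v cnt 2 β τ) := by push_cast; ring
    _ ≤ _ := natCast_add_le (b := 15) (by omega) le_rfl

/-- At the node `u`, the command `pre` with subsequent test `T` updates the key `k5` by `nx u`,
takes time `cv u`, and the test succeeds if `item u`. -/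
def Visits (E : Limits) (d : ℕ) (pre : Com) (T : Test WVar KVar) (v : Node) (b : ℝ)
    (tgt a₃ a₄ a₅ : ℕ) (q2 q3 q4 q7 : WithTop ℝ) (nx : Node → WithTop ℝ → WithTop ℝ)
    (item : Node → Prop) (cv : Node → ℕ) (u : Node) : Prop :=
  ∀ (cnt : ℕ) (β τ : WithTop ℝ) (h : Local WVar KVar → ℝ≥0∞),
    E.Small (walkSt E v b tgt a₃ a₄ a₅ q2 q3 q4 q7 u cnt 0 β τ) →
    E.symb d pre h (walkSt E v b tgt a₃ a₄ a₅ q2 q3 q4 q7 u cnt 0 β τ) ≤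
      cv u + h (walkSt E v b tgt a₃ a₄ a₅ q2 q3 q4 q7 u cnt 0 (nx u β) τ) ∧
    (T.Holds (mkW cnt 0 tgt a₃ a₄ a₅) (mkK (E.val v) b q2 q3 q4 (nx u β) τ q7) (E.val u) ↔ item u)

variable {nx : Node → WithTop ℝ → WithTop ℝ} {item : Node → Prop} {cv : Node → ℕ}

open Classical in
omit hv in
-- When the count reaches `tgt`, the walk ends at the node `u` itself; this is how a walk finds a
-- node and not merely a number.
theorem walk_visit (hp : pre.height ≤ 10) (hb : 2 ≤ E.bound) {u : Node}
    (hV : Visits E (d - 2) pre T v b tgt a₃ a₄ a₅ q2 q3 q4 q7 nx item cv u) {cnt : ℕ}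
    {β τ : WithTop ℝ} (hs : E.Small (wst u cnt 0 β τ)) (hc : cnt < tgt) {F : ℝ≥0∞}
    (hF : if item u ∧ cnt + 1 = tgt then f (wst u tgt 2 (nx u β) τ) ≤ F else
      if E.val u ≤ b then E.cost d (walk pre T) f
          (wst (false :: u) (if item u then cnt + 1 else cnt) 0 (nx u β) τ) ≤ F
        else E.cost d (walk pre T) f
          (wst u (if item u then cnt + 1 else cnt) 1 (nx u β) τ) ≤ F) :
    E.cost d (walk pre T) f (wst u cnt 0 β τ) ≤ (cv u + 15 : ℕ) + F := by
  have hs' := hs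
  rw [small_mkW] at hs'
  have hct : cnt + 1 ≤ E.bound := by omega
  refine (walk_unfold hd hp hs).trans ?_
  simp only [mkW_w1, Nat.ofNat_pos, if_true, Nat.zero_lt_one, visit, symb]
  have h1 := hV cnt β τ (E.symb (d - 1) (.ite T (.seq (.setWord w0 (.add (.var w0) (.lit 1)))
    (.ite (.wordLt (.var w0) (.var w2)) descend (.setWord w1 (.lit 2)))) descend)
    (E.cost d (walk pre T) f)) hs
  rw [show d - 1 - 1 = d - 2 by omega]
  calc _ ≤ 1 + (1 + (1 + ((cv u : ℝ≥0∞) + (10 + F)))) := by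
        gcongr
        refine h1.1.trans ?_
        gcongr
        simp only [symb, h1.2]
        by_cases hi : item u
        · simp only [hi, if_true, true_and] at hF ⊢
          simp only [WordExpr.eval, mkW_w0, mkW_w2, Test.Holds, hct, if_true, update_w0]
          by_cases he : cnt + 1 = tgt
          · subst he
            simp only [lt_irrefl, if_false, if_true, hb, update_w1] at hF ⊢
            have hs2 : E.Small (walkSt E v b (cnt + 1) a₃ a₄ a₅ q2 q3 q4 q7 u (cnt + 1) 2
                (nx u β) τ) := by
              rw [small_mkW]
              exact ⟨hct, hb, hs'.2.2⟩
            calc _ ≤ 1 + (1 + (1 + (1 + (1 + (1 + F))))) := by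
                  gcongr
                  refine (walk_unfold hd hp hs2).trans ?_
                  simp only [mkW_w1, lt_irrefl, if_false]
                  exact add_le_add_right hF 1
              _ = (6 : ℕ) + F := by push_cast; ring
              _ ≤ _ := natCast_add_le (b := 10) (by omega) le_rfl
          · have : cnt + 1 < tgt := by omega
            simp only [he, if_false, this, if_true, descend, symb, Test.Holds, KeyExpr.eval,
              mkK_k1, WithTop.coe_lt_coe, Dir.apply, WordExpr.eval, update_w1] at hF ⊢
            have h1b : 1 ≤ E.bound := by omega
            by_cases hub : E.val u ≤ b
            · simp only [hub, not_lt.2 hub, if_false, if_true] at hF ⊢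
              calc _ ≤ 1 + (1 + (1 + (1 + (1 + (1 + F))))) := by gcongr
                _ = (6 : ℕ) + F := by push_cast; ring
                _ ≤ _ := natCast_add_le (b := 10) (by omega) le_rfl
            · simp only [hub, not_le.1 hub, if_false, if_true, h1b] at hF ⊢
              calc _ ≤ 1 + (1 + (1 + (1 + (1 + (1 + F))))) := by gcongr
                _ = (6 : ℕ) + F := by push_cast; ring
                _ ≤ _ := natCast_add_le (b := 10) (by omega) le_rfl
        · simp only [hi, if_false, false_and] at hF ⊢
          simp only [descend, symb, Test.Holds, KeyExpr.eval,
              mkK_k1, WithTop.coe_lt_coe, Dir.apply, WordExpr.eval, update_w1] at hF ⊢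
          have h1b : 1 ≤ E.bound := by omega
          by_cases hub : E.val u ≤ b
          · simp only [hub, not_lt.2 hub, if_false, if_true] at hF ⊢
            calc _ ≤ 1 + (1 + (1 + F)) := by gcongr
              _ = (3 : ℕ) + F := by push_cast; ring
              _ ≤ _ := natCast_add_le (b := 10) (by omega) le_rfl
          · simp only [hub, not_le.1 hub, if_false, if_true, h1b] at hF ⊢
            calc _ ≤ 1 + (1 + (1 + F)) := by gcongr
              _ = (3 : ℕ) + F := by push_cast; ring
              _ ≤ _ := natCast_add_le (b := 10) (by omega) le_rfl
    _ = ((cv u + 13 : ℕ) : ℝ≥0∞) + F := by push_cast; ring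
    _ ≤ _ := natCast_add_le (by omega) le_rfl

open Classical in
/-- The cost of visiting the nodes of a list and continuing with `K`, or with `F` after counting
`tgt` nodes. -/
noncomputable def listCost (tgt : ℕ) (nx : Node → WithTop ℝ → WithTop ℝ) (item : Node → Prop)
    (cv : Node → ℕ) (F : Node → WithTop ℝ → ℝ≥0∞) :
    List Node → (ℕ → WithTop ℝ → ℝ≥0∞) → ℕ → WithTop ℝ → ℝ≥0∞
  | [], K, cnt, β => K cnt β
  -- Besides `cv u`, a node is charged 15 for its visit and, if it is an inner node, 15 for climbing
  -- out of each of its two children.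
  | u :: l, K, cnt, β => (cv u + 45 : ℕ) +
      if item u ∧ cnt + 1 = tgt then F u (nx u β)
      else listCost tgt nx item cv F l K (if item u then cnt + 1 else cnt) (nx u β)

omit hd hv in
theorem listCost_append {F : Node → WithTop ℝ → ℝ≥0∞} (l l' : List Node)
    (K : ℕ → WithTop ℝ → ℝ≥0∞) (cnt : ℕ) (β : WithTop ℝ) :
    listCost tgt nx item cv F (l ++ l') K cnt β =
      listCost tgt nx item cv F l (listCost tgt nx item cv F l' K) cnt β := by
  induction l generalizing cnt β with
  | nil => rfl
  | cons u l ih => simp only [List.cons_append, listCost, ih]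

omit hd hv in
theorem listCost_add {F : Node → WithTop ℝ → ℝ≥0∞} (l : List Node)
    (K : ℕ → WithTop ℝ → ℝ≥0∞) (a : ℝ≥0∞) (cnt : ℕ) (β : WithTop ℝ) :
    listCost tgt nx item cv F l (fun c β => a + K c β) cnt β ≤
      a + listCost tgt nx item cv F l K cnt β := by
  induction l generalizing cnt β with
  | nil => exact le_rfl
  | cons u l ih =>
    simp only [listCost]
    rw [add_left_comm]
    gcongr
    split_ifs
    · exact le_add_self
    · exact ih _ _
    · exact ih _ _

open Classical in
-- Continuation passing along the preorder: `K` bounds what follows once the subtree of `u` is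
-- finished. The left child gets as continuation the list of the right child, which in turn gets the
-- climb back to `u`. The scratch key `τ` stays arbitrary, since every climb overwrites it before
-- use.
theorem walk_list (hp : pre.height ≤ 10) (hb : 2 ≤ E.bound)
    (ht : ∀ u cnt β τ, cnt ≤ tgt → ∀ m ≤ 2, E.Small (wst u cnt m β τ))
    {F : Node → WithTop ℝ → ℝ≥0∞} {u : Node} {l : List Node} (hl : Preorder E.val b u l)
    (hu : v <:+ u)
    (hV : ∀ w ∈ l, Visits E (d - 2) pre T v b tgt a₃ a₄ a₅ q2 q3 q4 q7 nx item cv w)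
    (hF : ∀ w ∈ l, ∀ β τ, f (wst w tgt 2 β τ) ≤ F w β) {K : ℕ → WithTop ℝ → ℝ≥0∞}
    (hK : ∀ cnt < tgt, ∀ β τ, E.cost d (walk pre T) f (wst u cnt 1 β τ) ≤ K cnt β)
    {cnt : ℕ} (hc : cnt < tgt) (β τ : WithTop ℝ) :
    E.cost d (walk pre T) f (wst u cnt 0 β τ) ≤ listCost tgt nx item cv F l K cnt β := by
  induction hl generalizing K cnt β τ with
  | @leaf u h =>
    have hV := hV u (by simp)
    simp only [listCost]
    refine (walk_visit hd hp hb hV (ht _ _ _ _ hc.le _ (by omega)) hc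
      (F := if item u ∧ cnt + 1 = tgt then F u (nx u β)
        else K (if item u then cnt + 1 else cnt) (nx u β)) ?_).trans
        (natCast_add_le (by omega) le_rfl)
    rw [if_neg (not_le.2 h)]
    split_ifs with h1 h2
    · exact hF u (by simp) _ _
    · exact hK _ (by have : cnt + 1 ≠ tgt := fun h => h1 ⟨h2, h⟩; omega) _ _
    · exact hK _ hc _ _
  | @node u l l' h hl hl' ih ih' =>
    have hVu := hV u (by simp)
    simp only [listCost]
    refine (walk_visit hd hp hb hVu (ht _ _ _ _ hc.le _ (by omega)) hc
      (F := 30 + if item u ∧ cnt + 1 = tgt then F u (nx u β)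
        else listCost tgt nx item cv F (l ++ l') K (if item u then cnt + 1 else cnt) (nx u β))
        ?_).trans (le_of_eq ?_)
    · have key : ∀ cnt < tgt, ∀ β τ, E.cost d (walk pre T) f (wst (false :: u) cnt 0 β τ) ≤
          30 + listCost tgt nx item cv F (l ++ l') K cnt β := by
        intro cnt hc β τ
        rw [listCost_append]
        refine (ih (hu.trans (List.suffix_cons _ _)) (fun w hw => hV w (by simp [hw]))
          (fun w hw => hF w (by simp [hw]))
          (K := fun c β => 30 + listCost tgt nx item cv F l' K c β) ?_ hc β τ).trans
          (listCost_add l _ _ _ _)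
        intro cnt hc β τ
        refine (climb_left hv hd hp hu (ht _ _ _ _ hc.le _ (by omega))).trans ?_
        rw [show (30 : ℝ≥0∞) = 15 + 15 by norm_num, add_assoc]
        gcongr
        refine (ih' (hu.trans (List.suffix_cons _ _)) (fun w hw => hV w (by simp [hw]))
          (fun w hw => hF w (by simp [hw])) (K := fun c β => 15 + K c β) ?_ hc _ _).trans
          (listCost_add l' _ _ _ _)
        intro cnt hc β τ
        refine (climb_right hv hd hp hu (ht _ _ _ _ hc.le _ (by omega))).trans ?_
        gcongr
        exact hK cnt hc β _
      rw [if_pos h]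
      split_ifs with h1 h2
      · exact (hF u (by simp) _ _).trans le_add_self
      · exact key _ (by have : cnt + 1 ≠ tgt := fun h => h1 ⟨h2, h⟩; omega) _ _
      · exact key _ hc _ _
    · push_cast
      ring

omit hd hv in
open Classical in
theorem listCost_eq {F : Node → WithTop ℝ → ℝ≥0∞} (l : List Node)
    (K : ℕ → WithTop ℝ → ℝ≥0∞) {cnt : ℕ} (hc : cnt + (l.filter (item ·)).length < tgt)
    (β : WithTop ℝ) :
    listCost tgt nx item cv F l K cnt β = ((l.map cv).sum + 45 * l.length : ℕ) +
      K (cnt + (l.filter (item ·)).length) (l.foldl (fun β u => nx u β) β) := by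
  induction l generalizing cnt β with
  | nil => simp [listCost]
  | cons u l ih =>
    simp only [listCost, List.filter_cons, List.map_cons, List.sum_cons, List.length_cons,
      List.foldl_cons] at hc ⊢
    by_cases hi : item u
    · simp only [hi, decide_true, if_true, List.length_cons, true_and] at hc ⊢
      rw [if_neg (by omega), ih (by omega)]
      push_cast
      rw [show cnt + 1 + (l.filter (item ·)).length = cnt + ((l.filter (item ·)).length + 1) by
        omega]
      ring
    · simp only [hi, decide_false, Bool.false_eq_true, if_false, false_and] at hc ⊢
      rw [ih hc]
      push_cast
      ring

omit hd hv in
open Classical in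
-- The walk stops at the item with index `i`, but it is charged for the whole list, so that no
-- prefix has to be named.
theorem listCost_le {F : Node → WithTop ℝ → ℝ≥0∞} (l : List Node)
    (K : ℕ → WithTop ℝ → ℝ≥0∞) {cnt i : ℕ} (hi : i < (l.filter (item ·)).length)
    (hc : cnt + i + 1 = tgt) (β : WithTop ℝ) {S : ℝ≥0∞}
    (hS : ∀ β, F ((l.filter (item ·))[i]) (nx ((l.filter (item ·))[i]) β) ≤ S) :
    listCost tgt nx item cv F l K cnt β ≤ ((l.map cv).sum + 45 * l.length : ℕ) + S := by
  induction l generalizing cnt β i with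
  | nil => simp at hi
  | cons u l ih =>
    simp only [listCost, List.map_cons, List.sum_cons, List.length_cons]
    have hsum : ((cv u + (l.map cv).sum + 45 * (l.length + 1) : ℕ) : ℝ≥0∞) + S =
        (cv u + 45 : ℕ) + (((l.map cv).sum + 45 * l.length : ℕ) + S) := by
      push_cast
      ring
    rw [hsum]
    gcongr
    by_cases hu : item u
    · simp only [List.filter_cons, hu, decide_true, if_true, true_and] at hi hS ⊢
      rcases Nat.eq_zero_or_pos i with rfl | hpos
      · rw [if_pos (by omega)]
        exact (hS β).trans le_add_self
      · rw [if_neg (by omega)]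
        obtain ⟨i, rfl⟩ : ∃ j, i = j + 1 := ⟨i - 1, by omega⟩
        simp only [List.length_cons, List.getElem_cons_succ] at hi hS
        exact ih (i := i) (by omega) (by omega) _ hS
    · simp only [List.filter_cons, hu, decide_false, Bool.false_eq_true, if_false,
        false_and] at hi hS ⊢
      exact ih hi hc _ hS

end Walk

end Limits

open Classical in
theorem length_filter_eq_ncard {α : Type*} {l : List α} (hl : l.Nodup) (p : α → Prop) :
    (l.filter (p ·)).length = {w | w ∈ l ∧ p w}.ncard := by
  rw [← List.toFinset_card_of_nodup (hl.filter _), ← Set.ncard_coe_finset]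
  congr 1
  ext w
  simp

namespace Limits

variable {E : Limits}

section Walk

variable (hv : IsHeap E.val) {d : ℕ} (hd : 30 ≤ d) {pre : Com}
  {T : Test WVar KVar} {f : Local WVar KVar → ℝ≥0∞} {v : Node} {b : ℝ} {tgt a₃ a₄ a₅ : ℕ}
  {q2 q3 q4 q7 : WithTop ℝ}
  {nx : Node → WithTop ℝ → WithTop ℝ} {item : Node → Prop} {cv : Node → ℕ}

theorem small_walkSt {u : Node} {cnt m : ℕ} {β τ : WithTop ℝ} (hb : 2 ≤ E.bound)
    (ht : tgt ≤ E.bound) (h3 : a₃ ≤ E.bound) (h4 : a₄ ≤ E.bound) (h5 : a₅ ≤ E.bound)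
    (hc : cnt ≤ tgt) (hm : m ≤ 2) :
    E.Small (E.walkSt v b tgt a₃ a₄ a₅ q2 q3 q4 q7 u cnt m β τ) := by
  rw [small_mkW]
  omega

include hv hd

open Classical in
theorem walk_all (hp : pre.height ≤ 10) (hb : 2 ≤ E.bound) (ht : tgt ≤ E.bound)
    (h3 : a₃ ≤ E.bound) (h4 : a₄ ≤ E.bound) (h5 : a₅ ≤ E.bound) {l : List Node}
    (hl : Preorder E.val b v l)
    (hV : ∀ w ∈ l, Visits E (d - 2) pre T v b tgt a₃ a₄ a₅ q2 q3 q4 q7 nx item cv w)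
    (hc : (l.filter (item ·)).length < tgt) {β τ : WithTop ℝ} {F : ℝ≥0∞}
    (hF : ∀ τ, f (E.walkSt v b tgt a₃ a₄ a₅ q2 q3 q4 q7 v (l.filter (item ·)).length 2
      (l.foldl (fun β u => nx u β) β) τ) ≤ F) :
    E.cost d (walk pre T) f (E.walkSt v b tgt a₃ a₄ a₅ q2 q3 q4 q7 v 0 0 β τ) ≤
      ((l.map cv).sum + 45 * l.length + 15 : ℕ) + F := by
  refine (walk_list hv hd hp hb
    (fun u cnt β τ hc m hm => small_walkSt hb ht h3 h4 h5 hc hm) hl List.suffix_rfl hV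
    -- The last content of the scratch key depends on the path taken, and the supremum removes it
    -- from the bookkeeping.
    (F := fun w β => ⨆ τ, f (E.walkSt v b tgt a₃ a₄ a₅ q2 q3 q4 q7 w tgt 2 β τ))
    (fun w _ β τ => le_iSup (fun τ => f (E.walkSt v b tgt a₃ a₄ a₅ q2 q3 q4 q7 w tgt 2 β τ)) τ)
    (K := fun c β => 15 + ⨆ τ, f (E.walkSt v b tgt a₃ a₄ a₅ q2 q3 q4 q7 v c 2 β τ)) ?_
    (by omega) β τ).trans ?_
  · intro cnt hc β τ
    refine (climb_root hd hp hb (small_walkSt hb ht h3 h4 h5 hc.le (by omega))).trans ?_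
    gcongr
    exact le_iSup (fun τ => f (E.walkSt v b tgt a₃ a₄ a₅ q2 q3 q4 q7 v cnt 2 β τ)) τ
  · rw [listCost_eq l _ (by simpa using hc)]
    simp only [zero_add]
    calc _ ≤ (((l.map cv).sum + 45 * l.length : ℕ) : ℝ≥0∞) + (15 + F) := by
          gcongr
          exact iSup_le hF
      _ = _ := by push_cast; ring

open Classical in
theorem walk_nth (hp : pre.height ≤ 10) (hb : 2 ≤ E.bound) (ht : tgt ≤ E.bound)
    (h3 : a₃ ≤ E.bound) (h4 : a₄ ≤ E.bound) (h5 : a₅ ≤ E.bound) {l : List Node}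
    (hl : Preorder E.val b v l)
    (hV : ∀ w ∈ l, Visits E (d - 2) pre T v b tgt a₃ a₄ a₅ q2 q3 q4 q7 nx item cv w)
    {i : ℕ} {w : Node} (hi : (l.filter (item ·))[i]? = some w) (hit : i + 1 = tgt)
    {β τ : WithTop ℝ} {F : ℝ≥0∞}
    (hF : ∀ β τ, f (E.walkSt v b tgt a₃ a₄ a₅ q2 q3 q4 q7 w tgt 2 (nx w β) τ) ≤ F) :
    E.cost d (walk pre T) f (E.walkSt v b tgt a₃ a₄ a₅ q2 q3 q4 q7 v 0 0 β τ) ≤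
      ((l.map cv).sum + 45 * l.length : ℕ) + F := by
  obtain ⟨hi', rfl⟩ := List.getElem?_eq_some_iff.1 hi
  exact (walk_list hv hd hp hb
    (fun u cnt β τ hc m hm => small_walkSt hb ht h3 h4 h5 hc hm) hl List.suffix_rfl hV
    (F := fun w β => ⨆ τ, f (E.walkSt v b tgt a₃ a₄ a₅ q2 q3 q4 q7 w tgt 2 β τ))
    (fun w _ β τ => le_iSup (fun τ => f (E.walkSt v b tgt a₃ a₄ a₅ q2 q3 q4 q7 w tgt 2 β τ)) τ)
    -- By `hi` the walk stops inside the list, so its continuation may cost ∞.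
    (K := fun _ _ => ⊤) (fun _ _ _ _ => le_top) (by omega) β τ).trans
    (listCost_le l _ hi' (by omega) β fun β => iSup_le fun τ => hF β τ)

/-- The labels at most `b` may be infinite in number, and then no preorder list exists. The
induction is on the number `s` of nodes still to be counted: either the left subtree supplies the `s
- 1` nodes after `u`, or it is finite, is walked completely by `walk_list`, and the right subtree
supplies the rest. In the second case the time for the left subtree is paid by the nodes counted
there. -/
theorem walk_capped (hp : pre.height ≤ 10) (hb : 2 ≤ E.bound) (ht : tgt ≤ E.bound)
    (h3 : a₃ ≤ E.bound) (h4 : a₄ ≤ E.bound) (h5 : a₅ ≤ E.bound)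
    (hV : ∀ w, Visits E (d - 2) pre T v b tgt a₃ a₄ a₅ q2 q3 q4 q7 nx (fun w => E.val w ≤ b)
      (fun _ => 2) w) {F : ℝ≥0∞} {s : ℕ} (hs : 1 ≤ s) {u : Node} (hu : v <:+ u)
    (hsl : (s : ℕ∞) ≤ (low E.val u b).encard)
    (hF : ∀ w β τ, u <:+ w → w.length ≤ u.length + s →
      f (E.walkSt v b tgt a₃ a₄ a₅ q2 q3 q4 q7 w tgt 2 β τ) ≤ F) {cnt : ℕ} (hc : cnt + s = tgt)
    (β τ : WithTop ℝ) :
    E.cost d (walk pre T) f (E.walkSt v b tgt a₃ a₄ a₅ q2 q3 q4 q7 u cnt 0 β τ) ≤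
      (100 * s : ℕ) + F := by
  classical
  induction s using Nat.strong_induction_on generalizing u cnt β τ with
  | _ s ih =>
  have hub : E.val u ≤ b := by
    by_contra h
    rw [IsHeap.low_eq_empty hv (not_le.1 h), Set.encard_empty] at hsl
    have : s ≤ 0 := by exact_mod_cast hsl
    omega
  have hsuf : ∀ (x : Bool) (w : Node), (x :: u) <:+ w → u <:+ w := fun x w hw =>
    (List.suffix_cons _ _).trans hw
  rw [IsHeap.encard_low hub] at hsl
  have hstep : ∀ {F' : ℝ≥0∞}, (∀ β, 2 ≤ s → E.cost d (walk pre T) f (E.walkSt v b tgt a₃ a₄ a₅ q2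
      q3 q4 q7 (false :: u) (cnt + 1) 0 β τ) ≤ F') → F ≤ F' →
      E.cost d (walk pre T) f (E.walkSt v b tgt a₃ a₄ a₅ q2 q3 q4 q7 u cnt 0 β τ) ≤
        (17 : ℕ) + F' := by
    intro F' h h'
    refine walk_visit hd hp hb (hV u) (small_walkSt hb ht h3 h4 h5 (by omega) (by omega))
      (by omega) ?_
    simp only [hub, if_true, true_and]
    split_ifs with h1
    · exact (hF u _ _ List.suffix_rfl (by omega)).trans h'
    · exact h _ (by omega)
  by_cases hleft : ((s - 1 : ℕ) : ℕ∞) ≤ (low E.val (false :: u) b).encard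
  · refine (hstep (F' := (100 * (s - 1) : ℕ) + F) (fun β h2 => ?_) le_add_self).trans ?_
    · refine ih (s - 1) (by omega) (by omega) (hu.trans (List.suffix_cons _ _)) hleft ?_
        (by omega) β τ
      intro w β τ hw hl
      refine hF w β τ (hsuf _ _ hw) ?_
      simp only [List.length_cons] at hl
      omega
    · rw [← add_assoc, ← Nat.cast_add]
      exact natCast_add_le (by omega) le_rfl
  · have hfin : (low E.val (false :: u) b).Finite :=
      Set.finite_of_encard_le_coe (not_le.1 hleft).le
    obtain ⟨a, ha⟩ : ∃ a, a = (low E.val (false :: u) b).ncard := ⟨_, rfl⟩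
    have ha' : (low E.val (false :: u) b).encard = a := by rw [ha, hfin.cast_ncard_eq]
    rw [ha'] at hsl hleft
    have hlt : a < s - 1 := by exact_mod_cast not_le.1 hleft
    have hright : ((s - 1 - a : ℕ) : ℕ∞) ≤ (low E.val (true :: u) b).encard := by
      revert hsl
      generalize (low E.val (true :: u) b).encard = R
      induction R using ENat.recTopCoe with
      | top => intro _; exact le_top
      | coe R =>
        intro h
        have : s ≤ 1 + (a + R) := by exact_mod_cast h
        exact_mod_cast (by omega : s - 1 - a ≤ R)
    obtain ⟨l, hl⟩ := IsHeap.exists_preorder hfin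
    have hlen := IsHeap.length_preorder hl hfin
    have hcount : (l.filter (fun w => E.val w ≤ b)).length = a := by
      rw [length_filter_eq_ncard (IsHeap.nodup_preorder hl), ha]
      congr 1
      ext w
      simp only [Set.mem_ofPred_eq, IsHeap.mem_preorder hl]
      exact ⟨fun h => ⟨h.1.1, h.2⟩, fun h => ⟨IsHeap.reach_of_mem_low hv h, h.2⟩⟩
    refine (hstep (F' := (47 * l.length + 15 + 100 * (s - 1 - a) : ℕ) + F) (fun β h2 => ?_)
      le_add_self).trans ?_
    · refine (walk_list hv hd hp hb
        (fun u cnt β τ hc m hm => small_walkSt hb ht h3 h4 h5 hc hm) hl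
        (hu.trans (List.suffix_cons _ _)) (fun w _ => hV w)
        (F := fun w β => ⨆ τ, f (E.walkSt v b tgt a₃ a₄ a₅ q2 q3 q4 q7 w tgt 2 β τ))
        (fun w _ β τ =>
          le_iSup (fun τ => f (E.walkSt v b tgt a₃ a₄ a₅ q2 q3 q4 q7 w tgt 2 β τ)) τ)
        (K := fun c β => 15 + ⨆ τ, E.cost d (walk pre T) f
          (E.walkSt v b tgt a₃ a₄ a₅ q2 q3 q4 q7 (true :: u) c 0 β τ)) ?_
        (by omega) β τ).trans ?_
      · intro cnt hc β τ
        refine (climb_left hv hd hp hu (small_walkSt hb ht h3 h4 h5 hc.le (by omega))).trans ?_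
        gcongr
        exact le_iSup (fun τ => E.cost d (walk pre T) f
          (E.walkSt v b tgt a₃ a₄ a₅ q2 q3 q4 q7 (true :: u) cnt 0 β τ)) (E.val (false :: u))
      · rw [listCost_eq l _ (by rw [hcount]; omega), hcount]
        calc _ ≤ (((l.map fun _ => 2).sum + 45 * l.length : ℕ) : ℝ≥0∞) +
              (15 + ((100 * (s - 1 - a) : ℕ) + F)) := by
              gcongr
              refine iSup_le fun τ => ih (s - 1 - a) (by omega) (by omega)
                (hu.trans (List.suffix_cons _ _)) hright ?_ (by omega) _ τ
              intro w β τ hw hl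
              refine hF w β τ (hsuf _ _ hw) ?_
              simp only [List.length_cons] at hl
              omega
          _ = _ := by
              simp only [List.map_const', List.sum_replicate, smul_eq_mul]
              push_cast
              ring
    · rw [← add_assoc, ← Nat.cast_add]
      exact natCast_add_le (by omega) le_rfl

end Walk

/-! ## Scans -/

/-- The smallest label above `b` that was seen, after a visit of `u`. -/
noncomputable def seen (E : Limits) (b : ℝ) (u : Node) (β : WithTop ℝ) : WithTop ℝ :=
  open Classical in if b < E.val u ∧ (E.val u : WithTop ℝ) < β then (E.val u : WithTop ℝ) else β

theorem visits_trackMin {d : ℕ} {T : Test WVar KVar} {v : Node} {b : ℝ} {tgt a₃ a₄ a₅ : ℕ}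
    {q2 q3 q4 q7 : WithTop ℝ} {item : Node → Prop} {u : Node}
    (hT : ∀ cnt β τ, T.Holds (mkW cnt 0 tgt a₃ a₄ a₅) (mkK (E.val v) b q2 q3 q4 β τ q7) (E.val u) ↔
      item u) :
    Visits E d trackMin T v b tgt a₃ a₄ a₅ q2 q3 q4 q7 (E.seen b) item (fun _ => 2) u := by
  intro cnt β τ h _
  refine ⟨le_of_eq ?_, hT _ _ _⟩
  simp only [trackMin, symb, Test.Holds, KeyExpr.eval, mkK_k1, mkK_k5, WithTop.coe_lt_coe,
    update_k5, seen]
  split_ifs <;> · push_cast; ring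

theorem foldl_seen (b : ℝ) (l : List Node) (β : WithTop ℝ) :
    let y := l.foldl (fun β u => E.seen b u β) β
    y ≤ β ∧ (∀ w ∈ l, b < E.val w → y ≤ E.val w) ∧
      (y = β ∨ ∃ w ∈ l, b < E.val w ∧ y = E.val w) := by
  induction l generalizing β with
  | nil => simp
  | cons u l ih =>
    obtain ⟨h1, h2, h3⟩ := ih (E.seen b u β)
    simp only [List.foldl_cons]
    have hle : E.seen b u β ≤ β := by
      rw [seen]
      split_ifs with h
      · exact h.2.le
      · exact le_rfl
    refine ⟨h1.trans hle, ?_, ?_⟩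
    · intro w hw hb
      rcases List.mem_cons.1 hw with rfl | hw
      · refine h1.trans ?_
        rw [seen]
        split_ifs with h
        · exact le_rfl
        · exact not_lt.1 fun h' => h ⟨hb, h'⟩
      · exact h2 w hw hb
    · rcases h3 with h3 | ⟨w, hw, h3⟩
      · rw [h3, seen]
        split_ifs with h
        · exact .inr ⟨u, by simp, h.1, rfl⟩
        · exact .inl rfl
      · exact .inr ⟨w, by simp [hw], h3⟩

/-- The smallest label above `b` is the label of a root of the remaining forest, and all these roots
are leaves of the walk. -/
theorem isNext_foldl_seen (hv : IsHeap E.val) {v : Node} {b : ℝ} {l : List Node}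
    (hl : Preorder E.val b v l) (hf : (low E.val v b).Finite) :
    ∃ y, IsNext E.val v b y ∧ l.foldl (fun β u => E.seen b u β) ⊤ = y := by
  obtain ⟨-, h2, h3⟩ := foldl_seen (E := E) b l ⊤
  obtain ⟨w, hw1, hw2, hw3⟩ := hv.exists_next hf
  obtain ⟨r, hr, hrw⟩ := IsHeap.exists_front hf hw1 hw2
  have hrl : r ∈ l := (IsHeap.mem_preorder hl).2 hr.1
  have hry := h2 r hrl hr.2
  rcases h3 with h3 | ⟨x, hx, hbx, h3⟩
  · rw [h3] at hry
    exact absurd hry (by simp)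
  · refine ⟨E.val x, ⟨hbx, ⟨x, ((IsHeap.mem_preorder hl).1 hx).1, rfl⟩, fun u hu hbu => ?_⟩, h3⟩
    obtain ⟨r', hr', hru⟩ := IsHeap.exists_front hf hu hbu
    have := h2 r' ((IsHeap.mem_preorder hl).2 hr'.1) hr'.2
    rw [h3, WithTop.coe_le_coe] at this
    exact this.trans (hv.le_of_suffix hru)

theorem cost_call_mk {d : ℕ} {p : Proc} (B : Com) (hB : heapSelect.body p = B)
    {w0 w1 w2 w3 w4 w5 : WordExpr WVar} {e0 e1 e2 e3 e4 e5 e6 e7 : KeyExpr KVar}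
    {rw : WVar → Option WVar} {rk : KVar → Option KVar}
    {f : Local WVar KVar → ℝ≥0∞} {u : Node} {ws : WVar → ℕ} {ks : KVar → WithTop ℝ}
    (hσ : E.Small (st u ws ks)) (hd : 15 ≤ d) :
    E.cost d (.call p (mkWE w0 w1 w2 w3 w4 w5) (mkKE e0 e1 e2 e3 e4 e5 e6 e7) rw rk) f
        (st u ws ks) ≤
      1 + E.cost (d - 15) B (fun τ => 1 + f (st τ.pos
          (fun i => (rw i).elim (ws i) τ.words) fun i => (rk i).elim (ks i) τ.keys))
        (st u (mkW (w0.eval ws) (w1.eval ws) (w2.eval ws) (w3.eval ws) (w4.eval ws) (w5.eval ws))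
          (mkK (e0.eval ks (E.val u)) (e1.eval ks (E.val u)) (e2.eval ks (E.val u))
            (e3.eval ks (E.val u)) (e4.eval ks (E.val u)) (e5.eval ks (E.val u))
            (e6.eval ks (E.val u)) (e7.eval ks (E.val u)))) := by
  rw [← eval_mkWE, ← eval_mkKE, ← hB]
  exact E.cost_call hσ hd

/-- A node among the `n` smallest may be `n` levels deep, so its path cannot be kept in memory. It
is found again from its label by walking over the nodes with label at most that one. -/
theorem cost_callFind (hv : IsHeap E.val) (hb : 2 ≤ E.bound) {d : ℕ} (hd : 50 ≤ d)
    {e : KeyExpr KVar} {f : Local WVar KVar → ℝ≥0∞} {v r : Node} {ws : WVar → ℕ}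
    {ks : KVar → WithTop ℝ} (hs : E.Small (st v ws ks)) (he : e.eval ks (E.val v) = E.val r)
    (hr : v <:+ r) (hf : (low E.val v (E.val r)).Finite) {a : ℕ}
    (ha : (low E.val v (E.val r)).ncard ≤ a) :
    E.cost d (callFind e) f (st v ws ks) ≤ (100 * (a + 1) : ℕ) + f (st r ws ks) := by
  classical
  refine (cost_call_mk findBody rfl hs (by omega)).trans ?_
  simp only [he]
  simp only [WordExpr.eval, KeyExpr.eval, noW_elim, noK_elim]
  obtain ⟨l, hl⟩ := IsHeap.exists_preorder hf
  have hlen := IsHeap.length_preorder hl hf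
  have hV : ∀ w, Visits E (d - 15 - 2) trackMin findTest v (E.val r) 1 0 0 0 ⊤ ⊤ ⊤ ⊤
      (E.seen (E.val r)) (· = r) (fun _ => 2) w := fun w => visits_trackMin fun cnt β τ => by
    simp only [findTest, Test.Holds, KeyExpr.eval, mkK_k1, WithTop.coe_lt_coe, not_lt]
    rw [← le_antisymm_iff, hv.injective.eq_iff]
  have hlr : (l.filter (· = r)) = [r] := by
    have hmem : r ∈ l := (IsHeap.mem_preorder hl).2 (hv.reach_of_mem_low ⟨hr, le_rfl⟩)
    rw [List.filter_eq, List.count_eq_one_of_mem (IsHeap.nodup_preorder hl) hmem,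
      List.replicate_one]
  have hs' : E.Small (st v (mkW 0 0 1 0 0 0) (mkK ⊤ (E.val r) ⊤ ⊤ ⊤ ⊤ ⊤ ⊤)) := by
    rw [small_mkW]
    omega
  have hnth : ∀ l', l' = [r] → l'[0]? = some r := by
    rintro _ rfl
    rfl
  have key := walk_nth hv (d := d - 15) (by omega) (pre := trackMin)
    (f := fun τ => 1 + f ⟨τ.pos, ws, ks⟩) (by simp [trackMin, Cmd.height]) hb
    (by omega) (by omega) (by omega) (by omega) hl (fun w _ => hV w) (i := 0) (w := r)
    (hnth _ (by convert hlr)) rfl (β := ⊤) (τ := ⊤) (F := 1 + f (st r ws ks)) (fun _ _ => le_rfl)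
  have hh : findBody.height ≤ d - 15 := by
    simp [findBody, walk, visit, climb, descend, trackMin, Cmd.height]
    omega
  calc _ ≤ 1 + (1 + (1 + ((47 * l.length : ℕ) + (1 + f (st r ws ks))))) := by
        gcongr
        refine (E.cost_le_symb hs' hh).trans ?_
        simp only [findBody, symb, KeyExpr.eval, update_k0]
        gcongr
        refine (key).trans (le_of_eq ?_)
        simp only [List.map_const', List.sum_replicate, smul_eq_mul]
        congr 2
        ring
    _ = ((47 * l.length + 4 : ℕ) : ℝ≥0∞) + f (st r ws ks) := by push_cast; ring
    _ ≤ _ := natCast_add_le (by omega) le_rfl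

/-- A scan of the subtree of `r` takes time at most `C`, and the count, the smallest larger label
and the last counted label satisfy `R`. -/
def ScanSpec (E : Limits) (r : Node) (b : ℝ) (lo hi : WithTop ℝ) (tgt C : ℕ)
    (R : ℕ → WithTop ℝ → WithTop ℝ → Prop) : Prop :=
  ∀ d, 40 ≤ d → ∀ (f : Local WVar KVar → ℝ≥0∞) (F : ℝ≥0∞),
    (∀ p β o m τ, R p β o → p ≤ tgt →
      f (st r (mkW p m tgt 0 0 0) (mkK (E.val r) b lo hi ⊤ β τ o)) ≤ F) →
    E.cost d scanBody f (st r (mkW 0 0 tgt 0 0 0) (mkK ⊤ b lo hi ⊤ ⊤ ⊤ ⊤)) ≤ C + F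

theorem scanSpec_of_walk (hv : IsHeap E.val) (hb : 2 ≤ E.bound) {r : Node} {b : ℝ}
    {lo hi : WithTop ℝ} {tgt C a : ℕ} (ht : tgt ≤ E.bound) {Q : Node → ℕ → WithTop ℝ → Prop}
    (hQ : ∀ w p β, Q w p β → r <:+ w ∧ w.length ≤ r.length + a ∧ p ≤ tgt)
    (hw : ∀ d, 30 ≤ d → ∀ (g : Local WVar KVar → ℝ≥0∞) (G : ℝ≥0∞),
      (∀ w p β τ, Q w p β → g (E.walkSt r b tgt 0 0 0 lo hi ⊤ ⊤ w p 2 β τ) ≤ G) →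
      E.cost d (walk trackMin scanTest) g (E.walkSt r b tgt 0 0 0 lo hi ⊤ ⊤ r 0 0 ⊤ ⊤) ≤ C + G) :
    ScanSpec E r b lo hi tgt (C + 2 * a + 6) fun p β o => ∃ w, Q w p β ∧ o = E.val w := by
  intro d hd f F hF
  have hh : scanBody.height ≤ d := by
    simp [scanBody, walk, visit, climb, descend, trackMin, home, Cmd.height]
    omega
  have hs : E.Small (st r (mkW 0 0 tgt 0 0 0) (mkK ⊤ b lo hi ⊤ ⊤ ⊤ ⊤)) := by
    rw [small_mkW]
    omega
  refine (E.cost_le_symb hs hh).trans ?_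
  simp only [scanBody, symb, KeyExpr.eval, update_k0]
  calc _ ≤ 1 + (1 + (1 + ((C : ℝ≥0∞) + (1 + (1 + ((2 * a + 1 : ℕ) + F)))))) := by
        gcongr
        refine hw (d - 1) (by omega) _ _ fun w p β τ h => ?_
        obtain ⟨h1, h2, h3⟩ := hQ w p β h
        simp only [update_k7]
        gcongr
        refine (cost_home hv (by omega) ?_ rfl h1 h2).trans ?_
        · rw [small_mkW]
          omega
        · gcongr
          exact hF _ _ _ _ _ ⟨w, h, rfl⟩ h3
    _ = _ := by push_cast; ring

/-- The label `x` is counted by a scan. -/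
def Counted (b : ℝ) (lo hi : WithTop ℝ) (x : ℝ) : Prop :=
  x ≤ b ∧ (lo = ⊤ ∨ lo < x) ∧ (hi = ⊤ ∨ x < hi)

theorem visits_scan {d : ℕ} {v : Node} {b : ℝ} {tgt : ℕ} {lo hi : WithTop ℝ} (u : Node) :
    Visits E d trackMin scanTest v b tgt 0 0 0 lo hi ⊤ ⊤ (E.seen b)
      (fun u => Counted b lo hi (E.val u)) (fun _ => 2) u :=
  visits_trackMin fun cnt β τ => by
    simp only [scanTest, Test.or_holds, Test.Holds, KeyExpr.eval, mkK_k1, mkK_k2, mkK_k3,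
      WithTop.coe_lt_coe, not_lt, top_le_iff, Counted]

open Classical in
theorem scanSpec_all (hv : IsHeap E.val) (hb : 2 ≤ E.bound) {r : Node} {b : ℝ}
    {lo hi : WithTop ℝ} {tgt : ℕ} (ht : tgt ≤ E.bound) (hf : (low E.val r b).Finite) {l : List Node}
    (hl : Preorder E.val b r l)
    (hc : (l.filter fun u => Counted b lo hi (E.val u)).length < tgt) :
    ScanSpec E r b lo hi tgt (100 * ((low E.val r b).ncard + 1)) fun p β _ =>
      p = (l.filter fun u => Counted b lo hi (E.val u)).length ∧
        ∃ y, IsNext E.val r b y ∧ β = y := by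
  have hlen := IsHeap.length_preorder hl hf
  have key := scanSpec_of_walk hv hb (lo := lo) (hi := hi) (r := r) (b := b)
    (C := 47 * l.length + 15) (a := 0) ht
    (Q := fun w p β => w = r ∧ p = (l.filter fun u => Counted b lo hi (E.val u)).length ∧
      ∃ y, IsNext E.val r b y ∧ β = y) ?_ ?_
  · intro d hd f F hF
    refine (key d hd f F ?_).trans (natCast_add_le (by omega) le_rfl)
    rintro p β o m τ ⟨w, ⟨-, h⟩, -⟩ hp
    exact hF p β o m τ h hp
  · rintro w p β ⟨rfl, rfl, -⟩
    exact ⟨List.suffix_rfl, by omega, hc.le⟩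
  · intro d hd g G hG
    obtain ⟨y, hy, hy'⟩ := isNext_foldl_seen hv hl hf
    refine (walk_all hv hd (by simp [trackMin, Cmd.height]) hb ht (by omega) (by omega) (by omega)
      hl (fun w _ => visits_scan w) hc (F := G) fun τ => ?_).trans (le_of_eq ?_)
    · exact hG _ _ _ _ ⟨rfl, rfl, y, hy, hy'⟩
    · simp only [List.map_const', List.sum_replicate, smul_eq_mul]
      push_cast
      ring

open Classical in
theorem scanSpec_nth (hv : IsHeap E.val) (hb : 2 ≤ E.bound) {r : Node} {b : ℝ}
    {lo hi : WithTop ℝ} {i : ℕ} (ht : i + 1 ≤ E.bound) (hf : (low E.val r b).Finite) {l : List Node}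
    (hl : Preorder E.val b r l) {w : Node}
    (hw : (l.filter fun u => Counted b lo hi (E.val u))[i]? = some w) :
    ScanSpec E r b lo hi (i + 1) (100 * ((low E.val r b).ncard + 1)) fun _ _ o => o = E.val w := by
  have hlen := IsHeap.length_preorder hl hf
  have key := scanSpec_of_walk hv hb (lo := lo) (hi := hi) (r := r) (b := b)
    (C := 47 * l.length) (a := (low E.val r b).ncard) ht
    (Q := fun u p β => u = w ∧ p = i + 1) ?_ ?_
  · intro d hd f F hF
    refine (key d hd f F ?_).trans (natCast_add_le (by omega) le_rfl)
    rintro p β o m τ ⟨_, ⟨rfl, h⟩, h'⟩ hp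
    exact hF p β o m τ h' hp
  · rintro w p β ⟨rfl, rfl⟩
    have hwl : w ∈ l := List.mem_of_mem_filter (List.mem_of_getElem? hw)
    rw [IsHeap.mem_preorder hl] at hwl
    exact ⟨hwl.1, IsHeap.depth_of_reach hf hwl, le_rfl⟩
  · intro d hd g G hG
    refine (walk_nth hv hd (by simp [trackMin, Cmd.height]) hb ht (by omega) (by omega) (by omega)
      hl (fun w _ => visits_scan w) hw rfl (F := G) fun β τ => ?_).trans (le_of_eq ?_)
    · exact hG _ _ _ _ ⟨rfl, rfl⟩
    · simp only [List.map_const', List.sum_replicate, smul_eq_mul]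
      push_cast
      ring

theorem scanSpec_capped (hv : IsHeap E.val) (hb : 2 ≤ E.bound) {r : Node} {b : ℝ}
    {tgt : ℕ} (ht : tgt ≤ E.bound) (h1 : 1 ≤ tgt) (hc : (tgt : ℕ∞) ≤ (low E.val r b).encard) :
    ScanSpec E r b ⊤ ⊤ tgt (110 * (tgt + 1)) fun p _ _ => p = tgt := by
  have key := scanSpec_of_walk hv hb (lo := ⊤) (hi := ⊤) (r := r) (b := b)
    (C := 100 * tgt) (a := tgt) ht
    (Q := fun u p β => (r <:+ u ∧ u.length ≤ r.length + tgt) ∧ p = tgt) ?_ ?_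
  · intro d hd f F hF
    refine (key d hd f F ?_).trans (natCast_add_le (by omega) le_rfl)
    rintro p β o m τ ⟨_, ⟨-, h⟩, -⟩ hp
    exact hF p β o m τ h hp
  · rintro _ p β ⟨h, rfl⟩
    exact ⟨h.1, h.2, le_rfl⟩
  · intro d hd g G hG
    refine walk_capped hv hd (by simp [trackMin, Cmd.height]) hb ht (by omega) (by omega)
      (by omega) (nx := E.seen b) ?_ h1 List.suffix_rfl hc (fun w β τ h1 h2 => ?_) (by omega) _ _
    · intro w
      have := visits_scan (E := E) (d := d - 2) (v := r) (b := b) (tgt := tgt) (lo := ⊤) (hi := ⊤) w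
      simpa only [Counted, true_or, and_true] using this
    · exact hG _ _ _ _ ⟨⟨h1, h2⟩, rfl⟩

/-- The number of labels at most `b` in the subtree of `r`, or `tgt` if this is smaller. -/
noncomputable def capCount (E : Limits) (r : Node) (b : ℝ) (tgt : ℕ) : ℕ :=
  (min (low E.val r b).encard tgt).toNat

theorem capCount_of_finite {r : Node} {b : ℝ} {tgt : ℕ} (hf : (low E.val r b).Finite)
    (h : (low E.val r b).ncard ≤ tgt) : E.capCount r b tgt = (low E.val r b).ncard := by
  rw [capCount, min_eq_left]
  · rfl
  · rw [← hf.cast_ncard_eq]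
    exact_mod_cast h

theorem capCount_of_le {r : Node} {b : ℝ} {tgt : ℕ} (h : (tgt : ℕ∞) ≤ (low E.val r b).encard) :
    E.capCount r b tgt = tgt := by
  rw [capCount, min_eq_right h, ENat.toNat_natCast]

theorem scanSpec_count_finite (hv : IsHeap E.val) (hb : 2 ≤ E.bound) {r : Node} {b : ℝ}
    {tgt : ℕ} (ht : tgt ≤ E.bound) (hf : (low E.val r b).Finite)
    (h : (low E.val r b).ncard < tgt) :
    ScanSpec E r b ⊤ ⊤ tgt (100 * ((low E.val r b).ncard + 1)) fun p β _ =>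
      p = E.capCount r b tgt ∧ ∃ y, IsNext E.val r b y ∧ β = y := by
  classical
  obtain ⟨l, hl⟩ := IsHeap.exists_preorder hf
  have hcount : (l.filter fun u => Counted b ⊤ ⊤ (E.val u)).length = (low E.val r b).ncard := by
    rw [length_filter_eq_ncard (IsHeap.nodup_preorder hl)]
    congr 1
    ext w
    simp only [Set.mem_ofPred_eq, IsHeap.mem_preorder hl, Counted, true_or, and_true]
    exact ⟨fun h => ⟨h.1.1, h.2⟩, fun h => ⟨IsHeap.reach_of_mem_low hv h, h.2⟩⟩
  have := scanSpec_all hv hb (lo := ⊤) (hi := ⊤) ht hf hl (by rw [hcount]; exact h)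
  rw [hcount] at this
  rwa [capCount_of_finite hf h.le]

/-- The time depends only on the cap: a count that stays below the cap walks over a finite tree, and
any other count is cut off. -/
theorem scanSpec_count (hv : IsHeap E.val) (hb : 2 ≤ E.bound) {r : Node} {b : ℝ}
    {tgt : ℕ} (ht : tgt ≤ E.bound) (h1 : 1 ≤ tgt) :
    ScanSpec E r b ⊤ ⊤ tgt (110 * (tgt + 1)) fun p _ _ => p = E.capCount r b tgt := by
  rcases le_or_gt (tgt : ℕ∞) (low E.val r b).encard with h | h
  · rw [capCount_of_le h]
    exact scanSpec_capped hv hb ht h1 h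
  · have hf : (low E.val r b).Finite := Set.finite_of_encard_le_coe h.le
    have h' : (low E.val r b).ncard < tgt := by
      rw [← hf.cast_ncard_eq] at h
      exact_mod_cast h
    intro d hd f F hF
    refine (scanSpec_count_finite hv hb ht hf h' d hd f F ?_).trans
      (natCast_add_le (by omega) le_rfl)
    exact fun p β o m τ hp hp' => hF p β o m τ hp.1 hp'

/-! ## Queries -/

/-- The way to `r` is a search costing `O(a)`. The way back only climbs, and the depth of `r` below
`v` is at most `a`, because all nodes on the path have labels at most `E.val r`. -/
theorem cost_callQuery (hv : IsHeap E.val) (hb : 2 ≤ E.bound) {d : ℕ} (hd : 100 ≤ d)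
    {e bE loE hiE : KeyExpr KVar} {t : WordExpr WVar} {rw : WVar → Option WVar}
    {rk : KVar → Option KVar} {f : Local WVar KVar → ℝ≥0∞} {v r : Node} {ws : WVar → ℕ}
    {ks : KVar → WithTop ℝ} (hs : E.Small (st v ws ks)) {b : ℝ} {lo hi : WithTop ℝ} {tgt : ℕ}
    (he : e.eval ks (E.val v) = E.val r) (hbE : bE.eval ks (E.val v) = b)
    (hlo : loE.eval ks (E.val v) = lo) (hhi : hiE.eval ks (E.val v) = hi) (ht : t.eval ws = tgt)
    (htb : tgt ≤ E.bound) (hr : v <:+ r) (hf : (low E.val v (E.val r)).Finite) {a C : ℕ}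
    (ha : (low E.val v (E.val r)).ncard ≤ a) {R : ℕ → WithTop ℝ → WithTop ℝ → Prop}
    (hR : ScanSpec E r b lo hi tgt C R) {F : ℝ≥0∞}
    (hF : ∀ p β o, R p β o → p ≤ tgt → f (st v (fun i => (rw i).elim (ws i) (mkW p 0 tgt 0 0 0))
      (fun i => (rk i).elim (ks i) (mkK (E.val v) ⊤ lo hi b β o (E.val r)))) ≤ F) :
    E.cost d (callQuery e bE loE hiE t rw rk) f (st v ws ks) ≤ (C + 110 * (a + 1) : ℕ) + F := by
  refine (cost_call_mk queryBody rfl hs (by omega)).trans ?_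
  simp only [he, hbE, hlo, hhi, ht]
  simp only [WordExpr.eval, KeyExpr.eval]
  have hh : queryBody.height ≤ d - 15 := by
    simp [queryBody, callFind, home, Cmd.height]
    omega
  have hs' : ∀ u p q ks, p ≤ tgt →
      (E.Small (st u (mkW p 0 tgt q 0 0) ks) ↔ q ≤ E.bound) := by
    intro u p q ks hp
    rw [small_mkW]
    omega
  have hdep : r.length ≤ v.length + a := by
    have := IsHeap.depth_of_reach hf (hv.reach_of_mem_low (w := r) ⟨hr, le_rfl⟩)
    omega
  calc _ ≤ 1 + (1 + (1 + (1 + ((100 * (a + 1) : ℕ) + (1 + (1 + ((C : ℝ≥0∞) + (1 +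
        ((2 * a + 1 : ℕ) + (1 + F)))))))))) := by
        gcongr
        refine (E.cost_le_symb ((hs' _ _ _ _ (by omega)).2 (by omega)) hh).trans ?_
        simp only [queryBody, symb, KeyExpr.eval, update_k0]
        gcongr
        refine (cost_callFind hv hb (by omega) ((hs' _ _ _ _ (by omega)).2 (by omega)) rfl hr hf
          ha).trans ?_
        gcongr
        refine (cost_call_mk scanBody rfl ((hs' _ _ _ _ (by omega)).2 (by omega))
          (by omega)).trans ?_
        simp only [KeyExpr.eval, WordExpr.eval, mkK_k4, mkK_k2, mkK_k3, mkW_w2]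
        gcongr
        refine hR _ (by omega) _ _ fun p β o m τ h hp => ?_
        simp only [retW_elim, retK2_elim, update_w0, mkW_w0, mkK_k5, mkK_k7, update_k5, update_k6]
        gcongr
        refine (cost_home hv (by omega) ((hs' _ _ _ _ hp).2 (by omega)) rfl hr hdep).trans ?_
        gcongr
        exact hF p β o h hp
    _ = ((100 * (a + 1) + C + 2 * a + 9 : ℕ) : ℝ≥0∞) + F := by push_cast; ring
    _ ≤ _ := natCast_add_le (by omega) le_rfl

/-! ## Choosing a root -/

theorem low_self {val : Node → ℝ} (hv : IsHeap val) (v : Node) : low val v (val v) = {v} := by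
  ext w
  simp only [low, Set.mem_ofPred_eq, Set.mem_singleton_iff]
  constructor
  · rintro ⟨h1, h2⟩
    by_contra hne
    exact absurd (hv.lt_of_suffix h1 hne) (not_lt.2 h2)
  · rintro rfl
    exact ⟨List.suffix_rfl, le_rfl⟩

/-- The subtree of the root `w` has a label less than `U`, where `nv w` is the smallest unknown
label. -/
def Eligible (E : Limits) (L₀ : ℝ) (U : WithTop ℝ) (nv : Node → ℝ) (w : Node) : Prop :=
  L₀ < E.val w ∧ (nv w : WithTop ℝ) < U

open Classical in
theorem visits_pick (hv : IsHeap E.val) (hb : 2 ≤ E.bound) {d : ℕ} (hd : 100 ≤ d) {v w : Node}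
    {L₀ L : ℝ} {U : WithTop ℝ} {n tgt : ℕ} (hn : n + 1 ≤ E.bound) {nv : Node → ℝ}
    (hw : L₀ < E.val w → (low E.val w L).Finite ∧ (low E.val w L).ncard ≤ n ∧
      IsNext E.val w L (nv w)) :
    Visits E d pickPre (.keyLt (.var k5) (.var k3)) v L₀ tgt n 0 0 L U ⊤ ⊤
      (fun w _ => if L₀ < E.val w then (nv w : WithTop ℝ) else ⊤)
      (Eligible E L₀ U nv)
      (fun w => 2 + if L₀ < E.val w then 320 + 100 * (low E.val w L).ncard else 0) w := by
  intro cnt β τ h hs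
  by_cases hL : L₀ < E.val w
  · obtain ⟨hf, hle, hnx⟩ := hw hL
    simp only [pickPre, symb, Test.Holds, KeyExpr.eval, mkK_k1, mkK_k5, mkK_k3, WithTop.coe_lt_coe,
      hL, if_true, true_and, and_true, Eligible]
    have hfw : (low E.val w (E.val w)).Finite := by rw [low_self hv]; exact Set.finite_singleton w
    have hcw : (low E.val w (E.val w)).ncard ≤ 1 := by rw [low_self hv, Set.ncard_singleton]
    have key := cost_callQuery hv hb hd (e := .here) (bE := .var k2) (loE := infE)
      (hiE := infE)
      (t := .add (.var w3) (.lit 1)) (rw := noW) (rk := retK k5 k5) (f := h) hs rfl rfl rfl rfl rfl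
      (tgt := n + 1) hn List.suffix_rfl hfw hcw (scanSpec_count_finite hv hb hn hf (by omega))
      (F := h (E.walkSt v L₀ tgt n 0 0 L U ⊤ ⊤ w cnt 0 (nv w) τ)) ?_
    · refine (add_le_add_right key 1).trans ?_
      rw [← add_assoc, ← Nat.cast_one, ← Nat.cast_add]
      exact natCast_add_le (by omega) le_rfl
    · rintro p β o ⟨-, y, hy, rfl⟩ -
      rw [hnx.unique hy]
      simp only [noW_elim, retK_elim, mkK_k5, update_k5]
      exact le_rfl
  · simp only [pickPre, symb, Test.Holds, KeyExpr.eval, mkK_k1, mkK_k5, mkK_k3, WithTop.coe_lt_coe,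
      hL, if_false, false_and, update_k5, not_top_lt, and_true, Eligible]
    refine le_of_eq ?_
    push_cast
    ring

/-- The situation in which a root is chosen: the labels of the subtree of `v` up to `L` are known,
and `nv w` is the smallest label above `L` in the subtree of the root `w`. -/
structure Pool (E : Limits) (v : Node) (L₀ L : ℝ) (n : ℕ) (nv : Node → ℝ) : Prop where
  le : L₀ ≤ L
  finite : (low E.val v L).Finite
  ncard_le : (low E.val v L).ncard ≤ n
  next : ∀ w ∈ front E.val v L₀, IsNext E.val w L (nv w)

open Classical in
/-- The roots in the list `l` whose subtree has a label between `L` and `U`. -/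
noncomputable def pool (E : Limits) (L₀ : ℝ) (U : WithTop ℝ) (nv : Node → ℝ) (l : List Node) :
    List Node :=
  l.filter (Eligible E L₀ U nv ·)

open Classical in
-- One query is made at each root, but the queries count disjoint sets of labels, all of them at
-- most `L`. Hence the whole selection walk is linear in `n` and not quadratic.
theorem Pool.sum_le (hv : IsHeap E.val) {v : Node} {L₀ L : ℝ} {n : ℕ} {nv : Node → ℝ}
    (h : Pool E v L₀ L n nv) {l : List Node} (hl : Preorder E.val L₀ v l) :
    (l.map fun w => 2 + if L₀ < E.val w then 320 + 100 * (low E.val w L).ncard else 0).sum +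
      45 * l.length ≤ 520 * (n + 1) := by
  have hf₀ : (low E.val v L₀).Finite := h.finite.subset (IsHeap.low_mono h.le)
  have hlen := IsHeap.length_preorder hl hf₀
  have hle : (low E.val v L₀).ncard ≤ n :=
    (Set.ncard_le_ncard (IsHeap.low_mono h.le) h.finite).trans h.ncard_le
  have hsum := hv.ncard_low_eq_sum hf₀ h.finite h.le
  have hfr := hv.ncard_front_le hf₀
  have hn := h.ncard_le
  have hfil : l.toFinset.filter (fun w => L₀ < E.val w) =
      (IsHeap.finite_front hf₀).toFinset := by
    ext w
    simp only [Finset.mem_filter, List.mem_toFinset, IsHeap.mem_preorder hl,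
      Set.Finite.mem_toFinset,
      front, Set.mem_ofPred_eq]
  rw [Set.ncard_eq_toFinset_card _ (IsHeap.finite_front hf₀)] at hfr
  rw [List.sum_map_add, ← List.sum_toFinset _ (IsHeap.nodup_preorder hl),
    ← List.sum_toFinset _ (IsHeap.nodup_preorder hl), ← Finset.sum_filter, hfil,
    Finset.sum_add_distrib, ← Finset.mul_sum, Finset.sum_const, Finset.sum_const, smul_eq_mul,
    smul_eq_mul, List.toFinset_card_of_nodup (IsHeap.nodup_preorder hl)]
  omega

theorem cost_callPick_of_walk (hv : IsHeap E.val) (hb : 2 ≤ E.bound) {d : ℕ} (hd : 150 ≤ d)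
    {t : WordExpr WVar} {rw : WVar → Option WVar} {rk : KVar → Option KVar}
    {f : Local WVar KVar → ℝ≥0∞} {v : Node} {ws : WVar → ℕ} {ks : KVar → WithTop ℝ}
    (hs : E.Small (st v ws ks)) {L₀ L : ℝ} {U : WithTop ℝ} {n tgt C a : ℕ} (h1 : ks k1 = L₀)
    (h2 : ks k2 = L) (h3 : ks k3 = U) (hn : ws w0 = n) (ht : t.eval ws = tgt)
    (htb : tgt ≤ E.bound) (hnb : n ≤ E.bound) {Q : Node → ℕ → WithTop ℝ → Prop}
    (hQ : ∀ w p β, Q w p β → v <:+ w ∧ w.length ≤ v.length + a ∧ p ≤ tgt)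
    (hw : ∀ d, 130 ≤ d → ∀ (g : Local WVar KVar → ℝ≥0∞) (G : ℝ≥0∞),
      (∀ w p β τ, Q w p β → g (E.walkSt v L₀ tgt n 0 0 L U ⊤ ⊤ w p 2 β τ) ≤ G) →
      E.cost d (walk pickPre (.keyLt (.var k5) (.var k3))) g
        (E.walkSt v L₀ tgt n 0 0 L U ⊤ ⊤ v 0 0 ⊤ ⊤) ≤ C + G) {F : ℝ≥0∞}
    (hF : ∀ w p β τ, Q w p β → f (st v (fun i => (rw i).elim (ws i) (mkW p 2 tgt n 0 0))
      (fun i => (rk i).elim (ks i) (mkK (E.val v) L₀ L U ⊤ β τ (E.val w)))) ≤ F) :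
    E.cost d (callPick t rw rk) f (st v ws ks) ≤ (C + 2 * a + 10 : ℕ) + F := by
  refine (cost_call_mk pickBody rfl hs (by omega)).trans ?_
  simp only [ht]
  simp only [WordExpr.eval, KeyExpr.eval, h1, h2, h3, hn]
  have hh : pickBody.height ≤ d - 15 := by
    simp [pickBody, walk, visit, climb, descend, pickPre, callQuery, home, Cmd.height]
    omega
  have hs' : E.Small (st v (mkW 0 0 tgt n 0 0) (mkK ⊤ L₀ L U ⊤ ⊤ ⊤ ⊤)) := by
    rw [small_mkW]
    omega
  calc _ ≤ 1 + (1 + (1 + (1 + ((C : ℝ≥0∞) + (1 + (1 + ((2 * a + 1 : ℕ) + (1 + F)))))))) := by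
        gcongr
        refine (E.cost_le_symb hs' hh).trans ?_
        simp only [pickBody, symb, KeyExpr.eval, update_k0]
        gcongr
        refine hw _ (by omega) _ _ fun w p β τ h => ?_
        obtain ⟨h1, h2, h3⟩ := hQ w p β h
        simp only [update_k7]
        gcongr
        refine (cost_home hv (by omega) ?_ rfl h1 h2).trans ?_
        · rw [small_mkW]
          omega
        · gcongr
          exact hF _ _ _ _ h
    _ = ((C + 2 * a + 8 : ℕ) : ℝ≥0∞) + F := by push_cast; ring
    _ ≤ _ := natCast_add_le (by omega) le_rfl

section Pick

variable (hv : IsHeap E.val) (hb : 2 ≤ E.bound) {d : ℕ} (hd : 150 ≤ d)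
    {t : WordExpr WVar} {rw : WVar → Option WVar} {rk : KVar → Option KVar}
    {f : Local WVar KVar → ℝ≥0∞} {v : Node} {ws : WVar → ℕ} {ks : KVar → WithTop ℝ}
    (hs : E.Small (st v ws ks)) {L₀ L : ℝ} {U : WithTop ℝ} {n tgt : ℕ} (h1 : ks k1 = L₀)
    (h2 : ks k2 = L) (h3 : ks k3 = U) (hn : ws w0 = n) (ht : t.eval ws = tgt)
    (htb : tgt ≤ E.bound) (hnb : n + 1 ≤ E.bound) {nv : Node → ℝ} (hP : Pool E v L₀ L n nv)
    {l : List Node} (hl : Preorder E.val L₀ v l)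

include hP hl in
theorem Pool.spec {w : Node} (hw : w ∈ l) (hw' : L₀ < E.val w) : (low E.val w L).Finite ∧
    (low E.val w L).ncard ≤ n ∧ IsNext E.val w L (nv w) := by
  have hr := (IsHeap.mem_preorder hl).1 hw
  have hsub : low E.val w L ⊆ low E.val v L := IsHeap.low_subset_of_suffix hr.1
  exact ⟨hP.finite.subset hsub, (Set.ncard_le_ncard hsub hP.finite).trans hP.ncard_le,
    hP.next w ⟨hr, hw'⟩⟩

include hv hb hd hs h1 h2 h3 hn ht htb hnb hP hl

theorem cost_callPick_all (hlt : (E.pool L₀ U nv l).length < tgt) {F : ℝ≥0∞}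
    (hF : ∀ β τ o, f (st v
      (fun i => (rw i).elim (ws i) (mkW (E.pool L₀ U nv l).length 2 tgt n 0 0))
      (fun i => (rk i).elim (ks i) (mkK (E.val v) L₀ L U ⊤ β τ o))) ≤ F) :
    E.cost d (callPick t rw rk) f (st v ws ks) ≤ (550 * (n + 1) : ℕ) + F := by
  classical
  refine (cost_callPick_of_walk hv hb hd hs h1 h2 h3 hn ht htb (by omega) (a := 0)
    (C := 520 * (n + 1) + 15) (Q := fun w p β => w = v ∧ p = (E.pool L₀ U nv l).length) ?_ ?_
    (F := F) ?_).trans (natCast_add_le (by omega) le_rfl)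
  · rintro w p β ⟨rfl, rfl⟩
    exact ⟨List.suffix_rfl, by omega, hlt.le⟩
  · intro d hd g G hG
    refine (walk_all hv (by omega) (by simp [pickPre, callQuery, Cmd.height]) hb htb (by omega)
      (by omega) (by omega) hl (fun w hw => visits_pick hv hb (by omega) hnb
        fun h => Pool.spec hP hl hw h) hlt (F := G) fun τ => ?_).trans
        (natCast_add_le ?_ le_rfl)
    · exact hG _ _ _ _ ⟨rfl, rfl⟩
    · have := hP.sum_le hv hl
      omega
  · rintro w p β τ ⟨rfl, rfl⟩
    exact hF _ _ _

theorem cost_callPick_nth {i : ℕ} {r : Node} (hi : (E.pool L₀ U nv l)[i]? = some r)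
    (hit : i + 1 = tgt) {F : ℝ≥0∞}
    (hF : ∀ τ, f (st v
      (fun i => (rw i).elim (ws i) (mkW tgt 2 tgt n 0 0))
      (fun i => (rk i).elim (ks i) (mkK (E.val v) L₀ L U ⊤ (nv r) τ (E.val r)))) ≤ F) :
    E.cost d (callPick t rw rk) f (st v ws ks) ≤ (550 * (n + 1) : ℕ) + F := by
  classical
  have hrl := List.mem_of_mem_filter (List.mem_of_getElem? hi)
  have hri : Eligible E L₀ U nv r := by
    simpa using (List.mem_filter.1 (List.mem_of_getElem? hi)).2
  have hf₀ : (low E.val v L₀).Finite := hP.finite.subset (IsHeap.low_mono hP.le)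
  have hle : (low E.val v L₀).ncard ≤ n :=
    (Set.ncard_le_ncard (IsHeap.low_mono hP.le) hP.finite).trans hP.ncard_le
  refine (cost_callPick_of_walk hv hb hd hs h1 h2 h3 hn ht htb (by omega) (a := n)
    (C := 520 * (n + 1)) (Q := fun w p β => w = r ∧ p = tgt ∧ β = nv r) ?_ ?_
    (F := F) ?_).trans (natCast_add_le (by omega) le_rfl)
  · rintro _ p β ⟨rfl, rfl, -⟩
    rw [IsHeap.mem_preorder hl] at hrl
    have := IsHeap.depth_of_reach hf₀ hrl
    exact ⟨hrl.1, by omega, le_rfl⟩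
  · intro d hd g G hG
    refine (walk_nth hv (by omega) (by simp [pickPre, callQuery, Cmd.height]) hb htb (by omega)
      (by omega) (by omega) hl (fun w hw => visits_pick hv hb (by omega) hnb
        fun h => Pool.spec hP hl hw h) hi hit (F := G) fun β τ => ?_).trans
        (natCast_add_le ?_ le_rfl)
    · simp only [hri.1, if_true]
      exact hG _ _ _ _ ⟨rfl, rfl, rfl⟩
    · exact hP.sum_le hv hl
  · rintro _ p β τ ⟨rfl, rfl, rfl⟩
    exact hF _

end Pick

end Limits

/-! ## Potential functions -/

theorem harmonic_mono {a b : ℕ} (h : a ≤ b) : (harmonic a : ℝ) ≤ harmonic b := by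
  induction b, h using Nat.le_induction with
  | base => exact le_rfl
  | succ b _ ih =>
    refine ih.trans ?_
    rw [harmonic_succ]
    push_cast
    have : (0 : ℝ) ≤ ((b : ℝ) + 1)⁻¹ := by positivity
    linarith

theorem harmonic_nonneg (a : ℕ) : (0 : ℝ) ≤ harmonic a := by
  have := harmonic_mono a.zero_le
  simpa using this

theorem harmonic_le {a N : ℕ} (h : a ≤ N) : (harmonic a : ℝ) ≤ 1 + Real.log N :=
  (harmonic_mono h).trans (harmonic_le_one_add_log N)

/-- The element with the `i`-th largest `ℓ` leaves at most `i - 1` elements, and `H 0 + ⋯ + H (N -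
1) = N * H N - N`. So a uniform choice lowers the harmonic number by one on average. The induction
removes an element with the smallest `ℓ`, which leaves the most. -/
theorem sum_harmonic_le {ι : Type*} (A : Finset ι) (ℓ : ι → ℝ) {a' : ι → ℕ}
    (h : ∀ r ∈ A, a' r ≤ (A.filter fun j => ℓ r < ℓ j).card) :
    ∑ r ∈ A, (harmonic (a' r) : ℝ) + A.card ≤ A.card * harmonic A.card := by
  classical
  induction hn : A.card generalizing A with
  | zero => simp [Finset.card_eq_zero.1 hn]
  | succ n ih =>
    obtain ⟨r, hr, hmin⟩ := A.exists_min_image ℓ (Finset.card_pos.1 (by omega))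
    have hcard : (A.erase r).card = n := by rw [Finset.card_erase_of_mem hr, hn]; rfl
    have h1 := ih (A.erase r) (fun s hs => by
      refine (h s (Finset.mem_of_mem_erase hs)).trans (Finset.card_le_card fun j hj => ?_)
      rw [Finset.mem_filter] at hj ⊢
      refine ⟨Finset.mem_erase.2 ⟨?_, hj.1⟩, hj.2⟩
      rintro rfl
      exact absurd (hmin s (Finset.mem_of_mem_erase hs)) (not_le.2 hj.2)) hcard
    have h2 : a' r ≤ n := by
      refine (h r hr).trans (hcard ▸ Finset.card_le_card fun j hj => ?_)
      rw [Finset.mem_filter] at hj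
      refine Finset.mem_erase.2 ⟨?_, hj.1⟩
      rintro rfl
      exact absurd hj.2 (lt_irrefl _)
    have h3 := harmonic_mono h2
    rw [← Finset.add_sum_erase _ _ hr, harmonic_succ]
    push_cast
    have h4 : ((n : ℝ) + 1) * ((n : ℝ) + 1)⁻¹ = 1 := mul_inv_cancel₀ (by positivity)
    nlinarith

/-- The draw is from `A ∪ B`, and an element outside one of the sets leaves that set no larger than
before. The drops are `|A|` and `|B|` in total, and together they are at least `|A ∪ B|`. -/
theorem sum_harmonic_union_le {ι : Type*} [DecidableEq ι] (A B : Finset ι) (ℓ u : ι → ℝ)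
    {a' b' : ι → ℕ} (ha : ∀ r ∈ A, a' r ≤ (A.filter fun j => ℓ r < ℓ j).card)
    (ha' : ∀ r ∉ A, a' r ≤ A.card) (hb : ∀ r ∈ B, b' r ≤ (B.filter fun j => u j < u r).card)
    (hb' : ∀ r ∉ B, b' r ≤ B.card) :
    ∑ r ∈ A ∪ B, ((harmonic (a' r) : ℝ) + harmonic (b' r)) + (A ∪ B).card ≤
      (A ∪ B).card * (harmonic A.card + harmonic B.card : ℝ) := by
  have h1 := sum_harmonic_le A ℓ ha
  have h2 := sum_harmonic_le B (fun r => - u r) (a' := b') (by simpa using hb)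
  have h3 : ∑ r ∈ A ∪ B, (harmonic (a' r) : ℝ) ≤
      ∑ r ∈ A, (harmonic (a' r) : ℝ) + ((A ∪ B).card - A.card) * harmonic A.card := by
    rw [← Finset.sum_sdiff (Finset.subset_union_left (s₁ := A) (s₂ := B)), add_comm,
      ← Nat.cast_sub (Finset.card_le_card Finset.subset_union_left),
      ← Finset.card_sdiff_of_subset Finset.subset_union_left, ← nsmul_eq_mul]
    gcongr
    exact Finset.sum_le_card_nsmul _ _ _ fun r hr =>
      harmonic_mono (ha' r (Finset.mem_sdiff.1 hr).2)
  have h4 : ∑ r ∈ A ∪ B, (harmonic (b' r) : ℝ) ≤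
      ∑ r ∈ B, (harmonic (b' r) : ℝ) + ((A ∪ B).card - B.card) * harmonic B.card := by
    rw [← Finset.sum_sdiff (Finset.subset_union_right (s₁ := A) (s₂ := B)), add_comm,
      ← Nat.cast_sub (Finset.card_le_card Finset.subset_union_right),
      ← Finset.card_sdiff_of_subset Finset.subset_union_right, ← nsmul_eq_mul]
    gcongr
    exact Finset.sum_le_card_nsmul _ _ _ fun r hr =>
      harmonic_mono (hb' r (Finset.mem_sdiff.1 hr).2)
  have h5 : ((A ∪ B).card : ℝ) ≤ A.card + B.card := by exact_mod_cast Finset.card_union_le A B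
  rw [Finset.sum_add_distrib]
  linarith

/-- Here `g` counts the labels up to `X` in a subtree, `c` those known now, `Q j r` those of `j`
known after exploring `r`, `A' r` the roots live afterwards, and `ρ r` bounds the size at which the
exploration of `r` fails. For `r ≠ s` the failure costs at most `g r / 2`, so `r` overdraws the
potential `Ψ` by at most `(g r - c r) / 2`, less the amount `(Q s r - c s) / 2` by which the
potential of `s` drops. The choice of `s`, the root with the largest last label, leaves nothing
live: it frees the terms `g r - c r / 2` of all other roots, which cover the overdrafts, while the
amounts saved on `s` pay for its own failure, since `ρ s` is bounded by the same sum. -/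
theorem sum_charge_le {ι : Type*} [DecidableEq ι] {A : Finset ι} {g c ρ : ι → ℝ} {Q : ι → ι → ℝ}
    {A' : ι → Finset ι} {s : ι} (hs : s ∈ A) (hs' : A' s = ∅) (hA : ∀ r ∈ A, A' r ⊆ A.erase r)
    (hsA : ∀ r ∈ A, r ≠ s → s ∈ A' r) (hc : ∀ r ∈ A, 0 ≤ c r)
    (hQ : ∀ j ∈ A, ∀ r ∈ A, c j ≤ Q j r) (hg : ∀ j ∈ A, ∀ r ∈ A, Q j r ≤ g j)
    (hρ : ∀ r ∈ A, ρ r ≤ g r) (hρ' : ∀ r ∈ A, ρ r ≤ c r + ∑ j ∈ A.erase r, (Q r j - c r)) :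
    ∑ r ∈ A, (g r - c r + ρ r / 2 + ∑ j ∈ A' r, (g j - Q j r / 2)) ≤
      A.card * ∑ r ∈ A, (g r - c r / 2) := by
  have hcg : ∀ r ∈ A, c r ≤ g r := fun r hr => (hQ r hr r hr).trans (hg r hr r hr)
  set Ψ := ∑ r ∈ A, (g r - c r / 2) with hΨ
  have h1 : ∀ r ∈ A.erase s, g r - c r + ρ r / 2 + ∑ j ∈ A' r, (g j - Q j r / 2) ≤
      Ψ + (g r - c r) / 2 - (Q s r - c s) / 2 := by
    intro r hr
    obtain ⟨hrs, hr⟩ := Finset.mem_erase.1 hr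
    have h2 : ∑ j ∈ A' r, (g j - Q j r / 2) + (Q s r - c s) / 2 ≤ ∑ j ∈ A' r, (g j - c j / 2) := by
      rw [← Finset.add_sum_erase _ _ (hsA r hr hrs), ← Finset.add_sum_erase _ _ (hsA r hr hrs)]
      have : ∑ j ∈ (A' r).erase s, (g j - Q j r / 2) ≤ ∑ j ∈ (A' r).erase s, (g j - c j / 2) :=
        Finset.sum_le_sum fun j hj => by
          have := hQ j (Finset.mem_of_mem_erase (hA r hr (Finset.mem_of_mem_erase hj))) r hr
          linarith
      linarith
    have h3 : ∑ j ∈ A' r, (g j - c j / 2) ≤ ∑ j ∈ A.erase r, (g j - c j / 2) :=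
      Finset.sum_le_sum_of_subset_of_nonneg (hA r hr) fun j hj _ => by
        have hj := Finset.mem_of_mem_erase hj
        linarith [hcg j hj, hc j hj]
    have h4 := Finset.add_sum_erase A (fun j => g j - c j / 2) hr
    have h5 := hρ r hr
    linarith
  -- The sum form of the bound on `ρ` is needed for `s` only; for the other roots `ρ r ≤ g r` is
  -- enough.
  have h2 : g s - c s + ρ s / 2 + ∑ j ∈ A' s, (g j - Q j s / 2) ≤
      g s - c s / 2 + ∑ j ∈ A.erase s, (Q s j - c s) / 2 := by
    rw [hs', Finset.sum_empty, ← Finset.sum_div]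
    linarith [hρ' s hs]
  have h3 := Finset.add_sum_erase A (fun j => g j - c j / 2) hs
  have h4 : ∑ r ∈ A.erase s, (g r - c r) / 2 ≤ ∑ r ∈ A.erase s, (g r - c r / 2) :=
    Finset.sum_le_sum fun j hj => by
      have hj := Finset.mem_of_mem_erase hj
      linarith [hcg j hj, hc j hj]
  have h5 : (A.erase s).card = (A.card : ℝ) - 1 := by
    rw [Finset.card_erase_of_mem hs, Nat.cast_sub (Finset.card_pos.2 ⟨s, hs⟩), Nat.cast_one]
  have h6 : ∑ r ∈ A.erase s, (Ψ + (g r - c r) / 2 - (Q s r - c s) / 2) = (A.card - 1) * Ψ +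
      ∑ r ∈ A.erase s, (g r - c r) / 2 - ∑ r ∈ A.erase s, (Q s r - c s) / 2 := by
    rw [Finset.sum_sub_distrib, Finset.sum_add_distrib, Finset.sum_const, nsmul_eq_mul, h5]
  have h7 := (Finset.sum_le_sum h1).trans_eq h6
  rw [← Finset.add_sum_erase _ _ hs]
  linarith

/-! ## Real bounds -/

theorem natCast_add_ofReal_le {a : ℕ} {x y : ℝ} (h : a + x ≤ y) (hx : 0 ≤ x) {F G : ℝ≥0∞}
    (hFG : F ≤ ENNReal.ofReal x + G) : (a : ℝ≥0∞) + F ≤ ENNReal.ofReal y + G := by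
  calc _ ≤ (a : ℝ≥0∞) + (ENNReal.ofReal x + G) := by gcongr
    _ = ENNReal.ofReal (a + x) + G := by
      rw [ENNReal.ofReal_add (by positivity) hx, ENNReal.ofReal_natCast, add_assoc]
    _ ≤ _ := by gcongr

theorem average_le {p : ℕ} (hp : 0 < p) {x : ℕ → ℝ} (hx : ∀ i < p, 0 ≤ x i) {F : ℕ → ℝ≥0∞}
    {G : ℝ≥0∞} (hF : ∀ i < p, F i ≤ ENNReal.ofReal (x i) + G) {y : ℝ}
    (h : ∑ i ∈ Finset.range p, x i ≤ p * y) :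
    (∑ i ∈ Finset.range p, F i) / (p : ℕ) ≤ ENNReal.ofReal y + G := by
  have hp' : (p : ℝ≥0∞) ≠ 0 := by exact_mod_cast hp.ne'
  rw [ENNReal.div_le_iff hp' (ENNReal.natCast_ne_top p)]
  have hx' : ∀ i ∈ Finset.range p, 0 ≤ x i := fun i hi => hx i (Finset.mem_range.1 hi)
  have hy : 0 ≤ y := by
    have h1 := (Finset.sum_nonneg hx').trans h
    have h2 : (0 : ℝ) < p := by exact_mod_cast hp
    exact nonneg_of_mul_nonneg_right h1 h2
  calc _ ≤ ∑ i ∈ Finset.range p, (ENNReal.ofReal (x i) + G) :=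
        Finset.sum_le_sum fun i hi => hF i (Finset.mem_range.1 hi)
    _ = ENNReal.ofReal (∑ i ∈ Finset.range p, x i) + p * G := by
        rw [Finset.sum_add_distrib, ENNReal.ofReal_sum_of_nonneg hx', Finset.sum_const,
          Finset.card_range, nsmul_eq_mul]
    _ ≤ ENNReal.ofReal (p * y) + p * G := by gcongr
    _ = _ := by
        rw [ENNReal.ofReal_mul (by positivity), ENNReal.ofReal_natCast]
        ring

theorem update_w5 (a b c d e f x : ℕ) :
    Function.update (mkW a b c d e f) w5 x = mkW a b c d e x := by
  funext i; cases i <;> rfl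

theorem update_k4 (a b c d e f g h x : WithTop ℝ) :
    Function.update (mkK a b c d e f g h) k4 x = mkK a b c d x f g h := by
  funext i; cases i <;> rfl

/-! ### Comparison of labels with the label that is sought -/

/-- A label `X` of rank `n` in the subtree of `v`, with known labels up to `L₀`. -/
structure Level (E : Limits) (v : Node) (n : ℕ) (X L₀ : ℝ) : Prop where
  heap : IsHeap E.val
  rank : IsRank E.val v n X
  room : n + 2 ≤ E.bound
  lt : L₀ < X

namespace Level

variable {E : Limits} {v : Node} {n : ℕ} {X L₀ : ℝ} (h : Level E v n X L₀)

include h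

theorem finite {y : ℝ} (hy : y ≤ X) : (low E.val v y).Finite :=
  h.rank.2.1.subset (IsHeap.low_mono hy)

theorem ncard_le {y : ℝ} (hy : y ≤ X) : (low E.val v y).ncard ≤ n :=
  (Set.ncard_le_ncard (IsHeap.low_mono hy) h.rank.2.1).trans h.rank.2.2.le

theorem finite' {r : Node} (hr : v <:+ r) {y : ℝ} (hy : y ≤ X) : (low E.val r y).Finite :=
  (h.finite hy).subset (IsHeap.low_subset_of_suffix hr)

theorem ncard_le' {r : Node} (hr : v <:+ r) {y : ℝ} (hy : y ≤ X) : (low E.val r y).ncard ≤ n :=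
  (Set.ncard_le_ncard (IsHeap.low_subset_of_suffix hr) (h.finite hy)).trans (h.ncard_le hy)

theorem ncard_lt {y : ℝ} (hy : y < X) : (low E.val v y).ncard < n := by
  obtain ⟨⟨w, hw, rfl⟩, hf, hn⟩ := h.rank
  exact hn ▸ IsHeap.ncard_lt_of_lt hf hw hy

theorem eq_of_ncard {y : ℝ} (hy : y ≤ X) (hn : n ≤ (low E.val v y).ncard) : y = X := by
  by_contra hne
  exact absurd (h.ncard_lt (lt_of_le_of_ne hy hne)) (not_lt.2 hn)

theorem val_le : E.val v ≤ X := by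
  obtain ⟨⟨w, hw, rfl⟩, -⟩ := h.rank
  exact h.heap.le_of_suffix hw

theorem capCount_eq {y : ℝ} (hy : y ≤ X) : E.capCount v y (n + 1) = (low E.val v y).ncard :=
  Limits.capCount_of_finite (h.finite hy) ((h.ncard_le hy).trans (by omega))

/-- `X` is not known to the algorithm, but a count capped at `n + 1` decides on which side of `X` a
label lies, even if infinitely many labels are below it. -/
theorem lt_capCount_iff {y : ℝ} (hy : ∃ w, v <:+ w ∧ E.val w = y) :
    n < E.capCount v y (n + 1) ↔ X < y := by
  constructor
  · intro hn
    by_contra hle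
    rw [h.capCount_eq (not_lt.1 hle)] at hn
    exact absurd (h.ncard_le (not_lt.1 hle)) (not_le.2 hn)
  · intro hlt
    have h1 : ¬ (low E.val v y).encard ≤ n := by
      rw [IsHeap.encard_le_iff h.rank hy]
      exact not_le.2 hlt
    have h2 : ((n + 1 : ℕ) : ℕ∞) ≤ (low E.val v y).encard := by
      push_cast
      exact Order.add_one_le_of_lt (not_le.1 h1)
    rw [Limits.capCount_of_le h2]
    omega

end Level

/-! ### Counting, candidates and the choice of the increment -/

namespace Limits

variable {E : Limits}

theorem capCount_le {r : Node} {b : ℝ} {tgt : ℕ} : E.capCount r b tgt ≤ tgt := by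
  rcases le_or_gt (tgt : ℕ∞) (low E.val r b).encard with h | h
  · exact (capCount_of_le h).le
  · rw [capCount, min_eq_left h.le]
    exact ENat.toNat_le_of_le_natCast h.le

section Level

variable {v : Node} {n : ℕ} {X L₀ : ℝ} (h : Level E v n X L₀) {d : ℕ} (hd : 150 ≤ d)
  {f : Local WVar KVar → ℝ≥0∞} {ws : WVar → ℕ} {ks : KVar → WithTop ℝ} (hs : E.Small (st v ws ks))

include h hd hs

theorem cost_callCount {e b : KeyExpr KVar} {i : WVar} {r : Node} {y : ℝ} (hn : ws w0 = n)
    (hr : v <:+ r) (hrX : E.val r ≤ X) (he : e.eval ks (E.val v) = E.val r)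
    (hb : b.eval ks (E.val v) = y) :
    E.cost d (callCount e b i) f (st v ws ks) ≤
      (220 * (n + 2) : ℕ) + f (st v (Function.update ws i (E.capCount r y (n + 1))) ks) := by
  have hroom := h.room
  refine (cost_callQuery h.heap (by omega) (by omega) hs he hb rfl rfl (tgt := n + 1)
    (by simp [WordExpr.eval, hn]) (by omega) hr (h.finite hrX) (h.ncard_le hrX)
    (scanSpec_count h.heap (by omega) (by omega) (by omega))
    (F := f (st v (Function.update ws i (E.capCount r y (n + 1))) ks)) ?_).trans
    (natCast_add_le (by omega) le_rfl)
  rintro p β o rfl -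
  simp only [retW_elim, noK_elim, mkW_w0]
  exact le_rfl

open Classical in
/-- The nodes in the list `l` with a label between `L` and `U`. -/
noncomputable def candidates (E : Limits) (L U : ℝ) (l : List Node) :
    List Node :=
  l.filter (fun u => Counted U L U (E.val u))

omit h hd hs in
theorem mem_candidates {L U : ℝ} {r w : Node} {l : List Node} (hl : Preorder E.val U r l)
    (hv : IsHeap E.val) :
    w ∈ E.candidates L U l ↔ r <:+ w ∧ L < E.val w ∧ E.val w < U := by
  simp only [candidates, List.mem_filter, IsHeap.mem_preorder hl, Counted, decide_eq_true_eq,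
    WithTop.coe_ne_top, false_or, WithTop.coe_lt_coe]
  constructor
  · rintro ⟨h1, -, h2⟩
    exact ⟨h1.1, h2⟩
  · rintro ⟨h1, h2, h3⟩
    exact ⟨hv.reach_of_mem_low ⟨h1, h3.le⟩, h3.le, h2, h3⟩

omit h hd hs in
theorem nodup_candidates {L U : ℝ} {r : Node} {l : List Node} (hl : Preorder E.val U r l) :
    (E.candidates L U l).Nodup :=
  (IsHeap.nodup_preorder hl).filter _

omit h hd hs in
theorem length_candidates_le {L U : ℝ} {r : Node} {l : List Node} (hl : Preorder E.val U r l)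
    (hv : IsHeap E.val) (hf : (low E.val r U).Finite) :
    (E.candidates L U l).length ≤ (low E.val r U).ncard := by
  classical
  rw [← List.toFinset_card_of_nodup (nodup_candidates hl), ← Set.ncard_coe_finset]
  refine Set.ncard_le_ncard (fun w hw => ?_) hf
  have := (mem_candidates hl hv).1 (by simpa using hw)
  exact ⟨this.1, this.2.2.le⟩

section Items

variable {t : WordExpr WVar} {r : Node} {L U : ℝ} (hr : v <:+ r) (hrX : E.val r ≤ X)
  (h2 : ks k2 = L) (h3 : ks k3 = U) (h4 : ks k4 = E.val r) (hf : (low E.val r U).Finite)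
  (hfn : (low E.val r U).ncard ≤ n) {l : List Node} (hl : Preorder E.val U r l)

include hr hrX h2 h3 h4 hf hfn hl

theorem cost_callItems_all (ht : t.eval ws = n + 1) {i : WVar} :
    E.cost d (callItems t (retW i w0) noK) f (st v ws ks) ≤
      (220 * (n + 2) : ℕ) + f (st v (Function.update ws i (E.candidates L U l).length) ks) := by
  have hroom := h.room
  have hlen := length_candidates_le (L := L) hl h.heap hf
  refine (cost_callQuery h.heap (by omega) (by omega)
    (e := .var k4) (bE := .var k3) (loE := .var k2) (hiE := .var k3) hs h4 h3 h2 h3 ht (by omega) hr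
    (h.finite hrX) (h.ncard_le hrX)
    (scanSpec_all h.heap (by omega) (by omega) hf hl (by
      change (E.candidates L U l).length < _
      omega))
    (F := f (st v (Function.update ws i (E.candidates L U l).length) ks)) ?_).trans
    (natCast_add_le (by omega) le_rfl)
  rintro p β o ⟨rfl, -⟩ -
  simp only [retW_elim, noK_elim, mkW_w0]
  exact le_rfl

theorem cost_callItems_nth {i : ℕ} {w : Node} (hi : (E.candidates L U l)[i]? = some w)
    (ht : t.eval ws = i + 1) {j : KVar} :
    E.cost d (callItems t noW (retK j k6)) f (st v ws ks) ≤
      (220 * (n + 2) : ℕ) + f (st v ws (Function.update ks j (E.val w))) := by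
  have hroom := h.room
  have hlen := length_candidates_le (L := L) hl h.heap hf
  have hil : i < (E.candidates L U l).length := (List.getElem?_eq_some_iff.1 hi).1
  refine (cost_callQuery h.heap (by omega) (by omega)
    (e := .var k4) (bE := .var k3) (loE := .var k2) (hiE := .var k3) hs h4 h3 h2 h3 ht (by omega) hr
    (h.finite hrX) (h.ncard_le hrX)
    (scanSpec_nth h.heap (by omega) (by omega) hf hl hi)
    (F := f (st v ws (Function.update ks j (E.val w)))) ?_).trans
    (natCast_add_le (by omega) le_rfl)
  rintro p β o rfl -
  simp only [noW_elim, retK_elim, mkK_k6]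
  exact le_rfl

end Items

end Level

theorem cost_chooseLoop {d : ℕ} (hd : 2 ≤ d) {f : Local WVar KVar → ℝ≥0∞} {v : Node}
    {n k c s a b : ℕ} {ks : KVar → WithTop ℝ}
    (hs : ∀ s ≤ n, E.Small (st v (mkW n k c s a b) ks)) (h1 : 1 ≤ s) (hsk : s + k ≤ n)
    (hsc : s = 1 ∨ 2 * s ≤ c) {F : ℝ≥0∞}
    (hF : ∀ s, 1 ≤ s → s + k ≤ n → (s = 1 ∨ 2 * s ≤ c) → (c ≤ 2 * s + 1 ∨ s + k = n) →
      f (st v (mkW n k c s a b) ks) ≤ F) :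
    E.cost d (.while (.and (.wordLt (.add (.add (.var w3) (.var w3)) (.lit 1)) (.var w2))
        (.wordLt (.add (.var w3) (.var w1)) (.var w0)))
      (.setWord w3 (.add (.var w3) (.lit 1)))) f (st v (mkW n k c s a b) ks) ≤
      (2 * (n - (s + k)) + 1 : ℕ) + F := by
  induction hm : n - (s + k) generalizing s with
  | zero =>
    refine (E.cost_while (hs s (by omega)) (by simpa [Cmd.height] using hd)).trans ?_
    rw [if_neg]
    · simpa using hF s h1 hsk hsc (by omega)
    · simp only [Test.Holds, WordExpr.eval, mkW_w0, mkW_w1, mkW_w2, mkW_w3]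
      omega
  | succ m ih =>
    refine (E.cost_while (hs s (by omega)) (by simpa [Cmd.height] using hd)).trans ?_
    simp only [Test.Holds, WordExpr.eval, mkW_w0, mkW_w1, mkW_w2, mkW_w3, symb, update_w3]
    split_ifs with h2 h3
    · calc _ ≤ 1 + (1 + ((2 * m + 1 : ℕ) + F)) := by
            gcongr
            exact ih (by omega) (by omega) (by omega) (by omega)
        _ = _ := by push_cast; ring
    · have := hs (s + 1) (by omega)
      rw [small_mkW] at this
      omega
    · refine (add_le_add_right (hF s h1 hsk hsc (by omega)) 1).trans ?_
      exact_mod_cast natCast_add_le (a := 1) (by omega) le_rfl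

end Limits

theorem Level.length_le {E : Limits} {v : Node} {n : ℕ} {X L₀ : ℝ} (h : Level E v n X L₀)
    {r : Node} (hr : v <:+ r) (hrX : E.val r ≤ X) : r.length ≤ v.length + n :=
  (IsHeap.depth_of_reach h.rank.2.1 (h.heap.reach_of_mem_low ⟨hr, hrX⟩)).trans
    (by rw [h.rank.2.2])

/-! ### Growing the known part of one subtree -/

namespace Limits

variable {E : Limits}

/-- The procedure `ext` finds the label of rank `n` in expected time at most `B n m` if
`m ≤ S` labels are missing. -/
def ExtSpec (E : Limits) (B : ℕ → ℕ → ℝ) (S d₀ : ℕ) : Prop :=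
  ∀ d, d₀ ≤ d → ∀ (v : Node) (n k : ℕ) (X L₀ : ℝ), Level E v n X L₀ → (low E.val v L₀).ncard = k →
    n - k ≤ S → ∀ (f : Local WVar KVar → ℝ≥0∞) (F : ℝ≥0∞),
    (∀ ws ks, ks k2 = (X : WithTop ℝ) → f (st v ws ks) ≤ F) →
    E.cost d extBody f (st v (mkW n k 0 0 0 0) (mkK ⊤ L₀ ⊤ ⊤ ⊤ ⊤ ⊤ ⊤)) ≤
      ENNReal.ofReal (B n (n - k)) + F

/-- The local state during the exploration of the subtree of `r`. -/
abbrev lev (E : Limits) (v : Node) (n : ℕ) (L₀ : ℝ) (r : Node) (k c s a b : ℕ) (L : ℝ)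
    (U κ : WithTop ℝ) : Local WVar KVar :=
  st v (mkW n k c s a b) (mkK (E.val v) L₀ L U (E.val r) κ ⊤ ⊤)

theorem symb_home {d : ℕ} {f : Local WVar KVar → ℝ≥0∞} {σ : Local WVar KVar} :
    E.symb d home f σ = E.cost d home f σ := rfl

theorem symb_callCount {d : ℕ} {e b : KeyExpr KVar} {i : WVar} {f : Local WVar KVar → ℝ≥0∞}
    {σ : Local WVar KVar} :
    E.symb d (callCount e b i) f σ = E.cost d (callCount e b i) f σ := rfl

theorem symb_callFind {d : ℕ} {e : KeyExpr KVar} {f : Local WVar KVar → ℝ≥0∞}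
    {σ : Local WVar KVar} :
    E.symb d (callFind e) f σ = E.cost d (callFind e) f σ := rfl

section Grow

variable {v : Node} {n : ℕ} {X L₀ : ℝ} (h : Level E v n X L₀) {r : Node} (hr : v <:+ r)
  (hrX : E.val r ≤ X) {B : ℕ → ℕ → ℝ} {S d₀ : ℕ} (hext : ExtSpec E B S d₀) {d : ℕ}
  (hd : d₀ + 200 ≤ d) {f : Local WVar KVar → ℝ≥0∞}

include h hr hrX hext hd

open Classical in
-- The recursive call runs in the subtree of `r` with threshold `L`, so exactly `s` labels are
-- missing there. Its answer `x` may exceed `X`: then `L` and the count `c` are kept, the upper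
-- bound is lowered to `x` if that is smaller, and the flag is set.
theorem cost_grow {k c s₀ q : ℕ} {L : ℝ} {U κ : WithTop ℝ} (hc : IsRank E.val r c L)
    (hk : (low E.val v L).ncard = k) (hLX : L ≤ X) (hkn : k < n) (hq : q ≤ E.bound)
    (hS : ∀ s, 1 ≤ s → s + k ≤ n → (s = 1 ∨ 2 * s ≤ c) → s ≤ S) {F : ℝ≥0∞}
    (hF : ∀ s x, 1 ≤ s → s + k ≤ n → (s = 1 ∨ 2 * s ≤ c) → (c ≤ 2 * s + 1 ∨ s + k = n) →
      L < x → IsRank E.val r (c + s) x →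
      ENNReal.ofReal (B (c + s) s) + (if X < x then
        f (E.lev v n L₀ r k c s 1 (E.capCount v x (n + 1)) L (if (x : WithTop ℝ) < U then x else U)
          x) else
        f (E.lev v n L₀ r (low E.val v x).ncard (c + s) s 0 (E.capCount v x (n + 1)) x U x)) ≤ F) :
    E.symb d grow f (E.lev v n L₀ r k c s₀ 0 q L U κ) ≤ (350 * (n + 2) : ℕ) + F := by
  have hroom := h.room
  have hck : c ≤ k := by
    rw [← hc.2.2, ← hk]
    exact Set.ncard_le_ncard (IsHeap.low_subset_of_suffix hr) (h.finite hLX)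
  have hcn : c ≤ n := by omega
  have hsm : ∀ {k c s a q : ℕ} {u : Node} {ks : KVar → WithTop ℝ}, k ≤ n → c ≤ n → s ≤ n → a ≤ 1 →
      q ≤ E.bound → E.Small (st u (mkW n k c s a q) ks) := by
    intro k c s a q u ks h1 h2 h3 h4 h5
    rw [small_mkW]
    omega
  simp only [grow, symb, chooseStep, WordExpr.eval, update_w3, symb_home, symb_callCount,
    symb_callFind, ExplorableHeap.accept]
  rw [if_pos (by omega)]
  calc _ ≤ 1 + (1 + (1 + ((2 * (n - (1 + k)) + 1 : ℕ) + (1 + ((100 * (n + 1) : ℕ) + (1 + (1 +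
        (1 + (1 + ((2 * n + 1 : ℕ) + (1 + ((220 * (n + 2) : ℕ) + (1 + (6 + F)))))))))))))) := by
        gcongr
        refine cost_chooseLoop (by omega) (fun s hs => hsm (by omega) hcn hs (by omega) hq)
          le_rfl (by omega) (.inl rfl) fun s h1 hsk hsc hsn => ?_
        have hcs : s ≤ n := by omega
        have hlow := h.finite' hr hLX
        -- The subtree is infinite and its part up to `L` is finite, so the label of rank `c + s`
        -- exists even if the rest of the computation has no use for it.
        obtain ⟨x, hLx, hx⟩ := h.heap.exists_isRank hlow (n := c + s) (by rw [hc.2.2]; omega)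
        have hF := hF s x h1 hsk hsc hsn hLx hx
        gcongr
        refine (cost_callFind h.heap (by omega) (by omega) (hsm hkn.le hcn hcs (by omega) hq) rfl
          hr (h.finite hrX) (h.ncard_le hrX)).trans ?_
        gcongr
        refine (cost_call_mk extBody rfl (hsm hkn.le hcn hcs (by omega) hq) (by omega)).trans ?_
        simp only [WordExpr.eval, KeyExpr.eval, mkW_w2, mkW_w3, mkK_k2]
        have hcc : c + s ≤ n := by omega
        have hlev : Level E r (c + s) x L := ⟨h.heap, hx, by omega, hLx⟩
        have key : ∀ f F, (∀ ws ks, ks k2 = (x : WithTop ℝ) → f (st r ws ks) ≤ F) →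
            E.cost (d - 1 - 15) extBody f (st r (mkW (c + s) c 0 0 0 0)
              (mkK ⊤ L ⊤ ⊤ ⊤ ⊤ ⊤ ⊤)) ≤ ENNReal.ofReal (B (c + s) s) + F := by
          intro f F hF
          have := hext (d - 1 - 15) (by omega) r (c + s) c x L hlev hc.2.2
            (by rw [Nat.add_sub_cancel_left]; exact hS s h1 hsk hsc) f F hF
          rwa [Nat.add_sub_cancel_left] at this
        gcongr
        set F' := (if X < x then f (E.lev v n L₀ r k c s 1 (E.capCount v x (n + 1)) L
          (if (x : WithTop ℝ) < U then x else U) x) else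
          f (E.lev v n L₀ r (low E.val v x).ncard (c + s) s 0 (E.capCount v x (n + 1)) x U x))
          with hF'
        refine (key _ (1 + (1 + ((2 * n + 1 : ℕ) + (1 + ((220 * (n + 2) : ℕ) + (1 + (6 + F')))))))
          fun ws ks hks => ?_).trans ?_
        · simp only [noW_elim, retK_elim, hks, update_k5]
          gcongr
          refine (cost_home h.heap (by omega) (hsm hkn.le hcn hcs (by omega) hq) rfl hr
            (h.length_le hr hrX)).trans ?_
          gcongr
          refine (cost_callCount h (by omega) (hsm hkn.le hcn hcs (by omega) hq) rfl
            List.suffix_rfl h.val_le rfl rfl).trans ?_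
          rw [update_w5]
          have hxv : ∃ w, v <:+ w ∧ E.val w = x := by
            obtain ⟨⟨w, hw, hwx⟩, -⟩ := hx
            exact ⟨w, hr.trans hw, hwx⟩
          have hcap := h.lt_capCount_iff hxv
          have hcle : E.capCount v x (n + 1) ≤ n + 1 := capCount_le
          gcongr
          by_cases hxX : X < x
          · simp only [tooLarge, Test.Holds, WordExpr.eval, mkW_w0, mkW_w5, hcap, hxX, if_true,
              update_w4, KeyExpr.eval, mkK_k3, mkK_k5, update_k3, hF']
            rw [if_pos (by omega)]
            split_ifs with hxU
            · calc _ = (4 : ℕ) + f (E.lev v n L₀ r k c s 1 (E.capCount v x (n + 1)) L x x) := by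
                    push_cast; ring
                _ ≤ _ := natCast_add_le (b := 6) (by omega) le_rfl
            · calc _ = (4 : ℕ) + f (E.lev v n L₀ r k c s 1 (E.capCount v x (n + 1)) L U x) := by
                    push_cast; ring
                _ ≤ _ := natCast_add_le (b := 6) (by omega) le_rfl
          · have hce := h.capCount_eq (not_lt.1 hxX)
            simp only [tooLarge, Test.Holds, WordExpr.eval, mkW_w0, mkW_w5, hcap, hxX, if_false,
              update_w2, KeyExpr.eval, mkK_k5, update_k2, hF', update_w1, mkW_w2, mkW_w3]
            rw [if_pos (by omega), if_pos (by omega), hce]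
            calc _ = (5 : ℕ) + f (E.lev v n L₀ r (low E.val v x).ncard (c + s) s 0
                  (low E.val v x).ncard x U x) := by push_cast; ring
              _ ≤ _ := natCast_add_le (b := 6) (by omega) le_rfl
        · calc _ = 1 + (1 + ((2 * n + 1 : ℕ) + (1 + ((220 * (n + 2) : ℕ) + (1 + (6 +
              (ENNReal.ofReal (B (c + s) s) + F'))))))) := by ring
            _ ≤ _ := by gcongr
    _ = ((2 * (n - (1 + k)) + 1 + 100 * (n + 1) + (2 * n + 1) + 220 * (n + 2) + 16 : ℕ) : ℝ≥0∞)
          + F := by push_cast; ring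
    _ ≤ _ := natCast_add_le (by omega) le_rfl

omit hr hrX hext hd in
-- The labels in `(L, x]` below `r` are also labels in `(L, x]` below `v`: progress in one subtree
-- is progress towards the rank `n`.
theorem _root_.ExplorableHeap.Level.ncard_add_le {r : Node} (hr : v <:+ r) {L x : ℝ} (hLx : L ≤ x)
    (hx : x ≤ X) : (low E.val v L).ncard + (low E.val r x).ncard ≤
      (low E.val v x).ncard + (low E.val r L).ncard := by
  have h1 := h.finite hx
  have h2 := h.finite' hr hx
  have h3 : Disjoint (low E.val v L) (low E.val r x \ low E.val r L) := by
    rw [Set.disjoint_left]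
    exact fun w hw hw' => hw'.2 ⟨hw'.1.1, hw.2⟩
  have h4 := Set.ncard_union_eq h3 (h.finite (hLx.trans hx)) (h2.subset Set.sdiff_subset)
  have h5 := Set.ncard_sdiff_add_ncard_of_subset (IsHeap.low_mono (v := r) (val := E.val) hLx) h2
  have h6 : (low E.val v L ∪ (low E.val r x \ low E.val r L)).ncard ≤ (low E.val v x).ncard :=
    Set.ncard_le_ncard (Set.union_subset (IsHeap.low_mono hLx)
      (Set.sdiff_subset.trans (IsHeap.low_subset_of_suffix hr))) h1
  omega

end Grow

/-- The number of missing labels, if it is at least `2`. -/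
noncomputable def excess (m : ℕ) : ℝ := if m ≤ 1 then 0 else m

theorem excess_nonneg (m : ℕ) : 0 ≤ excess m := by
  rw [excess]
  split_ifs <;> positivity

theorem excess_le (m : ℕ) : excess m ≤ m := by
  rw [excess]
  split_ifs
  · positivity
  · exact le_rfl

/-- From `log t ≥ 1 - 1 / t` the difference is at least `s / (c + s)`. -/
theorem quarter_le_log {c s : ℕ} (hc : 1 ≤ c) (hs : c ≤ 3 * s) :
    1 / 4 ≤ Real.log (c + s : ℕ) - Real.log c := by
  have hc' : (0 : ℝ) < c := by exact_mod_cast hc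
  have hs' : (c : ℝ) ≤ 3 * s := by exact_mod_cast hs
  have hcs : (0 : ℝ) < c + s := by positivity
  rw [Nat.cast_add, ← Real.log_div hcs.ne' hc'.ne']
  refine le_trans ?_ (Real.one_sub_inv_le_log_of_pos (by positivity))
  rw [inv_div, le_sub_iff_add_le, ← le_sub_iff_add_le', div_le_iff₀ hcs]
  linarith

theorem ofReal_add_le_ofReal_add {x y z : ℝ} (h : x + y ≤ z) (hx : 0 ≤ x) (hy : 0 ≤ y)
    {F G : ℝ≥0∞} (hF : F ≤ ENNReal.ofReal y + G) :
    ENNReal.ofReal x + F ≤ ENNReal.ofReal z + G := by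
  calc _ ≤ ENNReal.ofReal x + (ENNReal.ofReal y + G) := by gcongr
    _ = ENNReal.ofReal (x + y) + G := by rw [ENNReal.ofReal_add hx hy, add_assoc]
    _ ≤ _ := by gcongr

section GrowLoop

variable {v : Node} {n : ℕ} {X L₀ : ℝ} (h : Level E v n X L₀) {r : Node} (hr : v <:+ r)
  (hrX : E.val r ≤ X) {w μ : ℝ} (hw : 0 ≤ w) (hμ : 0 ≤ μ) {S d₀ : ℕ}
  (hext : ExtSpec E (fun n m => w * (n + 6 * excess m * μ)) S d₀) {d : ℕ}
  (hd : d₀ + 210 ≤ d) {f : Local WVar KVar → ℝ≥0∞}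

include h hd in
open Classical in
theorem growLoop_unfold {k c s a q : ℕ} {L : ℝ} {U κ : WithTop ℝ} (hk : k ≤ n) (hc : c ≤ n)
    (hs : s ≤ E.bound) (ha : a ≤ 1) (hq : q ≤ E.bound) :
    E.cost d growLoop f (E.lev v n L₀ r k c s a q L U κ) ≤
      1 + if k < n ∧ a < 1 then E.symb (d - 1) grow (E.cost d growLoop f)
        (E.lev v n L₀ r k c s a q L U κ) else f (E.lev v n L₀ r k c s a q L U κ) := by
  have hroom := h.room
  have hs' : E.Small (E.lev v n L₀ r k c s a q L U κ) := by
    rw [small_mkW]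
    omega
  have hh : grow.height + 1 ≤ d := by
    simp [grow, chooseStep, callFind, home, callCount, callQuery, ExplorableHeap.accept, Cmd.height]
    omega
  refine (E.cost_while (b := .and (.wordLt (.var w1) (.var w0)) (.wordLt (.var w4) (.lit 1)))
    (c := grow) hs' hh).trans (le_of_eq ?_)
  simp only [Test.Holds, WordExpr.eval, mkW_w0, mkW_w1, mkW_w4]
  congr

include h hr hrX hw hμ hext hd

/-- Three accounts are kept, with `g` labels up to `X` below `r`. A successful call that does not
finish has `c ≤ 3 s`, so `c` grows by a factor of at least `4 / 3`, and the logarithm pays the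
linear overhead. The term `6 (g - c) + 2 c` drops by `4 s`, which pays the size `c + s` of the call.
The increments of the successful calls sum to at most `g - c`, and the single failing call adds at
most `ρ / 2`; these are the terms with factor `μ`. -/
theorem cost_growLoop {L₁ ρ : ℝ} (hρ₀ : 0 ≤ ρ)
    (hρ : ∀ c s L x, L₁ ≤ L → L ≤ X → IsRank E.val r c L → s + (low E.val v L).ncard ≤ n →
      IsRank E.val r (c + s) x → X < x → (c : ℝ) ≤ ρ)
    (hS : ∀ c s L, L ≤ X → IsRank E.val r c L → 1 ≤ s → s + (low E.val v L).ncard ≤ n →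
      (s = 1 ∨ 2 * s ≤ c) → s ≤ S) {U : WithTop ℝ} (hXU : X < U) {G : ℝ≥0∞}
    (hG : ∀ c s a q L U' κ, L₁ ≤ L → L ≤ X → IsRank E.val r c L → (X : WithTop ℝ) < U' → U' ≤ U →
      (a = 0 ∧ L = X ∨ a = 1 ∧ ∃ u : ℝ, U' = u ∧ (low E.val r u).Finite ∧
        (low E.val r u).ncard ≤ n) → c ≤ n → s ≤ E.bound → q ≤ E.bound →
      f (E.lev v n L₀ r (low E.val v L).ncard c s a q L U' κ) ≤ G)
    {c s q : ℕ} {L : ℝ} {κ : WithTop ℝ} (hc : IsRank E.val r c L) (hc1 : 1 ≤ c) (hLX : L ≤ X)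
    (hL : L₁ ≤ L) (hs : s ≤ E.bound) (hq : q ≤ E.bound) :
    E.cost d growLoop f (E.lev v n L₀ r (low E.val v L).ncard c s 0 q L U κ) ≤
      ENNReal.ofReal (400 * (n + 2) * (4 * (Real.log n - Real.log c) + 2) +
        w * (6 * ((low E.val r X).ncard - c) + 2 * c +
          6 * μ * ((low E.val r X).ncard - c + ρ / 2))) + G := by
  have hroom := h.room
  induction hm : (low E.val r X).ncard - c using Nat.strong_induction_on generalizing c s q L κ with
  | _ m ih =>
  have hcg : ∀ {c L}, IsRank E.val r c L → L ≤ X → c ≤ (low E.val r X).ncard := fun hc hL =>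
    hc.2.2 ▸ Set.ncard_le_ncard (IsHeap.low_mono hL) (h.finite' hr le_rfl)
  have hgn := h.ncard_le' hr le_rfl
  have hcg' := hcg hc hLX
  have hkn' := h.ncard_le hLX
  have hlog : Real.log c ≤ Real.log n := Real.log_le_log (by exact_mod_cast hc1)
    (by exact_mod_cast hcg'.trans hgn)
  have hcgr : (c : ℝ) ≤ (low E.val r X).ncard := by exact_mod_cast hcg'
  set g : ℝ := ((low E.val r X).ncard : ℝ) with hg
  have hu : (0 : ℝ) ≤ 400 * (n + 2) := by positivity
  have hfin : ∀ {c s q L U' κ a}, c ≤ n → s ≤ E.bound → q ≤ E.bound → a ≤ 1 →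
      (a = 1 ∨ n ≤ (low E.val v L).ncard) → (low E.val v L).ncard ≤ n →
      f (E.lev v n L₀ r (low E.val v L).ncard c s a q L U' κ) ≤ G →
      E.cost d growLoop f (E.lev v n L₀ r (low E.val v L).ncard c s a q L U' κ) ≤
        ENNReal.ofReal 1 + G := by
    intro c s q L U' κ a h1 h2 h3 h4 h5 h6 h7
    refine (growLoop_unfold h hd h6 h1 h2 h4 h3).trans ?_
    rw [if_neg (by omega), ENNReal.ofReal_one]
    gcongr
  have hy : 0 ≤ w * (6 * (g - c) + 2 * c + 6 * μ * (g - c + ρ / 2)) := by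
    have := sub_nonneg.2 hcgr
    positivity
  have hy' : 400 * ((n : ℝ) + 2) * 2 ≤
      400 * (n + 2) * (4 * (Real.log n - Real.log c) + 2) := by
    gcongr
    linarith
  by_cases hkn : (low E.val v L).ncard < n
  · refine (growLoop_unfold h hd hkn.le (hcg'.trans hgn) hs (by omega) hq).trans ?_
    rw [if_pos ⟨hkn, by omega⟩]
    set Y := 400 * ((n : ℝ) + 2) * (4 * (Real.log n - Real.log c) + 2) +
      w * (6 * (g - c) + 2 * c + 6 * μ * (g - c + ρ / 2)) - (350 * (n + 2) + 1) with hY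
    have hY0 : 0 ≤ Y := by linarith
    refine (add_le_add_right (cost_grow h hr hrX hext (by omega) hc rfl hLX hkn hq
      (F := ENNReal.ofReal Y + G) (fun s h1 h2 h3 => hS c s L hLX hc h1 h2 h3) ?_) 1).trans ?_
    · intro s' x h1 hsk hsc hsn hLx hx
      have hs' : s' ≤ n := by omega
      have hxv : ∃ w, v <:+ w ∧ E.val w = x := by
        obtain ⟨⟨w, hw, hwx⟩, -⟩ := hx
        exact ⟨w, hr.trans hw, hwx⟩
      have h2c : (s' : ℝ) ≤ c := by
        have : s' ≤ c := by omega
        exact_mod_cast this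
      have hB : 0 ≤ w * ((c + s' : ℕ) + 6 * excess s' * μ) := by
        have := excess_nonneg s'
        positivity
      by_cases hXx : X < x
      · rw [if_pos hXx]
        have hcρ := hρ c s' L x hL hLX hc hsk hx hXx
        -- For `s' = 1` the inequality `s' ≤ c / 2` may fail, and here it matters that `excess 1 =
        -- 0`. Otherwise `2 s' ≤ c ≤ ρ`.
        have hes : excess s' ≤ ρ / 2 := by
          rw [excess]
          split_ifs with h2
          · positivity
          · have : 2 * s' ≤ c := by omega
            have : 2 * (s' : ℝ) ≤ c := by exact_mod_cast this
            linarith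
        have hcs : c + s' ≤ n := by
          have := hc.2.2 ▸ Set.ncard_le_ncard (IsHeap.low_subset_of_suffix hr) (h.finite hLX)
          omega
        refine ofReal_add_le_ofReal_add ?_ hB zero_le_one (hfin (hcg'.trans hgn) (by omega)
          (capCount_le.trans (by omega)) le_rfl (.inl rfl) hkn.le ?_)
        · have h3 : w * ((c + s' : ℕ) + 6 * excess s' * μ) ≤
              w * (6 * (g - c) + 2 * c + 6 * μ * (g - c + ρ / 2)) := by
            refine mul_le_mul_of_nonneg_left ?_ hw
            have h4 : excess s' * μ ≤ (g - c + ρ / 2) * μ :=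
              mul_le_mul_of_nonneg_right (by linarith) hμ
            push_cast
            linarith
          linarith
        · refine hG _ _ _ _ _ _ _ hL hLX hc ?_ ?_ (.inr ⟨rfl, ?_⟩) (hcg'.trans hgn) (by omega)
            (capCount_le.trans (by omega))
          · split_ifs
            · exact_mod_cast hXx
            · exact hXU
          · split_ifs with hxU
            · exact hxU.le
            · exact le_rfl
          · split_ifs with hxU
            · exact ⟨x, rfl, hx.2.1, hx.2.2.trans_le hcs⟩
            · obtain ⟨u, rfl⟩ := WithTop.ne_top_iff_exists.1
                (ne_top_of_le_ne_top (WithTop.coe_ne_top) (not_lt.1 hxU))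
              have hsub : low E.val r u ⊆ low E.val r x :=
                IsHeap.low_mono (WithTop.coe_le_coe.1 (not_lt.1 hxU))
              exact ⟨u, rfl, hx.2.1.subset hsub,
                (Set.ncard_le_ncard hsub hx.2.1).trans (hx.2.2.trans_le hcs)⟩
      · rw [if_neg hXx]
        have hxX := not_lt.1 hXx
        have hcap := h.capCount_eq hxX
        have hcg2 := hcg hx hxX
        have hcgr2 : (c : ℝ) + s' ≤ g := by rw [hg]; exact_mod_cast hcg2
        have hes := excess_le s'
        have hk' := h.ncard_add_le hr hLx.le hxX
        rw [hc.2.2, hx.2.2] at hk'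
        have hesμ : excess s' * μ ≤ s' * μ := mul_le_mul_of_nonneg_right hes hμ
        by_cases hfull : n ≤ (low E.val v x).ncard
        · refine ofReal_add_le_ofReal_add ?_ hB zero_le_one (hfin (hcg2.trans hgn) (by omega)
            (capCount_le.trans (by omega)) (by omega) (.inr hfull) (h.ncard_le hxX) ?_)
          · have h3 : w * ((c + s' : ℕ) + 6 * excess s' * μ) ≤
                w * (6 * (g - c) + 2 * c + 6 * μ * (g - c + ρ / 2)) := by
              refine mul_le_mul_of_nonneg_left ?_ hw
              have h4 : s' * μ ≤ (g - c + ρ / 2) * μ :=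
                mul_le_mul_of_nonneg_right (by linarith) hμ
              push_cast
              linarith
            linarith
          · exact hG _ _ _ _ _ _ _ (hL.trans hLx.le) hxX hx hXU le_rfl
              (.inl ⟨rfl, h.eq_of_ncard hxX hfull⟩) (hcg2.trans hgn) (by omega)
              (capCount_le.trans (by omega))
        -- The rank `n` is not reached, so `s' + k = n` is impossible and the increment was limited
        -- by `c ≤ 2 s' + 1` alone.
        · have hcs3 : c ≤ 3 * s' := by omega
          have hcs3r : (c : ℝ) ≤ 3 * s' := by exact_mod_cast hcs3
          have hq := quarter_le_log hc1 hcs3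
          have hlog2 : Real.log (c + s' : ℕ) ≤ Real.log n := Real.log_le_log
            (by exact_mod_cast (by omega : 0 < c + s')) (by exact_mod_cast hcg2.trans hgn)
          refine ofReal_add_le_ofReal_add ?_ hB ?_ (ih _ (by omega) hx (by omega) hxX
            (hL.trans hLx.le) (by omega) (capCount_le.trans (by omega)) rfl)
          · have h3 : w * ((c + s' : ℕ) + 6 * excess s' * μ) + w * (6 * (g - (c + s' : ℕ)) +
                2 * (c + s' : ℕ) + 6 * μ * (g - (c + s' : ℕ) + ρ / 2)) ≤
                w * (6 * (g - c) + 2 * c + 6 * μ * (g - c + ρ / 2)) := by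
              rw [← mul_add]
              refine mul_le_mul_of_nonneg_left ?_ hw
              push_cast
              linarith
            have h4 : 400 * ((n : ℝ) + 2) * (4 * (Real.log n - Real.log (c + s' : ℕ)) + 2) ≤
                400 * (n + 2) * (4 * (Real.log n - Real.log c) + 2 - 1) := by
              gcongr
              linarith
            linarith
          · have : (0 : ℝ) ≤ g - (c + s' : ℕ) := by push_cast; linarith
            have : 0 ≤ Real.log n - Real.log (c + s' : ℕ) := sub_nonneg.2 hlog2
            positivity
    · rw [← add_assoc, ← Nat.cast_one, ← Nat.cast_add]
      refine natCast_add_ofReal_le ?_ hY0 le_rfl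
      push_cast
      linarith
  · refine (hfin (hcg'.trans hgn) hs hq (by omega) (.inr (not_lt.1 hkn)) hkn' ?_).trans ?_
    · exact hG _ _ _ _ _ _ _ hL hLX hc hXU le_rfl
        (.inl ⟨rfl, h.eq_of_ncard hLX (not_lt.1 hkn)⟩) (hcg'.trans hgn) hs hq
    · gcongr
      linarith

end GrowLoop

end Limits

/-! ### Random search among the candidates of one subtree -/

theorem sum_range_getElem {α : Type*} [DecidableEq α] {l : List α} (hl : l.Nodup) {x : ℕ → ℝ}
    {y : α → ℝ} (h : ∀ i w, l[i]? = some w → x i = y w) :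
    ∑ i ∈ Finset.range l.length, x i = ∑ w ∈ l.toFinset, y w := by
  rw [List.sum_toFinset y hl]
  clear hl
  induction l generalizing x with
  | nil => simp
  | cons a l ih =>
    rw [List.length_cons, Finset.sum_range_succ', List.map_cons, List.sum_cons, add_comm,
      ih (x := fun i => x (i + 1)) fun i w hi => h (i + 1) w (by simpa using hi),
      h 0 a (by simp)]

namespace Limits

variable {E : Limits}

theorem symb_callItems {d : ℕ} {t : WordExpr WVar} {rw : WVar → Option WVar}
    {rk : KVar → Option KVar} {f : Local WVar KVar → ℝ≥0∞} {σ : Local WVar KVar} :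
    E.symb d (callItems t rw rk) f σ = E.cost d (callItems t rw rk) f σ := rfl

section Refine

variable {v : Node} {n : ℕ} {X L₀ : ℝ} (h : Level E v n X L₀) {r : Node} (hr : v <:+ r)
  (hrX : E.val r ≤ X) {d : ℕ} (hd : 210 ≤ d) {f : Local WVar KVar → ℝ≥0∞}

include h hd in
open Classical in
theorem refineLoop_unfold {k c s a q : ℕ} {L : ℝ} {U κ : WithTop ℝ} (hk : k ≤ n) (hc : c ≤ n)
    (hs : s ≤ E.bound) (ha : a ≤ n + 1) (hq : q ≤ E.bound) :
    E.cost d refineLoop f (E.lev v n L₀ r k c s a q L U κ) ≤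
      1 + if 0 < a then E.symb (d - 1) refine (E.cost d refineLoop f)
        (E.lev v n L₀ r k c s a q L U κ) else f (E.lev v n L₀ r k c s a q L U κ) := by
  have hroom := h.room
  have hs' : E.Small (E.lev v n L₀ r k c s a q L U κ) := by
    rw [small_mkW]
    omega
  have hh : refine.height + 1 ≤ d := by
    simp [refine, callItems, callCount, callQuery, ExplorableHeap.accept, Cmd.height]
    omega
  refine (E.cost_while (b := .wordLt (.lit 0) (.var w4)) (c := ExplorableHeap.refine) hs'
    hh).trans (le_of_eq ?_)
  simp only [Test.Holds, WordExpr.eval, mkW_w4]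
  congr

omit hd in
include h hr hrX in
open Classical in
theorem cost_refine (hd : 200 ≤ d) {k c s a q : ℕ} {L u : ℝ} {κ : WithTop ℝ} (hk : k ≤ n)
    (hc : c ≤ n)
    (hs : s ≤ E.bound) (ha : a ≤ n + 1) (hq : q ≤ E.bound) (hf : (low E.val r u).Finite)
    (hfn : (low E.val r u).ncard ≤ n) {l : List Node} (hl : Preorder E.val u r l) {G : ℝ≥0∞}
    (h0 : (E.candidates L u l).length = 0 →
      f (E.lev v n L₀ r k c s 0 q L u κ) ≤ ENNReal.ofReal 1 + G)
    {y : ℝ} (hy : 0 ≤ y) {x : Node → ℝ} (hx : ∀ w, 0 ≤ x w)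
    (hxy : 0 < (E.candidates L u l).length → ∑ w ∈ (E.candidates L u l).toFinset, x w ≤
      (E.candidates L u l).length * y)
    (hF : ∀ w ∈ E.candidates L u l, ∀ p s, 0 < p → p ≤ n → s ≤ n → (if X < E.val w then
        f (E.lev v n L₀ r k c s p (E.capCount v (E.val w) (n + 1)) L (E.val w) (E.val w)) else
        f (E.lev v n L₀ r (low E.val v (E.val w)).ncard c s p (E.capCount v (E.val w) (n + 1))
          (E.val w) u (E.val w))) ≤ ENNReal.ofReal (x w) + G) :
    E.symb d refine f (E.lev v n L₀ r k c s a q L u κ) ≤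
      ENNReal.ofReal (700 * (n + 2) + y) + G := by
  have hroom := h.room
  have hsm : ∀ {s a q : ℕ} {ks : KVar → WithTop ℝ}, s ≤ E.bound → a ≤ n + 1 →
      q ≤ E.bound → E.Small (st v (mkW n k c s a q) ks) := by
    intro s a q ks h1 h2 h3
    rw [small_mkW]
    omega
  have hlen := (length_candidates_le (L := L) hl h.heap hf).trans hfn
  obtain ⟨p, hp⟩ : ∃ p, p = (E.candidates L u l).length := ⟨_, rfl⟩
  rw [← hp] at h0 hxy hlen
  simp only [refine, symb, symb_callItems, symb_callCount, ExplorableHeap.accept]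
  calc _ ≤ 1 + ((220 * (n + 2) : ℕ) + (1 + (ENNReal.ofReal (450 * (n + 2) + 5 + y) + G))) := by
        gcongr
        refine (cost_callItems_all h (by omega) (hsm hs ha hq) hr hrX rfl rfl rfl hf hfn hl
          (by rfl)).trans ?_
        gcongr
        rw [← hp]
        simp only [update_w4, Test.Holds, WordExpr.eval, mkW_w4]
        split_ifs with h1 h2
        · rw [Nat.sub_add_cancel h1, ← add_assoc, one_add_one_eq_two]
          refine natCast_add_ofReal_le (a := 2) (x := 440 * (n + 2) + 9 + y)
            (by push_cast; linarith) (by positivity) (average_le h1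
            (x := fun i => 440 * (n + 2) + 9 + ((E.candidates L u l)[i]?).elim 0 x) ?_ ?_ ?_)
          · intro i _
            have : 0 ≤ ((E.candidates L u l)[i]?).elim 0 x := by
              cases (E.candidates L u l)[i]? with
              | none => exact le_rfl
              | some w => exact hx w
            positivity
          · intro i hi
            obtain ⟨w, hw⟩ : ∃ w, (E.candidates L u l)[i]? = some w :=
              ⟨_, List.getElem?_eq_getElem (hp ▸ hi)⟩
            have hwc := List.mem_of_getElem? hw
            have hwv := ((mem_candidates hl h.heap).1 hwc).1
            have hin : i ≤ n := by omega
            have hF := hF w hwc p i h1 hlen hin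
            rw [hw, Option.elim_some]
            refine natCast_add_ofReal_le (a := 440 * (n + 2) + 9) (x := x w)
              (F := if X < E.val w then f (E.lev v n L₀ r k c i p (E.capCount v (E.val w) (n + 1)) L
                (E.val w) (E.val w)) else f (E.lev v n L₀ r (low E.val v (E.val w)).ncard c i p
                (E.capCount v (E.val w) (n + 1)) (E.val w) u (E.val w)))
              (by push_cast; linarith) (hx w) hF |> le_trans ?_
            simp only [update_w3]
            have hsm' : ∀ {q : ℕ} {ks : KVar → WithTop ℝ}, q ≤ E.bound →
                E.Small (st v (mkW n k c i p q) ks) := fun h3 => hsm (by omega) (by omega) h3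
            set F' := (if X < E.val w then f (E.lev v n L₀ r k c i p
                (E.capCount v (E.val w) (n + 1)) L
                (E.val w) (E.val w)) else f (E.lev v n L₀ r (low E.val v (E.val w)).ncard c i p
                (E.capCount v (E.val w) (n + 1)) (E.val w) u (E.val w))) with hF'
            calc _ ≤ 1 + ((220 * (n + 2) : ℕ) + (1 + ((220 * (n + 2) : ℕ) + (1 + (6 + F'))))) := by
                  gcongr
                  refine (cost_callItems_nth h (by omega) (hsm' hq) hr hrX rfl rfl rfl hf hfn hl
                    hw (by rfl)).trans ?_
                  rw [update_k5]
                  gcongr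
                  refine (cost_callCount h (by omega) (hsm' hq) rfl List.suffix_rfl h.val_le rfl
                    rfl).trans ?_
                  rw [update_w5]
                  have hcap := h.lt_capCount_iff ⟨w, hr.trans hwv, rfl⟩
                  have hcle : E.capCount v (E.val w) (n + 1) ≤ n + 1 := capCount_le
                  gcongr
                  by_cases hxX : X < E.val w
                  · simp only [tooLarge, Test.Holds, WordExpr.eval, mkW_w0, mkW_w5, hcap, hxX,
                      if_true, KeyExpr.eval, mkK_k5, update_k3, hF']
                    calc _ = (1 : ℕ) + f (E.lev v n L₀ r k c i p (E.capCount v (E.val w) (n + 1)) L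
                          (E.val w) (E.val w)) := by push_cast; ring
                      _ ≤ _ := natCast_add_le (b := 6) (by omega) le_rfl
                  · have hce := h.capCount_eq (not_lt.1 hxX)
                    simp only [tooLarge, Test.Holds, WordExpr.eval, mkW_w0, mkW_w5, hcap, hxX,
                      if_false, KeyExpr.eval, mkK_k5, update_k2, hF', update_w1]
                    rw [if_pos (by omega), hce]
                    calc _ = (3 : ℕ) + f (E.lev v n L₀ r (low E.val v (E.val w)).ncard c i p
                          (low E.val v (E.val w)).ncard (E.val w) u (E.val w)) := by
                          push_cast; ring
                      _ ≤ _ := natCast_add_le (b := 6) (by omega) le_rfl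
              _ = _ := by push_cast; ring
          · have := hxy h1
            rw [hp, Finset.sum_add_distrib, Finset.sum_const, Finset.card_range, nsmul_eq_mul,
              sum_range_getElem (nodup_candidates hl)
                (x := fun i => ((E.candidates L u l)[i]?).elim 0 x) (y := x)
                (fun i w hi => by simp only [hi, Option.elim_some])]
            rw [hp] at this
            linarith
        · omega
        · have hp0 : p = 0 := by omega
          rw [hp0]
          refine (add_le_add_right (h0 hp0) 1).trans ?_
          rw [← Nat.cast_one (R := ℝ≥0∞)]
          exact natCast_add_ofReal_le (a := 1) (by push_cast; linarith) zero_le_one le_rfl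
    _ = ((220 * (n + 2) + 2 : ℕ) : ℝ≥0∞) + (ENNReal.ofReal (450 * (n + 2) + 5 + y) + G) := by
        push_cast; ring
    _ ≤ _ := by
        refine natCast_add_ofReal_le ?_ (by positivity) le_rfl
        push_cast
        linarith

include h hr hrX hd

/-- Randomized binary search. The candidates between `L` and `u` split into those up to `X` and
those above it; testing one of them raises `L` or lowers `u` to it, and the two harmonic numbers
together drop by at least one on average. The first upper bound `u₁` fixes a finite set in which
both parts live during the whole loop. -/
theorem cost_refineLoop {L₁ u₁ : ℝ} (hf₁ : (low E.val r u₁).Finite)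
    (hn₁ : (low E.val r u₁).ncard ≤ n) {G : ℝ≥0∞}
    (hG : ∀ c s q L u κ, L₁ ≤ L → L ≤ X → (∃ w, r <:+ w ∧ E.val w = L) → X < u → u ≤ u₁ →
      (∀ w, r <:+ w → L < E.val w → u ≤ E.val w) → c ≤ n → s ≤ E.bound → q ≤ E.bound →
      f (E.lev v n L₀ r (low E.val v L).ncard c s 0 q L u κ) ≤ G)
    {c s a q : ℕ} {L u : ℝ} {κ : WithTop ℝ} (hL : L₁ ≤ L) (hLX : L ≤ X)
    (hLr : ∃ w, r <:+ w ∧ E.val w = L) (hXu : X < u) (hu : u ≤ u₁) (hc : c ≤ n)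
    (hs : s ≤ E.bound) (ha : 0 < a) (han : a ≤ n + 1) (hq : q ≤ E.bound) :
    E.cost d refineLoop f (E.lev v n L₀ r (low E.val v L).ncard c s a q L u κ) ≤
      ENNReal.ofReal (1000 * (n + 2) * (1 +
        (harmonic (hf₁.toFinset.filter fun w => L < E.val w ∧ E.val w ≤ X).card +
        harmonic (hf₁.toFinset.filter fun w => X < E.val w ∧ E.val w < u).card : ℝ))) + G := by
  classical
  have hroom := h.room
  set A : ℝ → Finset Node := fun L => hf₁.toFinset.filter fun w => L < E.val w ∧ E.val w ≤ X
    with hA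
  set B : ℝ → Finset Node := fun u => hf₁.toFinset.filter fun w => X < E.val w ∧ E.val w < u
    with hB
  change _ ≤ ENNReal.ofReal (1000 * (n + 2) * (1 + (harmonic (A L).card + harmonic (B u).card))) + G
  have hmA : ∀ L w, w ∈ A L ↔ r <:+ w ∧ E.val w ≤ u₁ ∧ L < E.val w ∧ E.val w ≤ X := by
    intro L w
    simp only [hA, Finset.mem_filter, Set.Finite.mem_toFinset, low, Set.mem_ofPred_eq, and_assoc]
  have hmB : ∀ u w, w ∈ B u ↔ r <:+ w ∧ E.val w ≤ u₁ ∧ X < E.val w ∧ E.val w < u := by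
    intro u w
    simp only [hB, Finset.mem_filter, Set.Finite.mem_toFinset, low, Set.mem_ofPred_eq, and_assoc]
  induction hm : (A L).card + (B u).card using Nat.strong_induction_on
    generalizing c s a q L u κ with
  | _ m ih =>
  have hf : (low E.val r u).Finite := hf₁.subset (IsHeap.low_mono hu)
  have hfn : (low E.val r u).ncard ≤ n := (Set.ncard_le_ncard (IsHeap.low_mono hu) hf₁).trans hn₁
  obtain ⟨l, hl⟩ := IsHeap.exists_preorder hf
  have hcand : (E.candidates L u l).toFinset = A L ∪ B u := by
    ext w
    rw [List.mem_toFinset, mem_candidates hl h.heap, Finset.mem_union, hmA, hmB]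
    constructor
    · rintro ⟨h1, h2, h3⟩
      rcases le_or_gt (E.val w) X with h4 | h4
      · exact .inl ⟨h1, h3.le.trans hu, h2, h4⟩
      · exact .inr ⟨h1, h3.le.trans hu, h4, h3⟩
    · rintro (⟨h1, -, h2, h3⟩ | ⟨h1, -, h2, h3⟩)
      · exact ⟨h1, h2, h3.trans_lt hXu⟩
      · exact ⟨h1, hLX.trans_lt h2, h3⟩
  have hsubA : ∀ w ∈ A L, A (E.val w) ⊆ (A L).filter fun j => E.val w < E.val j := by
    intro w hw j hj
    rw [hmA] at hw hj
    rw [Finset.mem_filter, hmA]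
    exact ⟨⟨hj.1, hj.2.1, hw.2.2.1.trans hj.2.2.1, hj.2.2.2⟩, hj.2.2.1⟩
  have hsubB : ∀ w ∈ B u, B (E.val w) ⊆ (B u).filter fun j => E.val j < E.val w := by
    intro w hw j hj
    rw [hmB] at hw hj
    rw [Finset.mem_filter, hmB]
    exact ⟨⟨hj.1, hj.2.1, hj.2.2.1, hj.2.2.2.trans hw.2.2.2⟩, hj.2.2.2⟩
  -- `a' w` and `b' w` are the sizes of the two parts after the test of `w`; the part that does not
  -- contain `w` is unchanged.
  set a' : Node → ℕ := fun w => if w ∈ A L then (A (E.val w)).card else (A L).card with ha'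
  set b' : Node → ℕ := fun w => if w ∈ B u then (B (E.val w)).card else (B u).card with hb'
  have hsum := sum_harmonic_union_le (A L) (B u) E.val E.val (a' := a') (b' := b')
    (fun w hw => by
      simp only [ha', if_pos hw]
      exact Finset.card_le_card (hsubA w hw))
    (fun w hw => by simp only [ha', if_neg hw, le_refl])
    (fun w hw => by
      simp only [hb', if_pos hw]
      exact Finset.card_le_card (hsubB w hw))
    (fun w hw => by simp only [hb', if_neg hw, le_refl])
  have hcardA : ∀ w ∈ A L, (A (E.val w)).card < (A L).card := fun w hw =>
    (Finset.card_le_card (hsubA w hw)).trans_lt (Finset.card_lt_card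
      (Finset.filter_ssubset.2 ⟨w, hw, lt_irrefl _⟩))
  have hcardB : ∀ w ∈ B u, (B (E.val w)).card < (B u).card := fun w hw =>
    (Finset.card_le_card (hsubB w hw)).trans_lt (Finset.card_lt_card
      (Finset.filter_ssubset.2 ⟨w, hw, lt_irrefl _⟩))
  have hcl : ((E.candidates L u l).length : ℝ) = (A L ∪ B u).card := by
    rw [← hcand, List.toFinset_card_of_nodup (nodup_candidates hl)]
  have hh0 := fun a => harmonic_nonneg a
  refine (refineLoop_unfold h hd (h.ncard_le hLX) hc hs han hq).trans ?_
  rw [if_pos ha]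
  refine (add_le_add_right (cost_refine h hr hrX (d := d - 1) (by omega) (h.ncard_le hLX) hc hs han
    hq hf hfn hl (G := G) (y := 1000 * (n + 2) * (harmonic (A L).card + harmonic (B u).card)) ?_
    (by have := hh0 (A L).card; have := hh0 (B u).card; positivity)
    (x := fun w => 1000 * (n + 2) * (1 + (harmonic (a' w) + harmonic (b' w))))
    (fun w => by have := hh0 (a' w); have := hh0 (b' w); positivity) ?_ ?_) 1).trans ?_
  · intro h0
    refine (refineLoop_unfold h hd (h.ncard_le hLX) hc hs (by omega) hq).trans ?_
    rw [if_neg (by omega), ENNReal.ofReal_one]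
    gcongr
    refine hG c s q L u κ hL hLX hLr hXu hu (fun w hw hw' => ?_) hc hs hq
    by_contra hlt
    have := (mem_candidates (L := L) hl h.heap).2 ⟨hw, hw', not_le.1 hlt⟩
    rw [List.length_eq_zero_iff.1 h0] at this
    simp at this
  · intro _
    rw [hcand, ← Finset.mul_sum, Finset.sum_add_distrib, Finset.sum_const, nsmul_eq_mul, mul_one,
      hcl]
    have hK : (0 : ℝ) ≤ 1000 * (n + 2) := by positivity
    have := mul_le_mul_of_nonneg_left hsum hK
    linarith
  · intro w hw p s' hp0 hp hs'
    have hw' : w ∈ A L ∪ B u := by rw [← hcand]; exact List.mem_toFinset.2 hw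
    obtain ⟨hwr, hLw, hwu⟩ := (mem_candidates hl h.heap).1 hw
    by_cases hXw : X < E.val w
    · have hwB : w ∈ B u := (hmB u w).2 ⟨hwr, hwu.le.trans hu, hXw, hwu⟩
      have hwA : w ∉ A L := fun hwA => absurd ((hmA L w).1 hwA).2.2.2 (not_le.2 hXw)
      have := hcardB w hwB
      rw [if_pos hXw]
      simp only [ha', hb', if_pos hwB, if_neg hwA]
      exact ih _ (by omega) hL hLX hLr hXw (hwu.le.trans hu) hc (by omega) hp0 (by omega)
        (capCount_le.trans (by omega)) rfl
    · have hwA : w ∈ A L := (hmA L w).2 ⟨hwr, hwu.le.trans hu, hLw, not_lt.1 hXw⟩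
      have hwB : w ∉ B u := fun hwB => hXw ((hmB u w).1 hwB).2.2.1
      have := hcardA w hwA
      rw [if_neg hXw]
      simp only [ha', hb', if_pos hwA, if_neg hwB]
      exact ih _ (by omega) (hL.trans hLw.le) (not_lt.1 hXw) ⟨w, hwr, rfl⟩ hXu hu hc (by omega)
        hp0 (by omega) (capCount_le.trans (by omega)) rfl
  · rw [← Nat.cast_one (R := ℝ≥0∞)]
    have h1 := hh0 (A L).card
    have h2 := hh0 (B u).card
    refine natCast_add_ofReal_le ?_ (by positivity) le_rfl
    push_cast
    nlinarith

end Refine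

end Limits

/-! ## The forest of unknown labels -/

namespace Limits

variable (E : Limits)

/-- The number of labels at most `y` in the subtree of `r`. -/
noncomputable def count (r : Node) (y : ℝ) : ℕ := (low E.val r y).ncard

open Classical in
/-- The roots of the forest of labels above `L₀` in the subtree of `v`. -/
noncomputable def roots (v : Node) (L₀ : ℝ) : Finset Node :=
  if h : (front E.val v L₀).Finite then h.toFinset else ∅

open Classical in
/-- The largest label at most `X` in the subtree of `r`. -/
noncomputable def top (X : ℝ) (r : Node) : ℝ :=
  if h : ∃ y, y ≤ X ∧ IsRank E.val r (E.count r X) y then h.choose else 0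

open Classical in
/-- The smallest label above `x` in the subtree of `r`. -/
noncomputable def succ (x : ℝ) (r : Node) : ℝ :=
  if h : ∃ y, IsNext E.val r x y then h.choose else 0

/-- The roots whose subtree has a label in the interval `(L, X]`. -/
noncomputable def live (v : Node) (L₀ X L : ℝ) : Finset Node :=
  (E.roots v L₀).filter fun r => E.count r L < E.count r X

open Classical in
/-- The roots whose subtree has a label in the interval `(X, U)`. -/
noncomputable def above (v : Node) (L₀ X : ℝ) (U : WithTop ℝ) : Finset Node :=
  (E.roots v L₀).filter fun r => (E.succ X r : WithTop ℝ) < U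

/-- The number of labels at most `X` in the live subtrees. -/
noncomputable def theta (v : Node) (L₀ X L : ℝ) : ℝ :=
  ∑ r ∈ E.live v L₀ X L, (E.count r X : ℝ)

/-- The number of labels at most `X` in the live subtrees, where known labels count half. -/
noncomputable def psi (v : Node) (L₀ X L : ℝ) : ℝ :=
  ∑ r ∈ E.live v L₀ X L, ((E.count r X : ℝ) - E.count r L / 2)

/-- A bound for the number of known labels in the subtree of `r` when its exploration fails. -/
noncomputable def failBound (v : Node) (L₀ X L : ℝ) (r : Node) : ℝ :=
  min (E.count r X : ℝ) (E.count r L +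
    ∑ j ∈ (E.live v L₀ X L).erase r, ((E.count r (E.top X j) : ℝ) - E.count r L))

end Limits

namespace Level

variable {E : Limits} {v : Node} {n : ℕ} {X L₀ : ℝ} (h : Level E v n X L₀)

include h

theorem mem_roots {r : Node} : r ∈ E.roots v L₀ ↔ r ∈ front E.val v L₀ := by
  rw [Limits.roots, dif_pos (IsHeap.finite_front (h.finite h.lt.le)), Set.Finite.mem_toFinset]

theorem suffix_of_mem {r : Node} (hr : r ∈ E.roots v L₀) : v <:+ r := (h.mem_roots.1 hr).1.1

theorem lt_of_mem {r : Node} (hr : r ∈ E.roots v L₀) : L₀ < E.val r := (h.mem_roots.1 hr).2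

theorem count_mono {r : Node} (hr : v <:+ r) {x y : ℝ} (hxy : x ≤ y) (hy : y ≤ X) :
    E.count r x ≤ E.count r y :=
  Set.ncard_le_ncard (IsHeap.low_mono hxy) (h.finite' hr hy)

theorem count_lt {r w : Node} (hr : v <:+ r) (hw : r <:+ w) {x : ℝ} (hx : x < E.val w)
    (hwX : E.val w ≤ X) : E.count r x < E.count r X :=
  (IsHeap.ncard_lt_of_lt (h.finite' hr hwX) hw hx).trans_le (h.count_mono hr hwX le_rfl)

theorem count_eq_sum {y : ℝ} (hy : L₀ ≤ y) (hyX : y ≤ X) :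
    E.count v y = E.count v L₀ + ∑ r ∈ E.roots v L₀, E.count r y := by
  have := h.heap.ncard_low_eq_sum (h.finite h.lt.le) (h.finite hyX) hy
  rw [Limits.roots, dif_pos (IsHeap.finite_front (h.finite h.lt.le))]
  exact this

theorem count_self : E.count v X = n := h.rank.2.2

theorem count_zero {r : Node} (hr : r ∈ E.roots v L₀) : E.count r L₀ = 0 := by
  rw [Limits.count, h.heap.low_eq_empty (h.lt_of_mem hr), Set.ncard_empty]

theorem card_roots : (E.roots v L₀).card ≤ n := by
  have h1 := h.heap.ncard_front_le (h.finite h.lt.le)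
  have h2 := h.ncard_lt h.lt
  rw [Set.ncard_eq_toFinset_card _ (IsHeap.finite_front (h.finite h.lt.le))] at h1
  rw [Limits.roots, dif_pos (IsHeap.finite_front (h.finite h.lt.le))]
  omega

omit h in
theorem mem_live {L : ℝ} {r : Node} :
    r ∈ E.live v L₀ X L ↔ r ∈ E.roots v L₀ ∧ E.count r L < E.count r X := by
  rw [Limits.live, Finset.mem_filter]

omit h in
theorem mem_above {U : WithTop ℝ} {r : Node} :
    r ∈ E.above v L₀ X U ↔ r ∈ E.roots v L₀ ∧ (E.succ X r : WithTop ℝ) < U := by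
  rw [Limits.above, Finset.mem_filter]

theorem isNext_succ {x : ℝ} (hx : x ≤ X) {r : Node} (hr : v <:+ r) :
    IsNext E.val r x (E.succ x r) := by
  have hex := h.heap.exists_isNext (h.finite' hr hx)
  rw [Limits.succ, dif_pos hex]
  exact hex.choose_spec

theorem top_spec {r : Node} (hc : 0 < E.count r X) :
    E.top X r ≤ X ∧ IsRank E.val r (E.count r X) (E.top X r) := by
  have hex : ∃ y, y ≤ X ∧ IsRank E.val r (E.count r X) y := by
    have hemp : low E.val r (E.val r - 1) = ∅ := h.heap.low_eq_empty (by linarith)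
    obtain ⟨y, -, hy⟩ := h.heap.exists_isRank (v := r) (x := E.val r - 1)
      (by rw [hemp]; exact Set.finite_empty) (n := E.count r X) (by rwa [hemp, Set.ncard_empty])
    refine ⟨y, ?_, hy⟩
    by_contra hlt
    obtain ⟨⟨w, hw, rfl⟩, hf, hn⟩ := hy
    have := IsHeap.ncard_lt_of_lt hf hw (not_le.1 hlt)
    exact absurd hn this.ne'
  rw [Limits.top, dif_pos hex]
  exact hex.choose_spec

theorem top_of_live {L : ℝ} {r : Node} (hr : r ∈ E.live v L₀ X L) :
    E.top X r ≤ X ∧ IsRank E.val r (E.count r X) (E.top X r) :=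
  h.top_spec (by have := (mem_live.1 hr).2; omega)

theorem lt_top {L : ℝ} (hL : L ≤ X) {r : Node} (hr : r ∈ E.live v L₀ X L) : L < E.top X r := by
  obtain ⟨h1, h2⟩ := h.top_of_live hr
  by_contra hle
  have := h.count_mono (h.suffix_of_mem (mem_live.1 hr).1) (not_lt.1 hle) hL
  have h3 : E.count r (E.top X r) = E.count r X := h2.2.2
  have := (mem_live.1 hr).2
  omega

/-- A root stays live exactly as long as `L` is below its largest label up to `X`. Hence the labels
`top` order the roots by the time at which they die. -/
theorem mem_live_iff {L y : ℝ} (hLy : L ≤ y) (hy : y ≤ X) {r : Node} :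
    r ∈ E.live v L₀ X y ↔ r ∈ E.live v L₀ X L ∧ y < E.top X r := by
  constructor
  · intro hr
    obtain ⟨h1, h2⟩ := mem_live.1 hr
    exact ⟨mem_live.2 ⟨h1, (h.count_mono (h.suffix_of_mem h1) hLy hy).trans_lt h2⟩,
      h.lt_top hy hr⟩
  · rintro ⟨hr, hlt⟩
    obtain ⟨h1, h2⟩ := mem_live.1 hr
    obtain ⟨h3, ⟨w, hw, hw'⟩, -⟩ := h.top_of_live hr
    rw [← hw'] at hlt h3
    exact mem_live.2 ⟨h1, h.count_lt (h.suffix_of_mem h1) hw hlt h3⟩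

/-- The algorithm can only test for a label in `(L, U)`, while the analysis needs to know on which
side of `X` it lies; the sampled set is the union of the two. -/
theorem mem_pool_iff {L : ℝ} (hLX : L ≤ X) {U : WithTop ℝ} (hXU : X < U) {r : Node}
    (hr : r ∈ E.roots v L₀) : (E.succ L r : WithTop ℝ) < U ↔
      r ∈ E.live v L₀ X L ∨ r ∈ E.above v L₀ X U := by
  have hs := h.suffix_of_mem hr
  obtain ⟨h1, ⟨w, hw, hw'⟩, h2⟩ := h.isNext_succ hLX hs
  obtain ⟨h1', ⟨u, hu, hu'⟩, h2'⟩ := h.isNext_succ le_rfl hs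
  constructor
  · intro hlt
    rcases le_or_gt (E.succ L r) X with hle | hgt
    · rw [← hw'] at hle h1
      exact .inl (mem_live.2 ⟨hr, h.count_lt hs hw h1 hle⟩)
    · refine .inr (mem_above.2 ⟨hr, lt_of_le_of_lt ?_ hlt⟩)
      rw [← hw'] at hgt ⊢
      exact_mod_cast h2' w hw hgt
  · rintro (hl | ha)
    · obtain ⟨h3, ⟨y, hy, hy'⟩, -⟩ := h.top_of_live hl
      have hlt := h.lt_top hLX hl
      rw [← hy'] at h3 hlt
      exact lt_of_le_of_lt (by exact_mod_cast (h2 y hy hlt).trans h3) hXU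
    · refine lt_of_le_of_lt ?_ (mem_above.1 ha).2
      rw [← hu'] at h1' ⊢
      exact_mod_cast h2 u hu (hLX.trans_lt h1')

theorem live_nonempty {L : ℝ} (hL : L₀ ≤ L) (hLX : L < X) : (E.live v L₀ X L).Nonempty := by
  by_contra hemp
  rw [Finset.not_nonempty_iff_eq_empty] at hemp
  have h1 := h.count_eq_sum h.lt.le le_rfl
  have h2 := h.count_eq_sum hL hLX.le
  have h3 : E.count v L < n := h.ncard_lt hLX
  have h4 : ∑ r ∈ E.roots v L₀, E.count r X ≤ ∑ r ∈ E.roots v L₀, E.count r L := by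
    refine Finset.sum_le_sum fun r hr => ?_
    by_contra hlt
    have := mem_live.2 ⟨hr, not_le.1 hlt⟩
    rw [hemp] at this
    simp at this
  rw [h.count_self] at h1
  omega

/-- Exploring `r` removes `r` from the live roots and adds none, so `theta` pays `count r X` for
every single choice and not only on average. -/
theorem theta_le {L : ℝ} (hL : L ≤ X) {r : Node} (hr : r ∈ E.live v L₀ X L) :
    (E.count r X : ℝ) + E.theta v L₀ X (E.top X r) ≤ E.theta v L₀ X L := by
  classical
  have hlt := h.lt_top hL hr
  have hX := (h.top_of_live hr).1
  rw [Limits.theta, Limits.theta, ← Finset.add_sum_erase _ _ hr]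
  gcongr
  intro j hj
  rw [h.mem_live_iff hlt.le hX] at hj
  refine Finset.mem_erase.2 ⟨?_, hj.1⟩
  rintro rfl
  exact lt_irrefl _ hj.2

/-- An instance of `sum_charge_le`, with `s` the live root whose `top` is largest: exploring it
reaches all that the live roots contain. -/
theorem sum_psi_le {L : ℝ} (hL : L₀ ≤ L) (hLX : L < X) :
    ∑ r ∈ E.live v L₀ X L, ((E.count r X : ℝ) - E.count r L + E.failBound v L₀ X L r / 2 +
      E.psi v L₀ X (E.top X r)) ≤ (E.live v L₀ X L).card * E.psi v L₀ X L := by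
  classical
  obtain ⟨s, hs, hmax⟩ := (E.live v L₀ X L).exists_max_image (E.top X) (h.live_nonempty hL hLX)
  have htX : ∀ {r}, r ∈ E.live v L₀ X L → E.top X r ≤ X := fun hr => (h.top_of_live hr).1
  have hlt : ∀ {r}, r ∈ E.live v L₀ X L → L < E.top X r := fun hr => h.lt_top hLX.le hr
  have hsuf : ∀ {r}, r ∈ E.live v L₀ X L → v <:+ r := fun hr =>
    h.suffix_of_mem (mem_live.1 hr).1
  refine sum_charge_le (A := E.live v L₀ X L) (g := fun r => (E.count r X : ℝ))
    (c := fun r => (E.count r L : ℝ)) (Q := fun j r => (E.count j (E.top X r) : ℝ))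
    (A' := fun r => E.live v L₀ X (E.top X r)) hs ?_ ?_ ?_ ?_ ?_ ?_ ?_ ?_
  · refine Finset.eq_empty_of_forall_notMem fun j hj => ?_
    rw [h.mem_live_iff (hlt hs).le (htX hs)] at hj
    exact absurd (hmax j hj.1) (not_le.2 hj.2)
  · intro r hr j hj
    rw [h.mem_live_iff (hlt hr).le (htX hr)] at hj
    refine Finset.mem_erase.2 ⟨?_, hj.1⟩
    rintro rfl
    exact lt_irrefl _ hj.2
  · intro r hr hrs
    rw [h.mem_live_iff (hlt hr).le (htX hr)]
    refine ⟨hs, lt_of_le_of_ne (hmax r hr) fun he => hrs ?_⟩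
    obtain ⟨-, ⟨w, hw, hw'⟩, -⟩ := h.top_of_live hr
    obtain ⟨-, ⟨u, hu, hu'⟩, -⟩ := h.top_of_live hs
    -- Equal `top` values belong to one node by injectivity, and a node lies below only one root; so
    -- roots other than `s` have a strictly smaller `top`.
    have hwu : w = u := h.heap.injective (by rw [hw', hu', he])
    subst hwu
    exact IsHeap.front_eq_of_suffix (h.mem_roots.1 (mem_live.1 hr).1)
      (h.mem_roots.1 (mem_live.1 hs).1) hw hu
  · intro r _
    positivity
  · intro j hj r hr
    exact_mod_cast h.count_mono (hsuf hj) (hlt hr).le (htX hr)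
  · intro j hj r hr
    exact_mod_cast h.count_mono (hsuf hj) (htX hr) le_rfl
  · intro r _
    exact min_le_left _ _
  · intro r _
    refine (min_le_right _ _).trans (le_of_eq ?_)
    congr! 1

/-- If the call fails, fewer than `c + s` labels up to `X` lie below `r`, while at least `s` labels
are missing in all. So another root `j` has a label in `(y, X]`, that is, `y < top j`, and `c =
count r y ≤ count r (top j)`. The latter is bounded by `count r L` plus one term of a sum of
nonnegative terms. -/
theorem le_failBound {L y x : ℝ} {r : Node} {c s : ℕ} (hr : r ∈ E.live v L₀ X L) (hL : L₀ ≤ L)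
    (hLy : L ≤ y) (hyX : y ≤ X) (hc : IsRank E.val r c y) (hs : s + E.count v y ≤ n)
    (hx : IsRank E.val r (c + s) x) (hXx : X < x) : (c : ℝ) ≤ E.failBound v L₀ X L r := by
  classical
  have hrr := (mem_live.1 hr).1
  have hsuf := h.suffix_of_mem hrr
  have hcy : E.count r y = c := hc.2.2
  refine le_min ?_ ?_
  · rw [← hcy]
    exact_mod_cast h.count_mono hsuf hyX le_rfl
  · have hg : E.count r X < c + s := by
      obtain ⟨⟨w, hw, rfl⟩, hf, hn⟩ := hx
      exact hn ▸ IsHeap.ncard_lt_of_lt hf hw hXx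
    have h1 := h.count_eq_sum h.lt.le le_rfl
    have h2 := h.count_eq_sum (hL.trans hLy) hyX
    rw [h.count_self, ← Finset.add_sum_erase _ _ hrr] at h1
    rw [← Finset.add_sum_erase _ _ hrr, hcy] at h2
    obtain ⟨j, hj, hj'⟩ : ∃ j ∈ (E.roots v L₀).erase r, E.count j y < E.count j X := by
      by_contra! hall
      have := Finset.sum_le_sum hall
      omega
    obtain ⟨hjr, hj⟩ := Finset.mem_erase.1 hj
    have hjl := (h.mem_live_iff hLy hyX).1 (mem_live.2 ⟨hj, hj'⟩)
    have hmono : ∀ i ∈ (E.live v L₀ X L).erase r,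
        0 ≤ (E.count r (E.top X i) : ℝ) - E.count r L := fun i hi => by
      have hi := Finset.mem_of_mem_erase hi
      have := h.count_mono hsuf (h.lt_top (hLy.trans hyX) hi).le (h.top_of_live hi).1
      rw [sub_nonneg]
      exact_mod_cast this
    have h3 := Finset.single_le_sum hmono (Finset.mem_erase.2 ⟨hjr, hjl.1⟩)
    have h4 : (c : ℝ) ≤ E.count r (E.top X j) := by
      rw [← hcy]
      exact_mod_cast h.count_mono hsuf hjl.2.le (h.top_of_live hjl.1).1
    linarith

theorem failBound_nonneg {L : ℝ} (hLX : L ≤ X) {r : Node} (hr : v <:+ r) :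
    0 ≤ E.failBound v L₀ X L r := by
  refine le_min (by positivity) (add_nonneg (by positivity) (Finset.sum_nonneg fun j hj => ?_))
  have hj := Finset.mem_of_mem_erase hj
  have := h.count_mono hr (h.lt_top hLX hj).le (h.top_of_live hj).1
  rw [sub_nonneg]
  exact_mod_cast this

theorem theta_initial : E.theta v L₀ X L₀ + E.count v L₀ ≤ n := by
  have h1 := h.count_eq_sum h.lt.le le_rfl
  rw [h.count_self] at h1
  have h2 : ∑ r ∈ E.live v L₀ X L₀, E.count r X ≤ ∑ r ∈ E.roots v L₀, E.count r X :=
    Finset.sum_le_sum_of_subset (Finset.filter_subset _ _)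
  rw [Limits.theta, ← Nat.cast_sum]
  exact_mod_cast (by omega : ∑ r ∈ E.live v L₀ X L₀, E.count r X + E.count v L₀ ≤ n)

/-- At the start no label below a root is known, so the discount in `psi` is zero. -/
theorem psi_initial : E.psi v L₀ X L₀ = E.theta v L₀ X L₀ := by
  rw [Limits.psi, Limits.theta]
  refine Finset.sum_congr rfl fun r hr => ?_
  rw [h.count_zero (mem_live.1 hr).1]
  simp

omit h in
theorem psi_nonneg {L : ℝ} : 0 ≤ E.psi v L₀ X L := by
  refine Finset.sum_nonneg fun r hr => ?_
  have : (E.count r L : ℝ) ≤ E.count r X := by exact_mod_cast (mem_live.1 hr).2.le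
  have : (0 : ℝ) ≤ E.count r L := by positivity
  linarith

omit h in
theorem theta_nonneg {L : ℝ} : 0 ≤ E.theta v L₀ X L :=
  Finset.sum_nonneg fun r _ => by positivity

end Level

theorem Level.eq_top {E : Limits} {v : Node} {n : ℕ} {X L₀ : ℝ} (h : Level E v n X L₀) {r : Node}
    (hr : v <:+ r) {L : ℝ} (hL : ∃ w, r <:+ w ∧ E.val w = L) (hLX : L ≤ X)
    (hmax : ∀ w, r <:+ w → E.val w ≤ X → E.val w ≤ L) : L = E.top X r := by
  obtain ⟨w, hw, rfl⟩ := hL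
  have hc : 0 < E.count r X := (Set.ncard_pos (h.finite' hr le_rfl)).2 ⟨w, hw, hLX⟩
  obtain ⟨h1, ⟨u, hu, hu'⟩, h2, h3⟩ := h.top_spec hc
  rw [← hu'] at h1 h2 h3 ⊢
  refine le_antisymm ?_ (hmax u hu h1)
  by_contra hlt
  have h4 := IsHeap.ncard_lt_of_lt (h.finite' hr hLX) hw (not_le.1 hlt)
  have h5 : (low E.val r (E.val w)).ncard ≤ E.count r X := h.count_mono hr hLX le_rfl
  omega

theorem Level.pos {E : Limits} {v : Node} {n : ℕ} {X L₀ : ℝ} (h : Level E v n X L₀) : 0 < n :=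
  (Nat.zero_le _).trans_lt (h.ncard_lt h.lt)

/-! ### Exploring one subtree -/

namespace Limits

variable {E : Limits}

theorem symb_growLoop {d : ℕ} {f : Local WVar KVar → ℝ≥0∞} :
    E.symb d growLoop f = E.cost d growLoop f := rfl

theorem symb_refineLoop {d : ℕ} {f : Local WVar KVar → ℝ≥0∞} :
    E.symb d refineLoop f = E.cost d refineLoop f := rfl

section Explore

variable {v : Node} {n : ℕ} {X L₀ : ℝ} (h : Level E v n X L₀) {r : Node} (hr : v <:+ r)
  (hrX : E.val r ≤ X) {w μ : ℝ} (hw : 0 ≤ w) (hμ : 0 ≤ μ) {S d₀ : ℕ}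
  (hext : ExtSpec E (fun n m => w * (n + 6 * excess m * μ)) S d₀) {d : ℕ}
  (hd : d₀ + 220 ≤ d) {f : Local WVar KVar → ℝ≥0∞} {lam : ℝ} (hlam : 1 + Real.log n ≤ lam)

include h hr hrX hw hμ hext hd hlam

/-- Afterwards `L` is the largest label up to `X` below `r`, and either it equals `X` or the upper
bound is at most the next label below `r`. So `r` is used up on both sides of `X`. The logarithm
from growing and the two harmonic numbers from refining are all `O(lam)`, which gives the first
term. -/
theorem cost_explore {y ρ : ℝ} (hy : ∃ w, r <:+ w ∧ E.val w = y) (hyX : y ≤ X) (hρ₀ : 0 ≤ ρ)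
    (hρ : ∀ c s L x, y ≤ L → L ≤ X → IsRank E.val r c L → s + (low E.val v L).ncard ≤ n →
      IsRank E.val r (c + s) x → X < x → (c : ℝ) ≤ ρ)
    (hS : ∀ c s L, L ≤ X → IsRank E.val r c L → 1 ≤ s → s + (low E.val v L).ncard ≤ n →
      (s = 1 ∨ 2 * s ≤ c) → s ≤ S) {U : WithTop ℝ} (hXU : X < U) {G : ℝ≥0∞}
    (hG : ∀ c s q U' κ, (X : WithTop ℝ) < U' → U' ≤ U →
      (E.top X r = X ∨ U' ≤ E.succ X r) → c ≤ n → s ≤ E.bound → q ≤ E.bound →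
      f (E.lev v n L₀ r (low E.val v (E.top X r)).ncard c s 0 q (E.top X r) U' κ) ≤ G)
    {k c s a : ℕ} {L : ℝ} (hc : c ≤ n) (hs : s ≤ E.bound)
    (ha : a ≤ E.bound) :
    E.symb d explore f (E.lev v n L₀ r k c s a (low E.val v y).ncard L U y) ≤
      ENNReal.ofReal (5000 * (n + 2) * lam +
        w * (6 * E.count r X + 6 * μ * (E.count r X - E.count r y + ρ / 2))) + G := by
  have hroom := h.room
  have hn : 0 < n := h.pos
  have hlog : 0 ≤ Real.log n := Real.log_natCast_nonneg n
  have hky : (low E.val v y).ncard ≤ n := h.ncard_le hyX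
  have hcy : IsRank E.val r (E.count r y) y := ⟨hy, h.finite' hr hyX, rfl⟩
  have hcn : E.count r y ≤ n := h.ncard_le' hr hyX
  have hcg : E.count r y ≤ E.count r X := h.count_mono hr hyX le_rfl
  have hcgr : (E.count r y : ℝ) ≤ E.count r X := by exact_mod_cast hcg
  have hc1 : 1 ≤ E.count r y := by
    obtain ⟨u, hu, hu'⟩ := hy
    exact (Set.ncard_pos (h.finite' hr hyX)).2 ⟨u, hu, hu'.le⟩
  have hcap : E.capCount r y (n + 1) = E.count r y :=
    capCount_of_finite (h.finite' hr hyX) (hcn.trans (by omega))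
  have hsm : E.Small (E.lev v n L₀ r (low E.val v y).ncard c s a (low E.val v y).ncard y U y) := by
    rw [small_mkW]
    omega
  have hgrow := cost_growLoop h hr hrX hw hμ hext (d := d - 1) (by omega)
    (f := E.cost d refineLoop f) hρ₀ hρ hS hXU
    (G := ENNReal.ofReal (1000 * (n + 2) * (1 + (lam + lam))) + G) ?_ hcy hc1 hyX le_rfl hs
    (q := (low E.val v y).ncard) (κ := y) (by omega)
  · simp only [explore, symb, ExplorableHeap.accept, symb_callCount]
    calc _ ≤ 1 + (1 + (1 + (1 + (1 + ((220 * (n + 2) : ℕ) + (1 + (1 + (1 +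
          (ENNReal.ofReal (400 * (n + 2) * (4 * (Real.log n - Real.log (E.count r y)) + 2) +
            w * (6 * ((low E.val r X).ncard - E.count r y) + 2 * E.count r y +
              6 * μ * ((low E.val r X).ncard - E.count r y + ρ / 2))) +
            (ENNReal.ofReal (1000 * (n + 2) * (1 + (lam + lam))) + G)))))))))) := by
          gcongr
          simp only [KeyExpr.eval, mkK_k5, update_k2, WordExpr.eval, mkW_w5, update_w1]
          rw [if_pos (by omega)]
          gcongr
          refine (cost_callCount h (by omega) hsm rfl hr hrX rfl rfl).trans ?_
          rw [hcap, update_w2]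
          gcongr
          refine (le_of_eq (if_pos (Nat.zero_le _))).trans ?_
          rw [update_w4, symb_growLoop, symb_refineLoop]
          exact add_le_add_right hgrow 1
      _ = ((220 * (n + 2) + 8 : ℕ) : ℝ≥0∞) +
          (ENNReal.ofReal (400 * (n + 2) * (4 * (Real.log n - Real.log (E.count r y)) + 2) +
            w * (6 * ((low E.val r X).ncard - E.count r y) + 2 * E.count r y +
              6 * μ * ((low E.val r X).ncard - E.count r y + ρ / 2))) +
            (ENNReal.ofReal (1000 * (n + 2) * (1 + (lam + lam))) + G)) := by push_cast; ring
      _ ≤ _ := by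
          have hlc : 0 ≤ Real.log (E.count r y) := Real.log_natCast_nonneg _
          have hlcn : Real.log (E.count r y) ≤ Real.log n :=
            Real.log_le_log (by exact_mod_cast hc1) (by exact_mod_cast hcn)
          have hg : ((low E.val r X).ncard : ℝ) = E.count r X := rfl
          have hW : 0 ≤ w * (6 * (E.count r X - E.count r y) + 2 * E.count r y +
              6 * μ * (E.count r X - E.count r y + ρ / 2)) := by
            have := sub_nonneg.2 hcgr
            positivity
          rw [hg]
          have hlam1 : 1 ≤ lam := by linarith
          refine natCast_add_ofReal_le (x := 400 * (n + 2) * (4 * (Real.log n -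
            Real.log (E.count r y)) + 2) + w * (6 * (E.count r X - E.count r y) +
            2 * E.count r y + 6 * μ * (E.count r X - E.count r y + ρ / 2)) +
            1000 * (n + 2) * (1 + (lam + lam))) ?_ ?_ ?_
          · have h1 : w * (6 * (E.count r X - E.count r y) + 2 * E.count r y +
                6 * μ * (E.count r X - E.count r y + ρ / 2)) ≤
                w * (6 * E.count r X + 6 * μ * (E.count r X - E.count r y + ρ / 2)) := by
              refine mul_le_mul_of_nonneg_left ?_ hw
              have : (0 : ℝ) ≤ E.count r y := by positivity
              linarith
            have h2 : 400 * ((n : ℝ) + 2) * (4 * (Real.log n - Real.log (E.count r y)) + 2) ≤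
                (n + 2) * (1600 * lam) := by
              rw [mul_comm (400 : ℝ), mul_assoc]
              refine mul_le_mul_of_nonneg_left ?_ (by positivity)
              linarith
            have h3 : ((n : ℝ) + 2) * 1 ≤ (n + 2) * lam :=
              mul_le_mul_of_nonneg_left hlam1 (by positivity)
            push_cast
            linarith
          · have := sub_nonneg.2 hlcn
            positivity
          · refine ofReal_add_le_ofReal_add le_rfl ?_ (by positivity) le_rfl
            have := sub_nonneg.2 hlcn
            positivity
  · intro c s a q L U' κ hyL hLX hcL hXU' hU'U hor hc hs hq
    -- Growing ends in one of two ways: flag 0 and `L = X`, when nothing is left to do, or flag 1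
    -- and a real upper bound with at most `n` labels below it, on which the random search can run.
    rcases hor with ⟨rfl, rfl⟩ | ⟨rfl, u, rfl, hf, hfn⟩
    · have ht := h.eq_top hr hcL.1 le_rfl fun w _ hw => hw
      refine (refineLoop_unfold h (by omega) (h.ncard_le hLX) hc hs (by omega) hq).trans ?_
      rw [if_neg (by omega), ← ENNReal.ofReal_one]
      gcongr
      · have : (0 : ℝ) ≤ n * (1 + (lam + lam)) := by
          have : 0 ≤ lam := by linarith
          positivity
        linarith
      · have := hG c s q U' κ hXU' hU'U (.inl ht.symm) hc hs hq
        rwa [← ht] at this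
    · refine (cost_refineLoop h hr hrX (by omega) (L₁ := y) hf hfn (G := G) ?_ hyL hLX hcL.1
        (by exact_mod_cast hXU') le_rfl hc hs one_pos (by omega) hq).trans ?_
      · intro c s q L u' κ _ hLX hL hXu hu hlast hc hs hq
        have ht := h.eq_top hr hL hLX fun w hw hwX => by
          by_contra hlt
          exact absurd (hlast w hw (not_le.1 hlt)) (not_le.2 (hwX.trans_lt hXu))
        have := hG c s q u' κ (by exact_mod_cast hXu)
          ((WithTop.coe_le_coe.2 hu).trans hU'U) (.inr ?_) hc hs hq
        · rwa [← ht] at this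
        · obtain ⟨h1, ⟨u, hu, hu'⟩, -⟩ := h.isNext_succ le_rfl hr
          rw [← hu'] at h1 ⊢
          exact_mod_cast hlast u hu (hLX.trans_lt h1)
      · have hcard : ∀ P : Node → Prop, ∀ [DecidablePred P],
            (harmonic (hf.toFinset.filter P).card : ℝ) ≤ lam := fun P _ => by
          refine (harmonic_le (N := n) ((Finset.card_filter_le _ _).trans ?_)).trans hlam
          rwa [← Set.ncard_eq_toFinset_card _ hf]
        gcongr
        · exact hcard _
        · exact hcard _

end Explore

theorem symb_callPick {d : ℕ} {t : WordExpr WVar} {rw : WVar → Option WVar}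
    {rk : KVar → Option KVar} {f : Local WVar KVar → ℝ≥0∞} {σ : Local WVar KVar} :
    E.symb d (callPick t rw rk) f σ = E.cost d (callPick t rw rk) f σ := rfl

/-! ### One round with a random root -/

section Round

variable {v : Node} {n : ℕ} {X L₀ : ℝ} (h : Level E v n X L₀)

include h

theorem _root_.ExplorableHeap.Level.pool_succ {L : ℝ} (hL : L₀ ≤ L) (hLX : L ≤ X) :
    Pool E v L₀ L n (E.succ L) :=
  ⟨hL, h.finite hLX, h.ncard_le hLX, fun _ hw => h.isNext_succ hLX hw.1.1⟩

open Classical in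
theorem toFinset_pool {L : ℝ} (hLX : L ≤ X) {U : WithTop ℝ} (hXU : X < U) {l : List Node}
    (hl : Preorder E.val L₀ v l) :
    (E.pool L₀ U (E.succ L) l).toFinset = E.live v L₀ X L ∪ E.above v L₀ X U := by
  ext r
  have hmem : r ∈ E.pool L₀ U (E.succ L) l ↔
      r ∈ E.roots v L₀ ∧ (E.succ L r : WithTop ℝ) < U := by
    rw [pool, List.mem_filter, IsHeap.mem_preorder hl, decide_eq_true_eq, Eligible, h.mem_roots]
    exact ⟨fun ⟨h1, h2, h3⟩ => ⟨⟨h1, h2⟩, h3⟩, fun ⟨⟨h1, h2⟩, h3⟩ => ⟨h1, h2, h3⟩⟩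
  rw [List.mem_toFinset, hmem, Finset.mem_union]
  constructor
  · rintro ⟨h1, h2⟩
    exact (h.mem_pool_iff hLX hXU h1).1 h2
  · intro hr
    have h1 : r ∈ E.roots v L₀ :=
      hr.elim (fun h => (Level.mem_live.1 h).1) fun h => (Level.mem_above.1 h).1
    exact ⟨h1, (h.mem_pool_iff hLX hXU h1).2 hr⟩

open Classical in
theorem cost_round {d : ℕ} (hd : 200 ≤ d) {f : Local WVar KVar → ℝ≥0∞} {c s a q : ℕ} {L : ℝ}
    (hL : L₀ ≤ L) (hLX : L < X) {U κ κ' : WithTop ℝ} (hXU : X < U) (hc : c ≤ n)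
    (hs : s ≤ E.bound) (ha : a ≤ E.bound) (hq : q ≤ E.bound) {x : Node → ℝ} (hx : ∀ r, 0 ≤ x r)
    {y : ℝ} (hxy : ∑ r ∈ E.live v L₀ X L ∪ E.above v L₀ X U, x r ≤
      (E.live v L₀ X L ∪ E.above v L₀ X U).card * y) {G : ℝ≥0∞}
    (hF : ∀ r ∈ E.live v L₀ X L ∪ E.above v L₀ X U, ∀ p s q, p ≤ n → s ≤ n → q ≤ E.bound →
      (if X < E.succ L r then
        f (E.lev v n L₀ r (low E.val v L).ncard c s p q L (E.succ L r) (E.succ L r)) else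
        E.symb d explore f (E.lev v n L₀ r (low E.val v L).ncard c s p
          (low E.val v (E.succ L r)).ncard L U (E.succ L r))) ≤ ENNReal.ofReal (x r) + G) :
    E.symb d round f (st v (mkW n (low E.val v L).ncard c s a q)
      (mkK (E.val v) L₀ L U κ κ' ⊤ ⊤)) ≤ ENNReal.ofReal (1400 * (n + 2) + y) + G := by
  have hroom := h.room
  have hkn := h.ncard_le hLX.le
  obtain ⟨l, hl⟩ := IsHeap.exists_preorder (h.finite h.lt.le)
  have hP := h.pool_succ hL hLX.le
  have hset := toFinset_pool h hLX.le hXU hl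
  have hnd : (E.pool L₀ U (E.succ L) l).Nodup := (IsHeap.nodup_preorder hl).filter _
  obtain ⟨p, hp⟩ : ∃ p, p = (E.pool L₀ U (E.succ L) l).length := ⟨_, rfl⟩
  have hpc : p = (E.live v L₀ X L ∪ E.above v L₀ X U).card := by
    rw [hp, ← hset, List.toFinset_card_of_nodup hnd]
  have hpn : p ≤ n := by
    rw [hpc]
    refine (Finset.card_le_card (Finset.union_subset ?_ ?_)).trans h.card_roots
    · exact Finset.filter_subset _ _
    · exact Finset.filter_subset _ _
  -- As long as `L < X` there is a live root, so the number of choices is positive and the truncated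
  -- `w4 - 1` gives the correct range for the draw.
  have hp0 : 0 < p := by
    rw [hpc, Finset.card_pos]
    exact (h.live_nonempty hL hLX).mono Finset.subset_union_left
  have hy : 0 ≤ y := by
    have h1 := (Finset.sum_nonneg fun r _ => hx r).trans hxy
    rw [← hpc] at h1
    exact nonneg_of_mul_nonneg_right h1 (by exact_mod_cast hp0)
  have hsm : ∀ {s a q : ℕ} {ks : KVar → WithTop ℝ}, s ≤ E.bound → a ≤ E.bound →
      q ≤ E.bound → E.Small (st v (mkW n (low E.val v L).ncard c s a q) ks) := by
    intro s a q ks h1 h2 h3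
    rw [small_mkW]
    omega
  simp only [round, symb, symb_callPick, symb_callCount]
  calc _ ≤ 1 + ((550 * (n + 1) : ℕ) +
        (1 + (1 + (ENNReal.ofReal (770 * (n + 2) + 10 + y) + G)))) := by
        gcongr
        refine (cost_callPick_all h.heap (by omega) (by omega) (hsm hs ha hq) rfl rfl rfl rfl
          (n := n) (U := U) (tgt := n + 1) (by rfl) (by omega) (by omega) hP hl (by omega)
          (F := 1 + (1 + (ENNReal.ofReal (770 * (n + 2) + 10 + y) + G)))
          fun β τ o => ?_).trans le_rfl
        simp only [retW_elim, noK_elim]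
        simp only [mkW_w0, update_w4, WordExpr.eval, mkW_w4]
        rw [← hp]
        gcongr
        rw [if_pos (by omega), Nat.sub_add_cancel hp0]
        refine average_le hp0
          (x := fun i => 770 * (n + 2) + 10 + ((E.pool L₀ U (E.succ L) l)[i]?).elim 0 x) ?_ ?_ ?_
        · intro i _
          have : 0 ≤ ((E.pool L₀ U (E.succ L) l)[i]?).elim 0 x := by
            cases (E.pool L₀ U (E.succ L) l)[i]? with
            | none => exact le_rfl
            | some w => exact hx w
          positivity
        · intro i hi
          obtain ⟨r, hr⟩ : ∃ r, (E.pool L₀ U (E.succ L) l)[i]? = some r :=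
            ⟨_, List.getElem?_eq_getElem (hp ▸ hi)⟩
          have hrm : r ∈ E.live v L₀ X L ∪ E.above v L₀ X U := by
            rw [← hset, List.mem_toFinset]
            exact List.mem_of_getElem? hr
          have hrr : r ∈ E.roots v L₀ := (Finset.mem_union.1 hrm).elim
            (fun h => (Level.mem_live.1 h).1) fun h => (Level.mem_above.1 h).1
          have hvr := h.suffix_of_mem hrr
          have hin : i ≤ n := by omega
          have hcle : E.capCount v (E.succ L r) (n + 1) ≤ n + 1 := capCount_le
          rw [hr, Option.elim_some]
          have hF := hF r hrm p i (E.capCount v (E.succ L r) (n + 1)) hpn hin (by omega)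
          set F' := (if X < E.succ L r then f (E.lev v n L₀ r (low E.val v L).ncard c i p
            (E.capCount v (E.succ L r) (n + 1)) L (E.succ L r) (E.succ L r)) else
            E.symb d explore f (E.lev v n L₀ r (low E.val v L).ncard c i p
              (low E.val v (E.succ L r)).ncard L U (E.succ L r))) with hF'
          refine natCast_add_ofReal_le (a := 770 * (n + 2) + 10) (x := x r) (F := F')
            (by push_cast; linarith) (hx r) hF |> le_trans ?_
          simp only [update_w3]
          have hsm' : ∀ {q : ℕ} {ks : KVar → WithTop ℝ}, q ≤ E.bound →
              E.Small (st v (mkW n (low E.val v L).ncard c i p q) ks) :=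
            fun h3 => hsm (by omega) (by omega) h3
          calc _ ≤ 1 + ((550 * (n + 1) : ℕ) + (1 + ((220 * (n + 2) : ℕ) + (2 + F')))) := by
                gcongr
                refine (cost_callPick_nth h.heap (by omega) (by omega) (hsm' hq) rfl rfl rfl rfl
                  (n := n) (U := U) (tgt := i + 1) (by rfl) (by omega) (by omega) hP hl hr rfl
                  (F := 1 + ((220 * (n + 2) : ℕ) + (2 + F'))) fun τ => ?_).trans le_rfl
                rw [noW_elim, retK2_elim, update_k5, update_k4]
                simp only [mkK_k7, mkK_k5]
                gcongr
                refine (cost_callCount h (by omega) (hsm' hq) rfl List.suffix_rfl h.val_le rfl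
                  rfl).trans ?_
                rw [update_w5]
                obtain ⟨-, ⟨w, hw, hw'⟩, -⟩ := h.isNext_succ hLX.le hvr
                have hcap := h.lt_capCount_iff ⟨w, hvr.trans hw, hw'⟩
                refine add_le_add_right ?_ _
                by_cases hxX : X < E.succ L r
                · simp only [tooLarge, Test.Holds, WordExpr.eval, mkW_w0, mkW_w5, hcap, hxX,
                    if_true, KeyExpr.eval, mkK_k5, update_k3, hF']
                  rw [← add_assoc, one_add_one_eq_two]
                · have hce := h.capCount_eq (not_lt.1 hxX)
                  simp only [tooLarge, Test.Holds, WordExpr.eval, mkW_w0, mkW_w5, hcap, hxX,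
                    if_false, hF']
                  rw [hce]
                  gcongr
                  exact one_le_two
            _ = ((550 * (n + 1) + 220 * (n + 2) + 4 : ℕ) : ℝ≥0∞) + F' := by push_cast; ring
            _ ≤ _ := natCast_add_le (by omega) le_rfl
        · rw [Finset.sum_add_distrib, Finset.sum_const, Finset.card_range, nsmul_eq_mul]
          nth_rewrite 2 [hp]
          rw [sum_range_getElem hnd
              (x := fun i => ((E.pool L₀ U (E.succ L) l)[i]?).elim 0 x) (y := x)
              (fun i w hi => by simp only [hi, Option.elim_some]), hset]
          rw [← hpc] at hxy
          linarith
    _ = ((550 * (n + 1) + 3 : ℕ) : ℝ≥0∞) + (ENNReal.ofReal (770 * (n + 2) + 10 + y) + G) := by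
        push_cast; ring
    _ ≤ _ := by
        refine natCast_add_ofReal_le ?_ (by positivity) le_rfl
        push_cast
        linarith

end Round

end Limits

/-! ### The potential of the round loop -/

namespace Limits

/-- The expected cost of the rounds for the bounds `L` and `U`. -/
noncomputable def potential (E : Limits) (v : Node) (n : ℕ) (X L₀ w μ lam L : ℝ)
    (U : WithTop ℝ) : ℝ :=
  8000 * lam * (n + 2) * (harmonic (E.live v L₀ X L).card + harmonic (E.above v L₀ X U).card) +
    w * (6 * E.theta v L₀ X L + 6 * μ * E.psi v L₀ X L)

variable {E : Limits}

section RoundLoop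

variable {v : Node} {n : ℕ} {X L₀ : ℝ} (h : Level E v n X L₀)

include h

theorem _root_.ExplorableHeap.Level.live_top_subset {L : ℝ} (hLX : L ≤ X) {r : Node}
    (hr : r ∈ E.live v L₀ X L) : E.live v L₀ X (E.top X r) ⊆
      (E.live v L₀ X L).filter fun j => E.top X r < E.top X j := by
  intro j hj
  rw [Finset.mem_filter]
  exact (h.mem_live_iff (h.lt_top hLX hr).le (h.top_of_live hr).1).1 hj

omit h in
theorem _root_.ExplorableHeap.Level.above_succ_subset {U : WithTop ℝ} {r : Node}
    (hr : r ∈ E.above v L₀ X U) : E.above v L₀ X (E.succ X r) ⊆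
      (E.above v L₀ X U).filter fun j => E.succ X j < E.succ X r := by
  intro j hj
  rw [Level.mem_above] at hj hr
  rw [Finset.mem_filter, Level.mem_above]
  exact ⟨⟨hj.1, hj.2.trans hr.2⟩, by exact_mod_cast hj.2⟩

omit h in
theorem _root_.ExplorableHeap.Level.above_mono {U U' : WithTop ℝ} (hU : U' ≤ U) :
    E.above v L₀ X U' ⊆ E.above v L₀ X U := by
  intro j hj
  rw [Level.mem_above] at hj ⊢
  exact ⟨hj.1, hj.2.trans_le hU⟩

theorem succ_eq_of_lt {L : ℝ} (hLX : L ≤ X) {r : Node} (hr : v <:+ r) (hlt : X < E.succ L r) :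
    E.succ L r = E.succ X r := by
  obtain ⟨-, h2, h3⟩ := h.isNext_succ hLX hr
  exact IsNext.unique (x := X) ⟨hlt, h2, fun w hw hX => h3 w hw (hLX.trans_lt hX)⟩
    (h.isNext_succ le_rfl hr)

theorem mem_live_of_succ_le {L : ℝ} (hLX : L ≤ X) {r : Node} (hr : r ∈ E.roots v L₀)
    (hle : E.succ L r ≤ X) : r ∈ E.live v L₀ X L := by
  obtain ⟨h1, ⟨w, hw, hw'⟩, -⟩ := h.isNext_succ hLX (h.suffix_of_mem hr)
  rw [← hw'] at h1 hle
  exact Level.mem_live.2 ⟨hr, h.count_lt (h.suffix_of_mem hr) hw h1 hle⟩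

open Classical in
-- The three accounts add up: averaged over the choice, the harmonic part drops by at least one unit
-- `8000 * lam * (n + 2)`, `theta` absorbs the linear work of the recursive calls and `psi` their
-- dependence on the increments. A root that is not live leaves `theta` and `psi` unchanged.
theorem sum_potential_le {w μ lam : ℝ} (hw : 0 ≤ w) (hμ : 0 ≤ μ) (hlam : 0 ≤ lam) {L : ℝ}
    (hL : L₀ ≤ L) (hLX : L < X) (U : WithTop ℝ) {a' b' : Node → ℕ}
    (ha : ∀ r ∈ E.live v L₀ X L, a' r = (E.live v L₀ X (E.top X r)).card)
    (ha' : ∀ r ∉ E.live v L₀ X L, a' r = (E.live v L₀ X L).card)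
    (hb : ∀ r ∈ E.above v L₀ X U, b' r = (E.above v L₀ X (E.succ X r)).card)
    (hb' : ∀ r ∉ E.above v L₀ X U, b' r = (E.above v L₀ X U).card) {z : Node → ℝ}
    (hz : ∀ r ∈ E.live v L₀ X L, z r = 6 * (E.count r X + E.theta v L₀ X (E.top X r)) + 6 * μ *
      (E.count r X - E.count r L + E.failBound v L₀ X L r / 2 + E.psi v L₀ X (E.top X r)))
    (hz' : ∀ r ∉ E.live v L₀ X L, z r = 6 * E.theta v L₀ X L + 6 * μ * E.psi v L₀ X L) (b : ℝ) :
    ∑ r ∈ E.live v L₀ X L ∪ E.above v L₀ X U,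
      (b + 8000 * lam * (n + 2) * (harmonic (a' r) + harmonic (b' r) : ℝ) + w * z r) ≤
    (E.live v L₀ X L ∪ E.above v L₀ X U).card *
      (b + (E.potential v n X L₀ w μ lam L U - 8000 * lam * (n + 2))) := by
  set A := E.live v L₀ X L with hA
  set B := E.above v L₀ X U with hB
  have h1 := sum_harmonic_union_le A B (E.top X) (E.succ X) (a' := a') (b' := b')
    (fun r hr => (ha r hr).trans_le (Finset.card_le_card (h.live_top_subset hLX.le hr)))
    (fun r hr => (ha' r hr).le)
    (fun r hr => (hb r hr).trans_le (Finset.card_le_card (Level.above_succ_subset hr)))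
    (fun r hr => (hb' r hr).le)
  have h2 : ∑ r ∈ A ∪ B, z r ≤
      (A ∪ B).card * (6 * E.theta v L₀ X L + 6 * μ * E.psi v L₀ X L) := by
    rw [← Finset.sum_sdiff (Finset.subset_union_left (s₁ := A) (s₂ := B)),
      Finset.sum_congr rfl fun r hr => hz' r (Finset.mem_sdiff.1 hr).2, Finset.sum_const,
      Finset.sum_congr rfl hz, Finset.sum_add_distrib, ← Finset.mul_sum, ← Finset.mul_sum,
      ← Finset.card_sdiff_add_card_eq_card (Finset.subset_union_left (s₁ := A) (s₂ := B)),
      nsmul_eq_mul]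
    have h3 := h.sum_psi_le hL hLX
    have h4 : ∑ r ∈ A, ((E.count r X : ℝ) + E.theta v L₀ X (E.top X r)) ≤
        A.card * E.theta v L₀ X L := by
      rw [← nsmul_eq_mul]
      exact Finset.sum_le_card_nsmul _ _ _ fun r hr => h.theta_le hLX.le hr
    have h5 := mul_le_mul_of_nonneg_left h3 (mul_nonneg (by norm_num : (0 : ℝ) ≤ 6) hμ)
    push_cast
    linarith
  rw [Finset.sum_add_distrib, Finset.sum_add_distrib, ← Finset.mul_sum, ← Finset.mul_sum,
    Finset.sum_const, nsmul_eq_mul, potential]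
  have h6 := mul_le_mul_of_nonneg_left h2 hw
  have h7 := mul_le_mul_of_nonneg_left h1
    (mul_nonneg (mul_nonneg (by norm_num) hlam) (by positivity) : 0 ≤ 8000 * lam * ((n : ℝ) + 2))
  linarith

/-- A live root exists, so the first harmonic number is at least 1. The remaining budget is
therefore nonnegative after a round has been paid, as `ENNReal.ofReal` requires. -/
theorem potential_ge {w μ lam : ℝ} (hw : 0 ≤ w) (hμ : 0 ≤ μ) (hlam : 0 ≤ lam) {L : ℝ}
    (hL : L₀ ≤ L) (hLX : L < X) (U : WithTop ℝ) :
    8000 * lam * (n + 2) ≤ E.potential v n X L₀ w μ lam L U := by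
  have h1 : (harmonic 1 : ℝ) ≤ harmonic (E.live v L₀ X L).card :=
    harmonic_mono (Finset.card_pos.2 (h.live_nonempty hL hLX))
  have h2 := harmonic_nonneg (E.above v L₀ X U).card
  have h3 := Level.theta_nonneg (E := E) (v := v) (X := X) (L₀ := L₀) (L := L)
  have h4 := Level.psi_nonneg (E := E) (v := v) (X := X) (L₀ := L₀) (L := L)
  have h5 : 0 ≤ w * (6 * E.theta v L₀ X L + 6 * μ * E.psi v L₀ X L) := by positivity
  rw [show harmonic 1 = 1 by simp [harmonic]] at h1
  push_cast at h1
  have h6 : 8000 * lam * ((n : ℝ) + 2) * 1 ≤ 8000 * lam * (n + 2) *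
      (harmonic (E.live v L₀ X L).card + harmonic (E.above v L₀ X U).card) :=
    mul_le_mul_of_nonneg_left (by linarith) (by positivity)
  rw [potential]
  linarith

/-- The `c` labels known below `r` all exceed `L₀`, so `c + s` is at most the number of missing
labels. Together with `2 s ≤ c` this gives `3 s ≤ 2 S`: each level of the recursion at least halves
the number of missing labels, with the exception `s = 1`. -/
theorem increment_le {S : ℕ} (hS : n - (low E.val v L₀).ncard ≤ 2 * S) (hS1 : 1 ≤ S) {r : Node}
    (hr : r ∈ E.roots v L₀) {c s : ℕ} {L : ℝ} (hL : L ≤ X) (hc : IsRank E.val r c L)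
    (hs : s + (low E.val v L).ncard ≤ n) (hsc : s = 1 ∨ 2 * s ≤ c) : s ≤ S := by
  rcases hsc with rfl | hsc
  · exact hS1
  · obtain ⟨⟨u, hu, rfl⟩, -, hn⟩ := hc
    have hlt : L₀ ≤ E.val u := (h.lt_of_mem hr).le.trans (h.heap.le_of_suffix hu)
    have h1 := h.ncard_add_le (h.suffix_of_mem hr) hlt hL
    have h2 : (low E.val r L₀).ncard = 0 := h.count_zero hr
    omega

variable {w μ : ℝ} (hw : 0 ≤ w) (hμ : 0 ≤ μ) {S d₀ : ℕ}
  (hext : ExtSpec E (fun n m => w * (n + 6 * excess m * μ)) S d₀) {d : ℕ}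
  (hd : d₀ + 230 ≤ d) {f : Local WVar KVar → ℝ≥0∞} {lam : ℝ} (hlam : 1 + Real.log n ≤ lam)

include hd in
open Classical in
theorem roundLoop_unfold {k c s a q : ℕ} {L : ℝ} {U κ κ' : WithTop ℝ} (hk : k ≤ n) (hc : c ≤ n)
    (hs : s ≤ E.bound) (ha : a ≤ E.bound) (hq : q ≤ E.bound) :
    E.cost d roundLoop f (st v (mkW n k c s a q) (mkK (E.val v) L₀ L U κ κ' ⊤ ⊤)) ≤
      1 + if k < n then E.symb (d - 1) round (E.cost d roundLoop f)
        (st v (mkW n k c s a q) (mkK (E.val v) L₀ L U κ κ' ⊤ ⊤)) else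
        f (st v (mkW n k c s a q) (mkK (E.val v) L₀ L U κ κ' ⊤ ⊤)) := by
  have hroom := h.room
  have hs' : E.Small (st v (mkW n k c s a q) (mkK (E.val v) L₀ L U κ κ' ⊤ ⊤)) := by
    rw [small_mkW]
    omega
  have hh : round.height + 1 ≤ d := by
    simp [round, explore, growLoop, grow, refineLoop, refine, chooseStep, callFind, home, callItems,
      callPick, callCount, callQuery, ExplorableHeap.accept, Cmd.height]
    omega
  refine (E.cost_while (b := .wordLt (.var w1) (.var w0)) (c := ExplorableHeap.round) hs'
    hh).trans (le_of_eq ?_)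
  simp only [Test.Holds, WordExpr.eval, mkW_w0, mkW_w1]
  congr

include hw hμ hext hd hlam

open Classical in
-- The induction is on the number of live roots plus the number of roots that can lower `U`. Every
-- choice decreases this sum, so the loop ends for all random draws; the averaging is needed only
-- for the expected cost.
theorem cost_roundLoop (hS : n - (low E.val v L₀).ncard ≤ 2 * S) (hS1 : 1 ≤ S) {G : ℝ≥0∞}
    (hG : ∀ ws ks, ks k2 = (X : WithTop ℝ) → f (st v ws ks) ≤ G) {c s a q : ℕ} {L : ℝ}
    {U κ κ' : WithTop ℝ} (hL : L₀ ≤ L) (hLX : L ≤ X) (hXU : X < U) (hc : c ≤ n)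
    (hs : s ≤ E.bound) (ha : a ≤ E.bound) (hq : q ≤ E.bound) :
    E.cost d roundLoop f (st v (mkW n (low E.val v L).ncard c s a q)
      (mkK (E.val v) L₀ L U κ κ' ⊤ ⊤)) ≤
      ENNReal.ofReal (1 + if L < X then E.potential v n X L₀ w μ lam L U else 0) + G := by
  have hroom := h.room
  have hlam1 : 1 ≤ lam := by
    have := Real.log_natCast_nonneg n
    linarith
  have hlam0 : 0 ≤ lam := zero_le_one.trans hlam1
  induction hm : (E.live v L₀ X L).card + (E.above v L₀ X U).card using Nat.strong_induction_on
    generalizing c s a q L U κ κ' with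
  | _ m ih =>
  have hkn := h.ncard_le hLX
  refine (roundLoop_unfold h hd hkn hc hs ha hq).trans ?_
  rcases hLX.eq_or_lt with rfl | hlt
  · rw [if_neg (by rw [h.rank.2.2]; exact lt_irrefl _), if_neg (lt_irrefl _), add_zero,
      ENNReal.ofReal_one]
    gcongr
    exact hG _ _ rfl
  rw [if_pos (h.ncard_lt hlt), if_pos hlt]
  set A := E.live v L₀ X L with hA
  set B := E.above v L₀ X U with hB
  set a' : Node → ℕ := fun r => if r ∈ A then (E.live v L₀ X (E.top X r)).card else A.card with ha'
  set b' : Node → ℕ := fun r => if r ∈ B then (E.above v L₀ X (E.succ X r)).card else B.card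
    with hb'
  set z : Node → ℝ := fun r => if r ∈ A then 6 * (E.count r X + E.theta v L₀ X (E.top X r)) +
    6 * μ * (E.count r X - E.count r L + E.failBound v L₀ X L r / 2 + E.psi v L₀ X (E.top X r))
    else 6 * E.theta v L₀ X L + 6 * μ * E.psi v L₀ X L with hz
  -- The part of an exploration that does not depend on the root, plus the final test of the loop.
  -- Together with the `1400 * (n + 2)` of a round it fits into the drop `8000 * lam * (n + 2)`.
  set b : ℝ := 1 + 5000 * (n + 2) * lam with hbd
  have hθ : ∀ {L}, 0 ≤ E.theta v L₀ X L := Level.theta_nonneg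
  have hψ : ∀ {L}, 0 ≤ E.psi v L₀ X L := Level.psi_nonneg
  have hcardA : ∀ r ∈ A, (E.live v L₀ X (E.top X r)).card < A.card := fun r hr =>
    (Finset.card_le_card (h.live_top_subset hLX hr)).trans_lt (Finset.card_lt_card
      (Finset.filter_ssubset.2 ⟨r, hr, lt_irrefl _⟩))
  have hcardB : ∀ r ∈ B, (E.above v L₀ X (E.succ X r)).card < B.card := fun r hr =>
    (Finset.card_le_card (Level.above_succ_subset hr)).trans_lt (Finset.card_lt_card
      (Finset.filter_ssubset.2 ⟨r, hr, lt_irrefl _⟩))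
  have hcg : ∀ r ∈ A, (0 : ℝ) ≤ E.count r X - E.count r L := fun r hr => by
    rw [sub_nonneg]
    exact_mod_cast (Level.mem_live.1 hr).2.le
  have hfb : ∀ r ∈ A, 0 ≤ E.failBound v L₀ X L r := fun r hr =>
    h.failBound_nonneg hLX (h.suffix_of_mem (Level.mem_live.1 hr).1)
  have hz0 : ∀ r, 0 ≤ z r := by
    intro r
    simp only [hz]
    split_ifs with hr
    · have h1 := hcg r hr
      have h2 := hfb r hr
      have h3 := hθ (L := E.top X r)
      have h4 := hψ (L := E.top X r)
      positivity
    · have h3 := hθ (L := L)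
      have h4 := hψ (L := L)
      positivity
  have hhn := fun a => harmonic_nonneg a
  have hsum := sum_potential_le h hw hμ hlam0 hL hlt U (a' := a') (b' := b') (z := z)
    (fun r hr => if_pos hr) (fun r hr => if_neg hr) (fun r hr => if_pos hr)
    (fun r hr => if_neg hr) (fun r hr => if_pos hr) (fun r hr => if_neg hr) b
  have hge := potential_ge h hw hμ hlam0 hL hlt U
  have hround := cost_round h (d := d - 1) (by omega) (f := E.cost d roundLoop f) (s := s) (a := a)
    (q := q) (κ := κ) (κ' := κ') hL hlt hXU hc hs ha hq
    (x := fun r => b + 8000 * lam * (n + 2) * (harmonic (a' r) + harmonic (b' r) : ℝ) + w * z r)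
    (fun r => by
      have := hz0 r
      have := hhn (a' r)
      have := hhn (b' r)
      positivity) hsum (G := G) ?_
  · refine (add_le_add_right hround 1).trans ?_
    rw [← Nat.cast_one (R := ℝ≥0∞)]
    have hnl : ((n : ℝ) + 2) * 1 ≤ (n + 2) * lam :=
      mul_le_mul_of_nonneg_left hlam1 (by positivity)
    have hn0 : (0 : ℝ) ≤ n := by positivity
    refine natCast_add_ofReal_le ?_ ?_ le_rfl
    · push_cast
      linarith
    · have : 0 ≤ b := by positivity
      linarith
  · intro r hr p s q hp hs hq
    have hrr : r ∈ E.roots v L₀ := (Finset.mem_union.1 hr).elim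
      (fun h => (Level.mem_live.1 h).1) fun h => (Level.mem_above.1 h).1
    have hvr := h.suffix_of_mem hrr
    by_cases hX : X < E.succ L r
    · have hrA : r ∉ A := fun hrA => by
        obtain ⟨h1, ⟨u, hu, hu'⟩, -⟩ := h.top_of_live hrA
        have h2 := h.lt_top hLX hrA
        rw [← hu'] at h1 h2
        exact absurd ((h.isNext_succ hLX hvr).2.2 u hu h2) (not_le.2 (h1.trans_lt hX))
      have hrB : r ∈ B := (Finset.mem_union.1 hr).resolve_left hrA
      have hlt' := hcardB r hrB
      rw [if_pos hX, succ_eq_of_lt h hLX hvr hX]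
      rw [succ_eq_of_lt h hLX hvr hX] at hX
      refine (ih _ (hm ▸ Nat.add_lt_add_left hlt' _) hL hLX (by exact_mod_cast hX) hc (by omega)
        (by omega) hq rfl).trans ?_
      refine add_le_add_left (ENNReal.ofReal_le_ofReal ?_) _
      rw [if_pos hlt, potential]
      simp only [ha', hb', hz, if_neg hrA, if_pos hrB]
      have : 0 ≤ 5000 * ((n : ℝ) + 2) * lam := by positivity
      linarith
    · have hrA : r ∈ A := mem_live_of_succ_le h hLX hrr (not_lt.1 hX)
      have hX := not_lt.1 hX
      obtain ⟨hLy, hy, -⟩ := h.isNext_succ hLX hvr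
      have htX := (h.top_of_live hrA).1
      have hLt := h.lt_top hLX hrA
      rw [if_neg (not_lt.2 hX)]
      set V' : ℝ := 8000 * lam * (n + 2) * (harmonic (a' r) + harmonic (b' r) : ℝ) +
        w * (6 * E.theta v L₀ X (E.top X r) + 6 * μ * E.psi v L₀ X (E.top X r)) with hV'
      have hV0 : 0 ≤ V' := by
        have := hhn (a' r)
        have := hhn (b' r)
        have h3 := hθ (L := E.top X r)
        have h4 := hψ (L := E.top X r)
        positivity
      have hrX : E.val r ≤ X := by
        obtain ⟨u, hu, hu'⟩ := hy
        exact (h.heap.le_of_suffix hu).trans (hu'.trans_le hX)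
      refine (cost_explore h hvr hrX hw hμ hext (d := d - 1) (by omega) hlam hy hX
        (hfb r hrA) ?_ ?_ hXU (G := ENNReal.ofReal (1 + V') + G) ?_ hc (by omega)
        (by omega)).trans ?_
      · intro c s L' x hyL hLX' hc hs hx hXx
        exact h.le_failBound hrA hL (hLy.le.trans hyL) hLX' hc hs hx hXx
      · intro c s L' hLX' hc _ hs hsc
        exact increment_le h hS hS1 hrr hLX' hc hs hsc
      · intro c s q U' κ hXU' hU'U hor hc hs hq
        have h1 := hcardA r hrA
        have h2 := Finset.card_le_card (Level.above_mono (E := E) (v := v) (L₀ := L₀) (X := X) hU'U)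
        refine (ih _ (hm ▸ Nat.add_lt_add_of_lt_of_le h1 h2) (hL.trans hLt.le) htX hXU' hc hs
          (by omega) hq rfl).trans ?_
        gcongr
        split_ifs with hlt'
        -- The search is not finished, so the exploration has lowered the upper bound to the next
        -- label below `r` at most; hence the roots above `X` shrink as if `r` had been drawn for
        -- them.
        · have hU' := hor.resolve_left hlt'.ne
          have hb : (E.above v L₀ X U').card ≤ b' r := by
            simp only [hb']
            split_ifs
            · exact Finset.card_le_card (Level.above_mono hU')
            · exact h2
          have h3 := harmonic_mono hb
          have h4 : a' r = (E.live v L₀ X (E.top X r)).card := if_pos hrA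
          rw [potential, hV', h4]
          gcongr
        · exact hV0
      · have hcc : (E.count r L : ℝ) ≤ E.count r (E.succ L r) := by
          exact_mod_cast h.count_mono hvr hLy.le hX
        have hcc' : (E.count r (E.succ L r) : ℝ) ≤ E.count r X := by
          exact_mod_cast h.count_mono hvr hX le_rfl
        have h2 := hfb r hrA
        refine ofReal_add_le_ofReal_add ?_ ?_ (by positivity) le_rfl
        · simp only [hz, if_pos hrA, hV', hbd]
          have h5 : w * (6 * E.count r X + 6 * μ * (E.count r X - E.count r (E.succ L r) +
              E.failBound v L₀ X L r / 2)) ≤ w * (6 * E.count r X + 6 * μ *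
              (E.count r X - E.count r L + E.failBound v L₀ X L r / 2)) := by
            gcongr
          linarith
        · have := sub_nonneg.2 hcc'
          positivity

end RoundLoop

theorem symb_roundLoop {d : ℕ} {f : Local WVar KVar → ℝ≥0∞} :
    E.symb d roundLoop f = E.cost d roundLoop f := rfl

theorem symb_callQuery {d : ℕ} {e b lo hi : KeyExpr KVar} {t : WordExpr WVar}
    {rw : WVar → Option WVar} {rk : KVar → Option KVar} {f : Local WVar KVar → ℝ≥0∞} :
    E.symb d (callQuery e b lo hi t rw rk) f = E.cost d (callQuery e b lo hi t rw rk) f := rfl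

/-! ### One level of the recursion, and the induction over its depth -/

section Ext

variable {v : Node} {n k : ℕ} {X L₀ : ℝ} (h : Level E v n X L₀) (hk : (low E.val v L₀).ncard = k)
  {d : ℕ} (hd : 230 ≤ d) {f : Local WVar KVar → ℝ≥0∞}

include h hk hd

open Classical in
theorem cost_extBody : E.cost d extBody f (st v (mkW n k 0 0 0 0) (mkK ⊤ L₀ ⊤ ⊤ ⊤ ⊤ ⊤ ⊤)) ≤
    (8 : ℕ) + if k + 1 < n then
      E.cost d roundLoop f (st v (mkW n k 0 0 0 0) (mkK (E.val v) L₀ L₀ ⊤ ⊤ ⊤ ⊤ ⊤)) else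
      E.cost d (callQuery (.var k0) (.var k1) infE infE (.add (.var w0) (.lit 1)) noW
        (retK k2 k5)) f (st v (mkW n k 0 0 0 0) (mkK (E.val v) L₀ L₀ ⊤ ⊤ ⊤ ⊤ ⊤)) := by
  have hroom := h.room
  have hkn := hk ▸ h.ncard_lt h.lt
  have hs : E.Small (st v (mkW n k 0 0 0 0) (mkK ⊤ L₀ ⊤ ⊤ ⊤ ⊤ ⊤ ⊤)) := by
    rw [small_mkW]
    omega
  have hh : extBody.height ≤ d := by
    simp [extBody, roundLoop, round, explore, growLoop, grow, refineLoop, refine, chooseStep,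
      callFind, home, callItems, callPick, callCount, callQuery, ExplorableHeap.accept, Cmd.height]
    omega
  refine (E.cost_le_symb hs hh).trans ?_
  simp only [extBody, symb, symb_roundLoop, symb_callQuery, KeyExpr.eval, update_k0, update_k2,
    update_k3, Test.Holds, WordExpr.eval, mkW_w0, mkW_w1, mkK_k1, if_pos hkn]
  split_ifs
  · refine le_trans (le_of_eq ?_) (natCast_add_le (a := 7) (b := 8) (by omega) le_rfl)
    push_cast
    ring
  · refine le_of_eq ?_
    push_cast
    ring

theorem cost_extBody_next (hkn : n = k + 1) {F : ℝ≥0∞}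
    (hF : ∀ ws ks, ks k2 = (X : WithTop ℝ) → f (st v ws ks) ≤ F) :
    E.cost d extBody f (st v (mkW n k 0 0 0 0) (mkK ⊤ L₀ ⊤ ⊤ ⊤ ⊤ ⊤ ⊤)) ≤
      (220 * (n + 2) : ℕ) + F := by
  have hroom := h.room
  have hs : ∀ {ks : KVar → WithTop ℝ}, E.Small (st v (mkW n k 0 0 0 0) ks) := by
    intro ks
    rw [small_mkW]
    omega
  have hlow := h.finite h.lt.le
  refine (cost_extBody h hk hd).trans ?_
  rw [if_neg (by omega)]
  refine (add_le_add_right (cost_callQuery h.heap (by omega) (by omega) hs rfl rfl rfl rfl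
    (tgt := n + 1) (by rfl) (by omega) List.suffix_rfl (h.finite h.val_le) (h.ncard_le h.val_le)
    (scanSpec_count_finite h.heap (by omega) (by omega) hlow (by omega)) (F := F) ?_) _).trans ?_
  · rintro p β o ⟨-, y, hy, rfl⟩ -
    rw [noW_elim, retK_elim, update_k2]
    refine hF _ _ ?_
    have := h.heap.isRank_next hlow hy
    rw [hk, ← hkn] at this
    rw [h.rank.unique this]
    rfl
  · rw [hk, ← add_assoc, ← Nat.cast_add]
    exact natCast_add_le (by omega) le_rfl

/-- The potential at the start: at most `n` roots, so both harmonic numbers are at most `lam`, and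
`theta` and `psi` coincide and are at most `n - k`. The factor `μ` for the recursive calls turns
into `1 + μ`, without any constant. -/
theorem cost_extBody_rounds {w μ lam : ℝ} (hw : 0 ≤ w) (hμ : 0 ≤ μ) {S d₀ : ℕ}
    (hext : ExtSpec E (fun n m => w * (n + 6 * excess m * μ)) S d₀) (hd' : d₀ + 230 ≤ d)
    (hlam : 1 + Real.log n ≤ lam) (hS : n - k ≤ 2 * S) (hS1 : 1 ≤ S) (hkn : k + 1 < n) {F : ℝ≥0∞}
    (hF : ∀ ws ks, ks k2 = (X : WithTop ℝ) → f (st v ws ks) ≤ F) :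
    E.cost d extBody f (st v (mkW n k 0 0 0 0) (mkK ⊤ L₀ ⊤ ⊤ ⊤ ⊤ ⊤ ⊤)) ≤
      ENNReal.ofReal (9 + 16000 * lam ^ 2 * (n + 2) + w * (6 * ((n : ℝ) - k) * (1 + μ))) + F := by
  have hlam1 : 1 ≤ lam := by
    have := Real.log_natCast_nonneg n
    linarith
  have hge := potential_ge h hw hμ (zero_le_one.trans hlam1) le_rfl h.lt ⊤
  refine (cost_extBody h hk hd).trans ?_
  rw [if_pos hkn]
  subst hk
  have hloop := cost_roundLoop h hw hμ hext hd' hlam hS hS1 hF (c := 0) (s := 0) (a := 0) (q := 0)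
    (U := ⊤) (κ := ⊤) (κ' := ⊤) le_rfl h.lt.le (WithTop.coe_lt_top X) (by omega) (by omega)
    (by omega) (by omega)
  rw [if_pos h.lt] at hloop
  have hlam0 : 0 ≤ lam := zero_le_one.trans hlam1
  refine natCast_add_ofReal_le ?_ (add_nonneg zero_le_one (le_trans (by positivity) hge)) hloop
  have h1 : (harmonic (E.live v L₀ X L₀).card : ℝ) ≤ lam := (harmonic_le (N := n)
    ((Finset.card_le_card (Finset.filter_subset _ _)).trans h.card_roots)).trans hlam
  have h2 : (harmonic (E.above v L₀ X ⊤).card : ℝ) ≤ lam := (harmonic_le (N := n)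
    ((Finset.card_le_card (Finset.filter_subset _ _)).trans h.card_roots)).trans hlam
  have h3 : E.theta v L₀ X L₀ ≤ (n : ℝ) - (low E.val v L₀).ncard := by
    have := h.theta_initial
    rw [Limits.count] at this
    linarith
  have h4 : 8000 * lam * ((n : ℝ) + 2) * (harmonic (E.live v L₀ X L₀).card +
      harmonic (E.above v L₀ X ⊤).card) ≤ 8000 * lam * (n + 2) * (lam + lam) := by
    gcongr
  have h5 : w * (6 * E.theta v L₀ X L₀ + 6 * μ * E.theta v L₀ X L₀) ≤
      w * (6 * ((n : ℝ) - (low E.val v L₀).ncard) * (1 + μ)) := by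
    refine mul_le_mul_of_nonneg_left ?_ hw
    rw [← add_mul]
    have := mul_le_mul_of_nonneg_left h3 (by positivity : 0 ≤ 6 + 6 * μ)
    linarith
  rw [potential, h.psi_initial]
  push_cast
  linarith

end Ext

/-- `M` bounds the depth. A further level adds `6 (n - k)` to the factor of `w = 50000 * lam ^ 2`,
and its overhead `9 + 16000 * lam ^ 2 * (n + 2)` is at most `w * n` since `n + 2 ≤ 3 n`. Each level
reserves 230 cells. -/
theorem extSpec {lam : ℝ} (hlam : ∀ n : ℕ, n ≤ E.bound → 1 + Real.log n ≤ lam) (M : ℕ) :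
    ExtSpec E (fun n m => 50000 * lam ^ 2 * (n + 6 * excess m * M)) (2 ^ M) (230 * (M + 1)) := by
  have hlam1 : 1 ≤ lam := by simpa using hlam 0 (Nat.zero_le _)
  have hsq : 1 ≤ lam ^ 2 := one_le_pow₀ hlam1
  -- The case of one missing label occurs at every depth and must be linear in `n` without the
  -- factor `M`; this is again the convention `excess 1 = 0`.
  have hnext : ∀ (M d : ℕ), 230 * (M + 1) ≤ d → ∀ (v : Node) (n k : ℕ) (X L₀ : ℝ),
      Level E v n X L₀ → (low E.val v L₀).ncard = k → n = k + 1 →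
      ∀ (f : Local WVar KVar → ℝ≥0∞) (F : ℝ≥0∞),
      (∀ ws ks, ks k2 = (X : WithTop ℝ) → f (st v ws ks) ≤ F) →
      E.cost d extBody f (st v (mkW n k 0 0 0 0) (mkK ⊤ L₀ ⊤ ⊤ ⊤ ⊤ ⊤ ⊤)) ≤
        ENNReal.ofReal (50000 * lam ^ 2 * (n + 6 * excess (n - k) * M)) + F := by
    intro M d hd v n k X L₀ h hk hkn f F hF
    refine (cost_extBody_next h hk (by omega) hkn hF).trans ?_
    rw [← ENNReal.ofReal_natCast]
    gcongr
    have hn : (1 : ℝ) ≤ n := by exact_mod_cast h.pos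
    have h1 : (n : ℝ) * 1 ≤ n * lam ^ 2 := mul_le_mul_of_nonneg_left hsq (by positivity)
    rw [excess, if_pos (by omega)]
    push_cast
    linarith
  induction M with
  | zero =>
    intro d hd v n k X L₀ h hk hS f F hF
    have hkn := hk ▸ h.ncard_lt h.lt
    exact hnext 0 d hd v n k X L₀ h hk (by omega) f F hF
  | succ M ih =>
    intro d hd v n k X L₀ h hk hS f F hF
    have hkn := hk ▸ h.ncard_lt h.lt
    rcases (by omega : n = k + 1 ∨ k + 1 < n) with hkn | hkn
    · exact hnext (M + 1) d hd v n k X L₀ h hk hkn f F hF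
    · have hroom := h.room
      refine (cost_extBody_rounds h hk (by omega) (by positivity) (by positivity) ih (by omega)
        (hlam n (by omega)) (by rw [← pow_succ']; exact hS) Nat.one_le_two_pow hkn hF).trans ?_
      gcongr
      have hn : (1 : ℝ) ≤ n := by exact_mod_cast h.pos
      have h1 : (n : ℝ) * 1 ≤ n * lam ^ 2 := mul_le_mul_of_nonneg_left hsq (by positivity)
      have h2 : lam ^ 2 * 1 ≤ lam ^ 2 * n := mul_le_mul_of_nonneg_left hn (by positivity)
      beta_reduce
      rw [excess, if_neg (by omega), Nat.cast_sub (by omega)]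
      push_cast
      linarith

end Limits

/-! ### From the expected price to time, output and space -/

namespace Limits

variable {E : Limits} {A : Algorithm}

theorem one_le_price {c : Config A.W A.K A.P} (h : ¬ A.Halted c) : 1 ≤ E.price c := by
  rw [price, if_neg h]
  split_ifs
  · exact le_rfl
  · exact le_top

theorem total_init (n : ℕ) :
    E.total (A.init n) = ∑' t, ∑' c, A.run E.val n t c * E.price c := by
  simp only [total, run_eq_iter]

theorem tsum_toOuterMeasure_le (n : ℕ) {s : Set (Config A.W A.K A.P)}
    (hs : ∀ c ∈ s, ¬ A.Halted c) :
    ∑' t, (A.run E.val n t).toOuterMeasure s ≤ E.total (A.init n) := by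
  rw [total_init]
  refine ENNReal.tsum_le_tsum fun t => ?_
  rw [PMF.toOuterMeasure_apply]
  refine ENNReal.tsum_le_tsum fun c => ?_
  by_cases hc : c ∈ s
  · rw [Set.indicator_of_mem hc]
    exact le_mul_of_one_le_right zero_le (one_le_price (hs c hc))
  · rw [Set.indicator_of_notMem hc]
    exact zero_le

theorem expectedTime_le (n : ℕ) : A.expectedTime E.val n ≤ E.total (A.init n) :=
  tsum_toOuterMeasure_le n fun _ hc => hc

theorem expectedTravel_le (n : ℕ) : A.expectedTravel E.val n ≤ E.total (A.init n) := by
  refine tsum_toOuterMeasure_le n ?_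
  rintro c ⟨f, d, todo, rest, hc, hf⟩ ⟨g, hg, hg'⟩
  rw [hc] at hg
  rw [(List.cons.inj hg).1, hg'] at hf
  exact List.noConfusion rfl (heq_of_eq hf)

theorem price_ne_top {n : ℕ} (h : E.total (A.init n) ≠ ⊤) {t : ℕ} {c : Config A.W A.K A.P}
    (hc : c ∈ (A.run E.val n t).support) : E.price c ≠ ⊤ := by
  intro htop
  rw [total_init] at h
  have h1 := ENNReal.ne_top_of_tsum_ne_top (ENNReal.ne_top_of_tsum_ne_top h t) c
  rw [htop, ENNReal.mul_top ((PMF.mem_support_iff _ _).1 hc)] at h1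
  exact h1 rfl

/-- A violation of the memory bounds costs ∞, so its occurrence with positive probability would make
the total infinite. An expectation thus yields a bound for every reachable configuration. -/
theorem fits_of_mem_support {n : ℕ} (h : E.total (A.init n) ≠ ⊤) {t : ℕ}
    {c : Config A.W A.K A.P} (hc : c ∈ (A.run E.val n t).support) : E.Fits c := by
  by_contra hf
  exact price_ne_top h hc (if_neg hf)

theorem accept_of_halted {n : ℕ} (h : E.total (A.init n) ≠ ⊤) {t : ℕ}
    {c : Config A.W A.K A.P} (hc : c ∈ (A.run E.val n t).support) (hh : A.Halted c) :
    ∃ f ∈ c.stack, E.accept (f.keys A.output) := by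
  by_contra hf
  refine price_ne_top h hc ?_
  rw [price, if_pos (fits_of_mem_support h hc), if_pos hh, if_neg hf]

/-- The probabilities of still running at time `t` are summable, hence tend to 0, and every halted
configuration of positive probability is accepted. -/
theorem tendsto_of_total_ne_top {n : ℕ} (h : E.total (A.init n) ≠ ⊤)
    {s : Set (Config A.W A.K A.P)}
    (hs : ∀ c, A.Halted c → (∃ f ∈ c.stack, E.accept (f.keys A.output)) → c ∈ s) :
    Filter.Tendsto (fun t : ℕ => (A.run E.val n t).toOuterMeasure s) Filter.atTop (𝓝 1) := by
  have h1 := ENNReal.tendsto_atTop_zero_of_tsum_ne_top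
    (ne_top_of_le_ne_top h (tsum_toOuterMeasure_le (s := {c | ¬ A.Halted c}) n fun _ hc => hc))
  have h2 := ENNReal.Tendsto.sub (tendsto_const_nhds (x := (1 : ℝ≥0∞))) h1 (.inl ENNReal.one_ne_top)
  rw [tsub_zero] at h2
  refine tendsto_of_tendsto_of_tendsto_of_le_of_le h2 tendsto_const_nhds (fun t => ?_) fun t => ?_
  · rw [tsub_le_iff_right]
    refine le_trans (le_of_eq ?_) (MeasureTheory.measure_union_le _ _)
    rw [eq_comm, PMF.toOuterMeasure_apply_eq_one_iff]
    intro c hc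
    by_cases hh : A.Halted c
    · exact .inl (hs c hh (accept_of_halted h hc hh))
    · exact .inr hh
  · rw [← (PMF.toOuterMeasure_apply_eq_one_iff (A.run E.val n t) (s := Set.univ)).2
      (Set.subset_univ _)]
    exact MeasureTheory.measure_mono (Set.subset_univ s)

/-- The memory bounds for the algorithm with input `n`, where only the output `X` is accepted. -/
noncomputable def select (val : Node → ℝ) (n : ℕ) (X : ℝ) : Limits where
  val := val
  -- The variables of `main` take 14 cells, the call of `ext` takes 15, and the recursion of depth
  -- `log₂ n + 1` takes `230 * (log₂ n + 2)`.
  space := 489 + 230 * Nat.log 2 n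
  bound := n + 2
  accept x := x = X

theorem exists_isRank_root {val : Node → ℝ} (hv : IsHeap val) {n : ℕ} (hn : 1 ≤ n) :
    ∃ X, IsRank val [] n X := by
  have hemp : low val [] (val [] - 1) = ∅ := hv.low_eq_empty (by linarith)
  obtain ⟨y, -, hy⟩ := hv.exists_isRank (v := []) (x := val [] - 1)
    (by rw [hemp]; exact Set.finite_empty) (n := n) (by rw [hemp, Set.ncard_empty]; exact hn)
  exact ⟨y, hy⟩

theorem isNthSmallest_of_isRank {val : Node → ℝ} {n : ℕ} {X : ℝ} (h : IsRank val [] n X) :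
    IsNthSmallest val n X := by
  obtain ⟨⟨w, -, hw⟩, hf, hn⟩ := h
  refine ⟨⟨w, hw⟩, ?_⟩
  have : {v : Node | val v ≤ X} = low val [] X := by
    ext v
    exact ⟨fun h => ⟨List.nil_suffix, h⟩, fun h => h.2⟩
  rw [this, ← hf.cast_ncard_eq, hn]

/-! ### The bounds for the whole algorithm -/

section Main

variable {val : Node → ℝ} (hv : IsHeap val) {n : ℕ} {X : ℝ} (hX : IsRank val [] n X)

theorem total_select_le (hn : 1 ≤ n) {F : ℝ≥0∞}
    (h : ∀ f : Local WVar KVar → ℝ≥0∞, (∀ ws ks, ks k2 = (X : WithTop ℝ) → f (st [] ws ks) ≤ 1) →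
      (select val n X).cost (475 + 230 * Nat.log 2 n - 15) extBody f
        (st [] (mkW n 1 0 0 0 0) (mkK ⊤ (val []) ⊤ ⊤ ⊤ ⊤ ⊤ ⊤)) ≤ F) :
    (select val n X).total (heapSelect.init n) ≤ 1 + F := by
  classical
  set E := select val n X with hE
  have hinit : heapSelect.init n = cfg (A := heapSelect) (st [] (mkW n 0 0 0 0 0) fun _ => ⊤)
      [mainBody] [] := by
    have : Function.update (fun _ => 0) w0 n = mkW n 0 0 0 0 0 := by
      funext i
      cases i <;> rfl
    rw [cfg, ← this]
    rfl
  have hroom : E.Room (A := heapSelect) (475 + 230 * Nat.log 2 n) [] [] := by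
    refine ⟨?_, fun f hf => absurd hf List.not_mem_nil⟩
    simp only [Algorithm.cells, List.map_nil, List.sum_nil, List.length_nil, hE, select]
    have h1 : heapSelect.vars = 14 := rfl
    omega
  have hs : E.Small (st [] (mkW n 0 0 0 0 0) fun _ => (⊤ : WithTop ℝ)) := by
    rw [small_mkW]
    simp only [hE, select]
    omega
  rw [hinit]
  refine (E.le_wp (f := fun τ => if τ.keys k2 = (X : WithTop ℝ) then 0 else ⊤) hroom
    fun τ hτ => ?_).trans ?_
  · split_ifs with hk
    · exact (E.total_of_halted (E.fits_cfg hroom hτ [] (Nat.zero_le _)) hk).le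
    · exact le_top
  · refine (cost_call_mk extBody rfl hs (by omega)).trans ?_
    refine add_le_add_right (h _ fun ws ks hk => ?_) _
    change 1 + (if ks k2 = (X : WithTop ℝ) then (0 : ℝ≥0∞) else ⊤) ≤ 1
    rw [if_pos hk, add_zero]

include hv hX

/-- For `n = 1` the root is already the answer and no label is missing. `Level` requires a threshold
strictly below `X`, so this case is traced by hand. -/
theorem total_select_one (hn : n = 1) : (select val n X).total (heapSelect.init n) ≤ 20 := by
  subst hn
  have hXr : X = val [] := hX.unique ⟨⟨[], List.suffix_rfl, rfl⟩, by
    rw [low_self hv]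
    exact ⟨Set.finite_singleton _, Set.ncard_singleton _⟩⟩
  refine (total_select_le le_rfl (F := 19) fun f hf => ?_).trans (by norm_num)
  have hs : (select val 1 X).Small (st [] (mkW 1 1 0 0 0 0) (mkK ⊤ (val []) ⊤ ⊤ ⊤ ⊤ ⊤ ⊤)) := by
    rw [small_mkW]
    simp only [select]
    omega
  have hh : extBody.height ≤ 475 + 230 * Nat.log 2 1 - 15 := by
    simp [extBody, roundLoop, round, explore, growLoop, grow, refineLoop, refine, chooseStep,
      callFind, home, callItems, callPick, callCount, callQuery, ExplorableHeap.accept, Cmd.height]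
  refine ((select val 1 X).cost_le_symb hs hh).trans ?_
  simp only [extBody, symb, KeyExpr.eval, update_k0, update_k2, update_k3, Test.Holds,
    WordExpr.eval, mkW_w0, mkW_w1, mkK_k1]
  rw [if_neg (by omega), if_neg (by omega)]
  calc _ ≤ (1 : ℝ≥0∞) + (1 + (1 + (1 + (1 + (1 + (1 + (1 + (1 + 1)))))))) := by
        gcongr
        exact hf _ _ (by rw [hXr]; rfl)
    _ ≤ _ := by norm_num

theorem total_select (hn : 2 ≤ n) : (select val n X).total (heapSelect.init n) ≤
    ENNReal.ofReal (10 ^ 7 * (n * Real.logb 2 n ^ 3)) := by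
  set E := select val n X with hE
  set ℓ := Real.logb 2 n with hℓ
  have hn2 : (2 : ℝ) ≤ n := by exact_mod_cast hn
  have hℓ1 : 1 ≤ ℓ := by
    rw [hℓ, Real.le_logb_iff_rpow_le one_lt_two (by linarith), Real.rpow_one]
    exact hn2
  have hlog : Real.log n ≤ ℓ := by
    rw [hℓ, Real.logb, le_div_iff₀ (Real.log_pos one_lt_two)]
    refine mul_le_of_le_one_right (Real.log_nonneg (by linarith)) ?_
    linarith [Real.log_two_lt_d9]
  -- All integers in memory are at most `n + 2`, and `n + 2 ≤ n ^ 2` for `n ≥ 2`, so `3 * ℓ` serves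
  -- as the bound `lam` at every level of the recursion.
  have hlam : ∀ m : ℕ, m ≤ E.bound → 1 + Real.log m ≤ 3 * ℓ := by
    intro m hm
    rcases Nat.eq_zero_or_pos m with rfl | hm0
    · simp
      linarith
    · have h1 : (m : ℝ) ≤ n ^ 2 := by
        have : (m : ℝ) ≤ n + 2 := by exact_mod_cast hm
        nlinarith
      have h2 := Real.log_le_log (by exact_mod_cast hm0) h1
      rw [Real.log_pow] at h2
      push_cast at h2
      linarith
  have hlow : (low val [] (val [])).ncard = 1 := by rw [low_self hv, Set.ncard_singleton]
  have hlt : val [] < X := by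
    obtain ⟨⟨w, hw, rfl⟩, -, hc⟩ := hX
    refine lt_of_le_of_ne (hv.le_of_suffix hw) fun he => ?_
    rw [← he] at hc
    omega
  have hlev : Level E [] n X (val []) := ⟨hv, hX, le_rfl, hlt⟩
  have hM : n - 1 ≤ 2 ^ (Nat.log 2 n + 1) :=
    (Nat.sub_le _ _).trans (Nat.lt_pow_succ_log_self one_lt_two n).le
  refine (total_select_le (by omega) fun f hf => extSpec hlam (Nat.log 2 n + 1) _ (by omega)
    [] n 1 X (val []) hlev hlow hM f 1 hf).trans ?_
  rw [add_comm, add_assoc, one_add_one_eq_two]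
  have h3 : (2 : ℝ≥0∞) = ENNReal.ofReal 2 := by simp
  have he := excess_le (n - 1)
  have he0 := excess_nonneg (n - 1)
  rw [h3, ← ENNReal.ofReal_add (by positivity) zero_le_two]
  refine ENNReal.ofReal_le_ofReal ?_
  have h4 : ((Nat.log 2 n + 1 : ℕ) : ℝ) ≤ 2 * ℓ := by
    have := Real.natLog_le_logb n 2
    push_cast at this ⊢
    linarith
  have h5 : excess (n - 1) ≤ n := he.trans (by exact_mod_cast Nat.sub_le n 1)
  have h6 : excess (n - 1) * ((Nat.log 2 n + 1 : ℕ) : ℝ) ≤ n * (2 * ℓ) := by gcongr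
  have h7 : (n : ℝ) * 1 ≤ n * ℓ := by gcongr
  -- The depth is at most `2 * ℓ`, so the bracket is at most `13 * (n * ℓ)`; the leading constant
  -- `50000 * 9 * 13` is below `10 ^ 7`.
  have h8 : 50000 * (3 * ℓ) ^ 2 * (n + 6 * excess (n - 1) * ((Nat.log 2 n + 1 : ℕ) : ℝ)) ≤
      50000 * (3 * ℓ) ^ 2 * (13 * (n * ℓ)) := by
    refine mul_le_mul_of_nonneg_left ?_ (by positivity)
    linarith
  have h9 : 1 ≤ ℓ ^ 3 := one_le_pow₀ hℓ1
  have h10 : (2 : ℝ) * 1 ≤ n * ℓ ^ 3 := by gcongr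
  linarith

end Main

end Limits

theorem heapSelect_solves : heapSelect.Solves := by
  intro val hv n hn
  obtain ⟨X, hX⟩ := Limits.exists_isRank_root hv hn
  have hne : (Limits.select val n X).total (heapSelect.init n) ≠ ⊤ := by
    rcases (by omega : n = 1 ∨ 2 ≤ n) with h1 | h2
    · exact ne_top_of_le_ne_top (by norm_num) (Limits.total_select_one hv hX h1)
    · exact ne_top_of_le_ne_top ENNReal.ofReal_ne_top (Limits.total_select hv hX h2)
  refine Limits.tendsto_of_total_ne_top (E := Limits.select val n X) hne ?_
  rintro c ⟨f, hf, hf'⟩ ⟨g, hg, hg'⟩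
  rw [hf, List.mem_singleton] at hg
  subst hg
  exact ⟨X, Limits.isNthSmallest_of_isRank hX, g, hf, hf', hg'⟩

theorem heapSelect_usesSpace {n : ℕ} (hn : 2 ≤ n) :
    heapSelect.UsesSpace n (10 ^ 7 * Real.logb 2 n) (10 ^ 7 * Real.logb 2 n) := by
  intro val hv t c hc
  obtain ⟨X, hX⟩ := Limits.exists_isRank_root hv (one_le_two.trans hn)
  obtain ⟨h1, h2⟩ := Limits.fits_of_mem_support (E := Limits.select val n X)
    (ne_top_of_le_ne_top ENNReal.ofReal_ne_top (Limits.total_select hv hX hn)) hc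
  have hlog : (Nat.log 2 n : ℝ) ≤ Real.logb 2 n := by
    have := Real.natLog_le_logb n 2
    exact_mod_cast this
  have hlog1 : 1 ≤ Nat.log 2 n := Nat.log_pos one_lt_two hn
  have hlog1' : (1 : ℝ) ≤ Nat.log 2 n := by exact_mod_cast hlog1
  constructor
  · have : ((heapSelect.cells c : ℕ) : ℝ) ≤ 489 + 230 * Nat.log 2 n := by exact_mod_cast h1
    linarith
  · intro f hf i
    have h3 : f.words i ≤ n + 2 := h2 f hf i
    have h4 : (f.words i).size ≤ Nat.log 2 n + 2 := by
      rw [Nat.size_le]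
      have h5 := Nat.lt_pow_succ_log_self one_lt_two n
      have h6 : 2 ^ (Nat.log 2 n + 2) = 2 * 2 ^ (Nat.log 2 n + 1) := pow_succ' _ _
      have h7 : 2 ^ 2 ≤ 2 ^ (Nat.log 2 n + 1) := Nat.pow_le_pow_right two_pos (by omega)
      omega
    have h5 : ((f.words i).size : ℝ) ≤ Nat.log 2 n + 2 := by exact_mod_cast h4
    linarith

end ExplorableHeap

theorem mainTheorem1 :
    ∃ A : ExplorableHeap.Algorithm, A.Solves ∧
      ∃ C : ℝ, ∀ n : ℕ, 2 ≤ n →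
        (∀ val : ExplorableHeap.Node → ℝ, ExplorableHeap.IsHeap val →
          A.expectedTime val n ≤ ENNReal.ofReal (C * (n * Real.logb 2 n ^ 3)) ∧
          A.expectedTravel val n ≤ ENNReal.ofReal (C * (n * Real.logb 2 n ^ 3))) ∧
        A.UsesSpace n (C * Real.logb 2 n) (C * Real.logb 2 n) := by
  refine ⟨ExplorableHeap.heapSelect, ExplorableHeap.heapSelect_solves, 10 ^ 7, fun n hn =>
    ⟨fun val hv => ?_, ExplorableHeap.heapSelect_usesSpace hn⟩⟩
  obtain ⟨X, hX⟩ := ExplorableHeap.Limits.exists_isRank_root hv (one_le_two.trans hn)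
  have h := ExplorableHeap.Limits.total_select hv hX hn
  exact ⟨(ExplorableHeap.Limits.expectedTime_le
      (E := ExplorableHeap.Limits.select val n X) n).trans h,
    (ExplorableHeap.Limits.expectedTravel_le
      (E := ExplorableHeap.Limits.select val n X) n).trans h⟩
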